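/- **Conventions.** Let $S^1=\mathbb R/\mathbb Z$ and let $(M,\omega)$ be a symplectic manifold. For $H\in C_c^\infty(S^1\times M)$ the Hamiltonian vector fields are given by $\omega(X_H^t,\cdot)=-dH_t$, and $\{\phi_H^t\}$ is the isotopy they generate. A subset $X\subset M$ is *displaceable* if $\overline X\cap\phi^1_H(X)=\emptyset$ for some $H\in C_c^\infty(S^1\times M)$, and *stably displaceable* if $X\times T^1$ (with $T^1$ the zero section of $T^*T^1$) is displaceable in $M\times T^*T^1$. For an open symplectic manifold $N$, a compact subset $Y\subset N$ and a free homotopy class $\alpha\in[S^1,N]$, let $$C_{BPS}(N,Y;\alpha)=\inf\{K>0:\ \text{every }H\in C_c^\infty(S^1\times N)\text{ with }\inf_{S^1\times Y}H\ge K\text{ has a 1-periodic trajectory in the class }\alpha\}\in[0,\infty].$$ For $R\in(\mathbb R_{>0})^n$ put $I_R^n=\{p\in\mathbb R^n: |p_i|<R_i \text{ for all } i\}$, and let $T^n=(\mathbb R/\mathbb Z)^n$. For $(M,\omega)$ connected, $X\subset M$ compact and $e\in\mathbb Z^n$, let $$C(M,X,R;e)=C_{BPS}\bigl(M\times I_R^n\times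 T^n,\ X\times\{0\}\times T^n;\ (0_M,e)\bigr),$$ where $M\times I_R^n\times T^n$ carries the form $\omega+\sum_i dp_i\wedge dq_i$ and $(0_M,e)$ is the class of the loop $t\mapsto(x_0,0,te)$. **Statement.** Let $S^2=\{x^2+y^2+z^2=1\}\subset\mathbb R^3$ with its standard area form, and for $\varepsilon>0$ let $C_\varepsilon=\{(x,y,z)\in S^2: z=\pm\varepsilon\}$. 1. $C_\varepsilon$ is stably displaceable for every $\varepsilon>0$. 2. There is a constant $E>0$ such that for every $\varepsilon>0$, every $n$, every $R\in(\mathbb R_{>0})^n$ and every $e\in\mathbb Z^n$ such that $R_k>E$ and $e_k\ne0$ for some $k$, $$C(S^2,C_\varepsilon,R;e)=\infty .$$ 3. For $0<\varepsilon<\tfrac13$ the set $C_\varepsilon$ is not displaceable in $S^2$. 4. Consequently, for every $n\ge1$ the following assertion is false: for every closed connected symplectic manifold $(M,\omega)$ and every non-displaceable compact subset $X\subset M$, the equality $C(M,X,R;e)=\sum_{i=1}^nR_i|e_i|$ holds for all $R\in(\mathbb R_{>0})^n$ and $e\in\mathbb Z^n$. -/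

import Mathlib

open scoped Manifold ContDiff ENNReal Matrix

noncomputable section

/-! ## Two-forms and symplectic forms -/

section Forms

variable {E : Type*} [NormedAddCommGroup E] [NormedSpace ℝ E]
  {H : Type*} [TopologicalSpace H] (I : ModelWithCorners ℝ E H)
  (M : Type*) [TopologicalSpace M] [ChartedSpace H M]

/-- A field of bilinear forms on the tangent spaces of `M`. -/
abbrev TwoForm : Type _ :=
  ∀ x : M, TangentSpace I x →L[ℝ] TangentSpace I x →L[ℝ] ℝ

variable {I M}

/-- The coordinate expression of `σ` in the preferred chart around `x₀`: the pullback of `σ` under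
the inverse of that chart. -/
def TwoForm.inChart (σ : TwoForm I M) (x₀ : M) (y : E) : E →L[ℝ] E →L[ℝ] ℝ :=
  let D : E →L[ℝ] E := mfderiv 𝓘(ℝ, E) I (extChartAt I x₀).symm y
  let B : E →L[ℝ] E →L[ℝ] ℝ := σ ((extChartAt I x₀).symm y)
  B.bilinearComp D D

/-- `σ` is a symplectic form on the manifold without boundary `M`: a smooth, alternating,
nondegenerate, closed two-form. Closedness is `dσ = 0`, evaluated in charts on constant vector
fields. -/
structure TwoForm.IsSymplectic (σ : TwoForm I M) : Prop where
  alternating : ∀ (x : M) (v : TangentSpace I x), σ x v v = 0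
  nondegenerate : ∀ (x : M) (v : TangentSpace I x), (∀ w, σ x v w = 0) → v = 0
  smooth : ∀ x₀ : M, ContDiffOn ℝ ∞ (σ.inChart x₀) (extChartAt I x₀).target
  closed : ∀ x₀ : M, ∀ y ∈ (extChartAt I x₀).target, ∀ u v w : E,
    fderiv ℝ (σ.inChart x₀) y u v w + fderiv ℝ (σ.inChart x₀) y v w u
      + fderiv ℝ (σ.inChart x₀) y w u v = 0

end Forms

/-! ## Hamiltonian dynamics -/

section Dynamics

variable {E : Type*} [NormedAddCommGroup E] [NormedSpace ℝ E]
  {H : Type*} [TopologicalSpace H] {I : ModelWithCorners ℝ E H}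
  {M : Type*} [TopologicalSpace M] [ChartedSpace H M]

variable (I) in
/-- `F ∈ C_c^∞(S¹ × M)`, where `S¹ = ℝ/ℤ`. Smoothness is tested on the covering `ℝ × M`. -/
structure IsHamiltonian (F : UnitAddCircle → M → ℝ) : Prop where
  smooth : ContMDiff (𝓘(ℝ, ℝ).prod I) 𝓘(ℝ, ℝ) ∞ (fun z : ℝ × M => F (z.1 : UnitAddCircle) z.2)
  compactSupport : HasCompactSupport (fun z : UnitAddCircle × M => F z.1 z.2)

/-- `v` is the value at `x` of the Hamiltonian vector field of `f`, i.e. `σ(v, ·) = -df`. -/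
def IsHamiltonianVector (σ : TwoForm I M) (f : M → ℝ) (x : M) (v : TangentSpace I x) : Prop :=
  ∀ w : TangentSpace I x, σ x v w = -(mvfderiv I f x w)

/-- `γ` solves `γ'(t) = X_F^t(γ(t))` for all `t`. -/
def IsHamiltonianTrajectory (σ : TwoForm I M) (F : UnitAddCircle → M → ℝ) (γ : ℝ → M) : Prop :=
  ∀ t : ℝ, ∃ v : TangentSpace I (γ t), IsHamiltonianVector σ (F (t : UnitAddCircle)) (γ t) v ∧
    HasMFDerivAt 𝓘(ℝ, ℝ) I γ t ((1 : ℝ →L[ℝ] ℝ).smulRight v)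

/-- `φ` is the Hamiltonian isotopy generated by `F`: `φ t x` is the position at time `t` of the
trajectory that starts at `x` at time `0`. -/
def IsHamiltonianIsotopy (σ : TwoForm I M) (F : UnitAddCircle → M → ℝ) (φ : ℝ → M → M) : Prop :=
  ∀ x : M, φ 0 x = x ∧ IsHamiltonianTrajectory σ F (fun t => φ t x)

/-- `X` is displaceable: `closure X` is disjoint from `φ¹(X)` for the time-one map `φ¹` of some
compactly supported Hamiltonian. -/
def Displaceable (σ : TwoForm I M) (X : Set M) : Prop :=
  ∃ (F : UnitAddCircle → M → ℝ) (φ : ℝ → M → M), IsHamiltonian I F ∧ IsHamiltonianIsotopy σ F φ ∧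
    Disjoint (closure X) (φ 1 '' X)

/-- Free homotopy of loops. -/
def freeLoopSetoid (N : Type*) [TopologicalSpace N] : Setoid C(UnitAddCircle, N) :=
  ⟨ContinuousMap.Homotopic, ContinuousMap.Homotopic.equivalence⟩

/-- The set `[S¹, N]` of free homotopy classes of loops. -/
def FreeLoopClass (N : Type*) [TopologicalSpace N] : Type _ := Quotient (freeLoopSetoid N)

/-- The free homotopy class of a loop. -/
def FreeLoopClass.mk {N : Type*} [TopologicalSpace N] (z : C(UnitAddCircle, N)) :
    FreeLoopClass N :=
  Quotient.mk (freeLoopSetoid N) z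

/-- The set `P(F; α)` of `1`-periodic trajectories in the class `α` (such loops are automatically
smooth). -/
def periodicTrajectories (σ : TwoForm I M) (F : UnitAddCircle → M → ℝ) (α : FreeLoopClass M) :
    Set C(UnitAddCircle, M) :=
  {z | FreeLoopClass.mk z = α ∧ IsHamiltonianTrajectory σ F (fun t : ℝ => z (t : UnitAddCircle))}

/-- The Biran-Polterovich-Salamon capacity: the infimum of all `K > 0` such that every
`F ∈ C_c^∞(S¹ × N)` with `F ≥ K` on `S¹ × Y` has a `1`-periodic trajectory in the class `α`
(and `∞` if there is no such `K`). -/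
def bpsCapacity (σ : TwoForm I M) (Y : Set M) (α : FreeLoopClass M) : ℝ≥0∞ :=
  ⨅ (K : ℝ) (_ : 0 < K ∧ ∀ F : UnitAddCircle → M → ℝ, IsHamiltonian I F →
    (∀ t, ∀ y ∈ Y, K ≤ F t y) → (periodicTrajectories σ F α).Nonempty), ENNReal.ofReal K

end Dynamics

/-! ## The torus and the products `M × I_R^n × T^n`, `M × T^*T^n` -/

/-- The torus `T^n = (ℝ/ℤ)^n`. -/
abbrev Torus (n : ℕ) : Type := Fin n → UnitAddCircle

/-- The inverse of the restriction of the projection `ℝ^n → T^n` to the open unit cube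
`∏ᵢ (aᵢ, aᵢ + 1)`. -/
def torusChart {n : ℕ} (a : Fin n → ℝ) : OpenPartialHomeomorph (Torus n) (Fin n → ℝ) :=
  (OpenPartialHomeomorph.pi fun i => AddCircle.openPartialHomeomorphCoe (1 : ℝ) (a i)).symm

/-- The manifold structure of `T^n`, with the local inverses of `ℝ^n → T^n` as charts. Hence every
tangent space of `T^n` is identified with `ℝ^n` by the differential of this projection. -/
instance torusChartedSpace (n : ℕ) : ChartedSpace (Fin n → ℝ) (Torus n) where
  atlas := Set.range torusChart
  chartAt q := torusChart fun i => (AddCircle.equivIco (1 : ℝ) 0 (q i) : ℝ) - 1 / 2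
  mem_chart_source q := by
    intro i _
    change q i ∈ ({_}ᶜ : Set UnitAddCircle)
    simp only [Set.mem_compl_iff, Set.mem_singleton_iff]
    intro h
    have h1 : ((AddCircle.equivIco (1 : ℝ) 0 (q i) : ℝ) : UnitAddCircle) = q i :=
      (AddCircle.equivIco (1 : ℝ) 0).symm_apply_apply (q i)
    rw [AddCircle.coe_sub, h1, eq_comm, sub_eq_self, AddCircle.coe_eq_zero_iff] at h
    obtain ⟨k, hk⟩ := h
    simp only [zsmul_eq_mul, mul_one] at hk
    have h2 : ((2 * k : ℤ) : ℝ) = ((1 : ℤ) : ℝ) := by push_cast; linarith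
    have h3 : 2 * k = 1 := by exact_mod_cast h2
    omega
  chart_mem_atlas q := ⟨_, rfl⟩

instance torusIsManifold (n : ℕ) : IsManifold 𝓘(ℝ, Fin n → ℝ) ∞ (Torus n) := by
  refine isManifold_of_contDiffOn _ _ _ ?_
  rintro _ _ ⟨a, rfl⟩ ⟨b, rfl⟩
  intro x hx
  apply ContDiffAt.contDiffWithinAt
  rw [contDiffAt_pi]
  intro i
  have hx2 : ((x i : ℝ) : UnitAddCircle) ≠ ((b i : ℝ) : UnitAddCircle) := by
    have h := hx.1.2 i (Set.mem_univ i)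
    exact h
  have hx3 : ¬ (x i) ≡ (b i) [PMOD (1 : ℝ)] :=
    AddCommGroup.not_modEq_iff_ne_mod_zmultiples.mpr hx2
  have h4 := (eventuallyEq_toIcoDiv_nhds (zero_lt_one (α := ℝ)) (b i) hx3)
  have h5 : Filter.Tendsto (fun y : Fin n → ℝ => y i) (nhds x) (nhds (x i)) :=
    (continuous_apply i).continuousAt
  have h6 : ContDiffAt ℝ ∞
      (fun y : Fin n → ℝ => y i - toIcoDiv (zero_lt_one (α := ℝ)) (b i) (x i) • (1 : ℝ)) x := by
    fun_prop
  refine h6.congr_of_eventuallyEq ?_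
  filter_upwards [h5.eventually h4] with y hy
  rw [← hy]
  rfl

/-- The open box `I_R^n = {p ∈ ℝ^n : |pᵢ| < Rᵢ for all i}`. -/
def box {n : ℕ} (R : Fin n → {r : ℝ // 0 < r}) : TopologicalSpace.Opens (Fin n → ℝ) :=
  ⟨{p | ∀ i, |p i| < (R i : ℝ)}, by
    have h : {p : Fin n → ℝ | ∀ i, |p i| < (R i : ℝ)} = ⋂ i, {p | |p i| < (R i : ℝ)} := by
      ext; simp
    rw [h]
    exact isOpen_iInter_of_finite fun i => isOpen_lt (by fun_prop) continuous_const⟩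

/-- The bilinear form `∑ᵢ dpᵢ ∧ dqᵢ` on `ℝ^n × ℝ^n` with coordinates `(p, q)`. -/
def stdSymplectic (n : ℕ) :
    ((Fin n → ℝ) × (Fin n → ℝ)) →L[ℝ] ((Fin n → ℝ) × (Fin n → ℝ)) →L[ℝ] ℝ :=
  let dp (i : Fin n) : ((Fin n → ℝ) × (Fin n → ℝ)) →L[ℝ] ℝ :=
    (ContinuousLinearMap.proj i).comp (ContinuousLinearMap.fst ℝ _ _)
  let dq (i : Fin n) : ((Fin n → ℝ) × (Fin n → ℝ)) →L[ℝ] ℝ :=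
    (ContinuousLinearMap.proj i).comp (ContinuousLinearMap.snd ℝ _ _)
  ∑ i, ((dp i).smulRight (dq i) - (dq i).smulRight (dp i))

theorem stdSymplectic_apply (n : ℕ) (v w : (Fin n → ℝ) × (Fin n → ℝ)) :
    stdSymplectic n v w = ∑ i, (v.1 i * w.2 i - v.2 i * w.1 i) := by
  simp [stdSymplectic]

section Product

variable {E : Type*} [NormedAddCommGroup E] [NormedSpace ℝ E]
  {H : Type*} [TopologicalSpace H] {I : ModelWithCorners ℝ E H}
  {M : Type*} [TopologicalSpace M] [ChartedSpace H M]

/-- The form `pr₁^*σ + pr₂^*σ₀` on `M × P × T^n`, where `σ₀ = ∑ᵢ dpᵢ ∧ dqᵢ` and `P` is an open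
subset of `ℝ^n` or `ℝ^n` itself (so that `T_pP = ℝ^n`, and `T_qT^n = ℝ^n` as above). -/
def productForm (σ : TwoForm I M) (n : ℕ) (P : Type) [TopologicalSpace P]
    [ChartedSpace (Fin n → ℝ) P] :
    TwoForm (I.prod (𝓘(ℝ, Fin n → ℝ).prod 𝓘(ℝ, Fin n → ℝ))) (M × P × Torus n) := fun z =>
  let B : E →L[ℝ] E →L[ℝ] ℝ := σ z.1
  let B' : (E × (Fin n → ℝ) × (Fin n → ℝ)) →L[ℝ] (E × (Fin n → ℝ) × (Fin n → ℝ)) →L[ℝ] ℝ :=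
    B.bilinearComp (ContinuousLinearMap.fst ℝ _ _) (ContinuousLinearMap.fst ℝ _ _) +
      (stdSymplectic n).bilinearComp (ContinuousLinearMap.snd ℝ _ _)
        (ContinuousLinearMap.snd ℝ _ _)
  B'

/-- `X` is `n`-stably displaceable: `X × T^n` is displaceable in `M × T^*T^n`, where
`T^*T^n = ℝ^n × T^n` and `T^n` is its zero section. -/
def NStablyDisplaceable (n : ℕ) (σ : TwoForm I M) (X : Set M) : Prop :=
  Displaceable (productForm σ n (Fin n → ℝ)) {z | z.1 ∈ X ∧ z.2.1 = 0}

/-- `X` is stably displaceable. -/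
def StablyDisplaceable (σ : TwoForm I M) (X : Set M) : Prop := NStablyDisplaceable 1 σ X

/-- The loop `t ↦ (x₀, 0, t e)` in `M × I_R^n × T^n`. -/
def standardLoop (x₀ : M) {n : ℕ} (R : Fin n → {r : ℝ // 0 < r}) (e : Fin n → ℤ) :
    C(UnitAddCircle, M × box R × Torus n) where
  toFun t := (x₀, ⟨0, fun i => by simpa using (R i).2⟩, fun i => e i • t)
  continuous_toFun := by fun_prop

/-- The capacity `C(M, X, R; e) = C_BPS(M × I_R^n × T^n, X × T^n; (0_M, e))` of a subset `X` of the
connected manifold `M`. As `M` is connected, the class `(0_M, e)` does not depend on the base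
point. -/
def relativeCapacity [Nonempty M] (σ : TwoForm I M) (X : Set M) {n : ℕ}
    (R : Fin n → {r : ℝ // 0 < r}) (e : Fin n → ℤ) : ℝ≥0∞ :=
  bpsCapacity (productForm σ n (box R)) {z | z.1 ∈ X ∧ (z.2.1 : Fin n → ℝ) = 0}
    (FreeLoopClass.mk (standardLoop (Classical.arbitrary M) R e))

end Product

/-- The assertion that, for the given `n`, every non-displaceable compact subset `X` of every
closed connected symplectic manifold satisfies `C(M, X, R; e) = ∑ᵢ Rᵢ |eᵢ|` for all `R` and `e`. -/
def NonDisplaceableCapacityFormula (n : ℕ) : Prop :=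
  ∀ (d : ℕ) (M : Type) [TopologicalSpace M] [ChartedSpace (EuclideanSpace ℝ (Fin d)) M]
    [IsManifold (𝓡 d) ∞ M] [T2Space M] [CompactSpace M] [ConnectedSpace M]
    (σ : TwoForm (𝓡 d) M), σ.IsSymplectic →
    ∀ X : Set M, IsCompact X → ¬ Displaceable σ X →
    ∀ (R : Fin n → {r : ℝ // 0 < r}) (e : Fin n → ℤ),
      relativeCapacity σ X R e = ENNReal.ofReal (∑ i, (R i : ℝ) * |(e i : ℝ)|)

/-! ## The round sphere -/

/-- The unit sphere in `ℝ³`. -/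
abbrev S2 : Type := Metric.sphere (0 : EuclideanSpace ℝ (Fin 3)) 1

instance : Nonempty S2 := NormedSpace.sphere_nonempty_rclike ℝ zero_le_one

/-- The triple product `x · (u × v)` as a bilinear form in `u, v`. -/
def tripleProduct (x : EuclideanSpace ℝ (Fin 3)) :
    EuclideanSpace ℝ (Fin 3) →L[ℝ] EuclideanSpace ℝ (Fin 3) →L[ℝ] ℝ :=
  (LinearMap.mk₂ ℝ (fun u v : EuclideanSpace ℝ (Fin 3) => x.ofLp ⬝ᵥ (u.ofLp ⨯₃ v.ofLp))
    (by simp) (by simp) (by simp) (by simp)).toContinuousBilinearMap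

/-- The standard area form on the sphere: `(u, v) ↦ x · (u × v)` for `u, v ∈ T_xS² ⊆ ℝ³`. -/
def areaForm : TwoForm (𝓡 2) S2 := fun x =>
  let D : EuclideanSpace ℝ (Fin 2) →L[ℝ] EuclideanSpace ℝ (Fin 3) :=
    mvfderiv (𝓡 2) (fun y : S2 => (y : EuclideanSpace ℝ (Fin 3))) x
  let B : EuclideanSpace ℝ (Fin 2) →L[ℝ] EuclideanSpace ℝ (Fin 2) →L[ℝ] ℝ :=
    (tripleProduct x).bilinearComp D D
  B

/-- The set `C_ε = {(x, y, z) ∈ S² : z = ±ε}`. -/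
def circlePair (ε : ℝ) : Set S2 :=
  {x | (x : EuclideanSpace ℝ (Fin 3)) 2 = ε ∨ (x : EuclideanSpace ℝ (Fin 3)) 2 = -ε}

end

/-!
The first two statements rest on one family of Hamiltonians on `S² × ℝⁿ × Tⁿ` (coordinates
`(x, y, z)` on the sphere, `(p, q)` on the cotangent bundle of the torus), `twistHamiltonian`. Put
`P = p + 2πz eₖ` and consider the frame on the sphere that rotates about the `z`-axis with the angle
`2πqₖ`. Passing to `P` and to this frame is a symplectic change of coordinates. Hence a function
`W(P) y₁`, where `y₁` is the second coordinate in the rotating frame, generates the rotation of the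
sphere about the second axis of that frame with angular velocity `W(P)`; it conserves `P` and `y₁`,
and `qₖ` moves with velocity `y₁ ∂ₖW(P)`.

* Where `W = π`, the time-one map changes `z` into `-z`. As `P` is conserved, `pₖ` changes by `4πz`.
  This is not `0` on `C_ε`, so that `C_ε × Tⁿ` is displaced (`nStablyDisplaceable_circlePair`).
* Add `z M(P)` to this Hamiltonian. On a `1`-periodic trajectory with `W(P) = π` and
  `∂ₖW(P) = 0`, `z(1) = -z(0)` forces `z(1) = 0`, and then the increment `z(1) ∂ₖM(P)` of `qₖ`
  vanishes. If `∂ₖM = 0` and `|∂ₖW| < 1` at all other values of `P`, then the increment of `qₖ`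
  is less than `1` in absolute value on all other trajectories
  (`twistHamiltonian_displacement`). So no `1`-periodic trajectory has the class `e` if `eₖ ≠ 0`.
  On the other hand, `z M(2πz eₖ)` is as large as desired on `C_ε` for `M(s eₖ) = c s` with large `c`.
  The support of `M` and `W` in the direction `k` has a fixed size, because a cutoff function from `π`
  to `0` with slope less than `1` fits into a fixed interval (`exists_profiles`). This gives
  `relativeCapacity_circlePair_eq_top`.

The third statement is a matter of areas. Extending a Hamiltonian on the sphere to `ℝ³` homogeneously
of degree one, the Hamiltonian vector field becomes the divergence-free field `x × ∇F`, and the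
isotopy extends to the cone over the sphere. An Euler scheme for divergence-free fields
(`IsSolenoidal.volume_le_volume_timeOne`) shows that the time-one map does not decrease the areas of
compact sets (`sphereMeasure_le_image`). For `ε < 1/3` the zone `|z| < ε` has less area than each of the
two caps, by Archimedes' hat-box theorem (`sphereMeasure_zone_shift`), and connectedness
leaves no room for the image of `C_ε` outside `C_ε`
(`IsAreaNondecreasing.not_disjoint_circlePair`).

The last statement combines the second and the third, as the area form is symplectic
(`areaForm_isSymplectic`) and the sum `∑ Rᵢ |eᵢ|` is finite.
-/

open scoped Manifold ContDiff ENNReal Matrix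

noncomputable section

/-! ### The sphere, the torus and their products -/

/-- The model space of the sphere. -/
abbrev E2 : Type := EuclideanSpace ℝ (Fin 2)
/-- The ambient space of the sphere. -/
abbrev E3 : Type := EuclideanSpace ℝ (Fin 3)

instance finrank_E3 : Fact (Module.finrank ℝ (EuclideanSpace ℝ (Fin 3)) = 2 + 1) :=
  ⟨by simp⟩

/-- The derivative of a pair of maps into normed spaces. Unlike in `HasMFDerivAt.prodMk`, the target
is the normed space `E' × E''` and not a product of manifolds. -/
theorem hasMFDerivAt_prodMk_space {E H M E' E'' : Type*} [NormedAddCommGroup E] [NormedSpace ℝ E]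
    [TopologicalSpace H] {I : ModelWithCorners ℝ E H} [TopologicalSpace M] [ChartedSpace H M]
    [NormedAddCommGroup E'] [NormedSpace ℝ E'] [NormedAddCommGroup E''] [NormedSpace ℝ E'']
    {f : M → E'} {g : M → E''} {x : M} {f' : E →L[ℝ] E'} {g' : E →L[ℝ] E''}
    (hf : HasMFDerivAt I 𝓘(ℝ, E') f x f') (hg : HasMFDerivAt I 𝓘(ℝ, E'') g x g') :
    HasMFDerivAt I 𝓘(ℝ, E' × E'') (fun y => (f y, g y)) x (f'.prod g') := by
  rw [modelWithCornersSelf_prod, ← chartedSpaceSelf_prod]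
  exact HasMFDerivAt.prodMk hf hg

/-- The derivative of the inclusion `S² ⊆ ℝ³`. -/
def sphereD (x : S2) : E2 →L[ℝ] E3 := mvfderiv (𝓡 2) (fun y : S2 => (y : E3)) x

theorem hasMFDerivAt_sphere_coe (x : S2) :
    HasMFDerivAt (𝓡 2) 𝓘(ℝ, E3) (fun y : S2 => (y : E3)) x (sphereD x) :=
  ((contMDiff_coe_sphere (m := 1) x).mdifferentiableAt one_ne_zero).hasMFDerivAt

theorem sphereD_injective (x : S2) : Function.Injective (sphereD x) :=
  injective_mvfderiv_subtypeVal_sphere x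

theorem mem_range_sphereD (x : S2) (w : E3) :
    w ∈ Set.range (sphereD x) ↔ inner ℝ (x : E3) w = 0 := by
  have h := range_mvfderiv_subtypeVal (n := 2) x
  have h2 : w ∈ Set.range (sphereD x) ↔ w ∈ (mvfderiv (𝓡 2) ((↑) : S2 → E3) x).range := Iff.rfl
  rw [h2, h, Submodule.mem_orthogonal_singleton_iff_inner_right]

theorem inner_sphereD (x : S2) (v : E2) : inner ℝ (x : E3) (sphereD x v) = 0 :=
  (mem_range_sphereD x _).1 ⟨v, rfl⟩

theorem E3_inner (u v : E3) : inner ℝ u v = u 0 * v 0 + u 1 * v 1 + u 2 * v 2 := by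
  simp [PiLp.inner_apply, Fin.sum_univ_three]
  ring

theorem S2_normSq (x : S2) : (x : E3) 0 ^ 2 + (x : E3) 1 ^ 2 + (x : E3) 2 ^ 2 = 1 := by
  have h : ‖(x : E3)‖ = 1 := by simp
  have h2 := E3_inner (x : E3) x
  rw [real_inner_self_eq_norm_sq, h] at h2
  linarith

theorem tripleProduct_apply (x u v : E3) : tripleProduct x u v =
    x 0 * (u 1 * v 2 - u 2 * v 1) + x 1 * (u 2 * v 0 - u 0 * v 2) +
      x 2 * (u 0 * v 1 - u 1 * v 0) := by
  simp [tripleProduct, LinearMap.toContinuousBilinearMap, cross_apply, dotProduct,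
    Fin.sum_univ_three]

theorem areaForm_apply (x : S2) (u v : E2) :
    areaForm x u v = tripleProduct x (sphereD x u) (sphereD x v) := rfl

section
variable {n : ℕ} {P : Type} [TopologicalSpace P] [ChartedSpace (Fin n → ℝ) P]

theorem productForm_apply (z : S2 × P × Torus n) (v w : E2 × (Fin n → ℝ) × (Fin n → ℝ)) :
    productForm areaForm n P z v w = areaForm z.1 v.1 w.1 +
      ∑ i, (v.2.1 i * w.2.2 i - v.2.2 i * w.2.1 i) := by
  have h := stdSymplectic_apply n v.2 w.2
  rw [← h]; rfl

end

/-- The projection `ℝ^n → T^n`. -/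
def torusMk {n : ℕ} (q : Fin n → ℝ) : Torus n := fun i => (q i : UnitAddCircle)

theorem torusMk_chartAt {n : ℕ} (Q₀ Q : Torus n) (h : Q ∈ (chartAt (Fin n → ℝ) Q₀).source) :
    torusMk (chartAt (Fin n → ℝ) Q₀ Q) = Q :=
  (chartAt (Fin n → ℝ) Q₀).left_inv h

/-- The identity map of `ℝ^n` stands for the derivative of a chart, because the tangent spaces of the
torus are identified with `ℝ^n` by the preferred charts. -/
theorem hasMFDerivAt_torus_chart {n : ℕ} (Q : Torus n) :
    HasMFDerivAt 𝓘(ℝ, Fin n → ℝ) 𝓘(ℝ, Fin n → ℝ) (chartAt (Fin n → ℝ) Q) Q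
      (ContinuousLinearMap.id ℝ (Fin n → ℝ)) := by
  have : IsManifold 𝓘(ℝ, Fin n → ℝ) 1 (Torus n) := IsManifold.of_le (n := ∞) (by simp)
  have h := (mdifferentiableAt_extChartAt (I := 𝓘(ℝ, Fin n → ℝ))
    (mem_chart_source (Fin n → ℝ) Q)).hasMFDerivAt
  rw [mfderiv_extChartAt_self] at h
  exact h

/-- A smooth local section of `ℝ^n → T^n` through a given point. -/
theorem exists_torus_section {n : ℕ} (q : Fin n → ℝ) :
    ∃ s : Torus n → (Fin n → ℝ), s (torusMk q) = q ∧ (∀ᶠ Q in nhds (torusMk q), torusMk (s Q) = Q) ∧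
      ContMDiffAt 𝓘(ℝ, Fin n → ℝ) 𝓘(ℝ, Fin n → ℝ) ∞ s (torusMk q) ∧
      HasMFDerivAt 𝓘(ℝ, Fin n → ℝ) 𝓘(ℝ, Fin n → ℝ) s (torusMk q)
        (ContinuousLinearMap.id ℝ (Fin n → ℝ)) := by
  set Q₀ := torusMk q
  set c := chartAt (Fin n → ℝ) Q₀
  set m : Fin n → ℝ := q - c Q₀ with hm
  have h0 : torusMk (c Q₀) = Q₀ := torusMk_chartAt Q₀ Q₀ (mem_chart_source _ _)
  have hm0 : ∀ i, ((m i : ℝ) : UnitAddCircle) = 0 := by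
    intro i
    have := congrFun h0 i
    simp only [torusMk, Q₀] at this
    simp only [hm, Pi.sub_apply, AddCircle.coe_sub]
    rw [sub_eq_zero]
    exact this.symm
  -- the chart followed by the integral translation that takes the base point to `q`
  refine ⟨fun Q => c Q + m, by simp [hm], ?_, ?_, ?_⟩
  · filter_upwards [c.open_source.mem_nhds (mem_chart_source _ _)] with Q hQ
    have := torusMk_chartAt Q₀ Q hQ
    funext i
    have h := congrFun this i
    simp only [torusMk, Pi.add_apply, AddCircle.coe_add, hm0, add_zero] at h ⊢
    exact h
  · have h1 : ContMDiffAt 𝓘(ℝ, Fin n → ℝ) 𝓘(ℝ, Fin n → ℝ) ∞ c Q₀ :=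
      contMDiffAt_extChartAt (I := 𝓘(ℝ, Fin n → ℝ)) (x := Q₀)
    exact h1.add contMDiffAt_const
  · have h2 : HasFDerivAt (fun y : Fin n → ℝ => y + m)
        (ContinuousLinearMap.id ℝ (Fin n → ℝ)) (c Q₀) := (hasFDerivAt_id _).add_const m
    have h3 := h2.hasMFDerivAt.comp Q₀ (hasMFDerivAt_torus_chart Q₀)
    exact h3

theorem torusMk_surjective {n : ℕ} : Function.Surjective (torusMk (n := n)) := by
  intro Q
  exact ⟨_, torusMk_chartAt Q Q (mem_chart_source _ _)⟩

section
variable {n : ℕ} {P : Type} [TopologicalSpace P] [ChartedSpace (Fin n → ℝ) P]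

/-- The model of `S² × P × T^n`, where `P` is modelled on `ℝ^n`. -/
abbrev prodModel (n : ℕ) : ModelWithCorners ℝ (E2 × (Fin n → ℝ) × (Fin n → ℝ))
    (ModelProd E2 (ModelProd (Fin n → ℝ) (Fin n → ℝ))) :=
  (𝓡 2).prod (𝓘(ℝ, Fin n → ℝ).prod 𝓘(ℝ, Fin n → ℝ))

/-- The derivative of a function on `S² × P × T^n` that is given by a function `g` on
`ℝ³ × ℝ^n × ℝ^n`. Here `ι : P → ℝ^n` is the inclusion of an open set, or the identity. -/
theorem hasMFDerivAt_of_lift {ι : P → Fin n → ℝ}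
    (hι : ∀ p, HasMFDerivAt 𝓘(ℝ, Fin n → ℝ) 𝓘(ℝ, Fin n → ℝ) ι p
      (ContinuousLinearMap.id ℝ (Fin n → ℝ)))
    {f : S2 × P × Torus n → ℝ} {g : E3 × (Fin n → ℝ) × (Fin n → ℝ) → ℝ}
    (hfg : ∀ x p q, f (x, p, torusMk q) = g (x, ι p, q))
    {x : S2} {p : P} {q : Fin n → ℝ} {g' : E3 × (Fin n → ℝ) × (Fin n → ℝ) →L[ℝ] ℝ}
    (hg : HasFDerivAt g g' ((x : E3), ι p, q)) :
    HasMFDerivAt (prodModel n) 𝓘(ℝ, ℝ) f (x, p, torusMk q)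
      (g'.comp ((sphereD x).prodMap (ContinuousLinearMap.id ℝ _))) := by
  obtain ⟨s, hs1, hs2, hs3, hs4⟩ := exists_torus_section q
  have h1 : HasMFDerivAt (prodModel n) 𝓘(ℝ, E3 × (Fin n → ℝ) × (Fin n → ℝ))
      (fun z : S2 × P × Torus n => ((z.1 : E3), ι z.2.1, s z.2.2)) (x, p, torusMk q)
      ((sphereD x).prodMap (ContinuousLinearMap.id ℝ ((Fin n → ℝ) × (Fin n → ℝ)))) := by
    have b1 := hasMFDerivAt_fst
      (I := 𝓡 2) (I' := 𝓘(ℝ, Fin n → ℝ).prod 𝓘(ℝ, Fin n → ℝ)) (M := S2) (M' := P × Torus n)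
      (x, p, torusMk q)
    have b2 := hasMFDerivAt_snd
      (I := 𝓡 2) (I' := 𝓘(ℝ, Fin n → ℝ).prod 𝓘(ℝ, Fin n → ℝ)) (M := S2) (M' := P × Torus n)
      (x, p, torusMk q)
    have b3 := hasMFDerivAt_fst
      (I := 𝓘(ℝ, Fin n → ℝ)) (I' := 𝓘(ℝ, Fin n → ℝ)) (M := P) (M' := Torus n) (p, torusMk q)
    have b4 := hasMFDerivAt_snd
      (I := 𝓘(ℝ, Fin n → ℝ)) (I' := 𝓘(ℝ, Fin n → ℝ)) (M := P) (M' := Torus n) (p, torusMk q)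
    have a1 := HasMFDerivAt.comp (f := Prod.fst) (x, p, torusMk q) (hasMFDerivAt_sphere_coe x) b1
    have a2 := HasMFDerivAt.comp (f := fun z : S2 × P × Torus n => z.2.1) (x, p, torusMk q) (hι p)
      (HasMFDerivAt.comp (f := Prod.snd) (x, p, torusMk q) b3 b2)
    have a3 := HasMFDerivAt.comp (f := fun z : S2 × P × Torus n => z.2.2) (x, p, torusMk q) hs4
      (HasMFDerivAt.comp (f := Prod.snd) (x, p, torusMk q) b4 b2)
    have a4 := hasMFDerivAt_prodMk_space a1 (hasMFDerivAt_prodMk_space a2 a3)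
    exact a4
  have hg2 : HasFDerivAt g g' ((x : E3), ι p, s (torusMk q)) := by rw [hs1]; exact hg
  have h2 := hg2.hasMFDerivAt.comp (x, p, torusMk q) h1
  refine h2.congr_of_eventuallyEq ?_
  have h3 : Filter.Tendsto (fun z : S2 × P × Torus n => z.2.2) (nhds (x, p, torusMk q))
      (nhds (torusMk q)) := (continuous_snd.comp continuous_snd).continuousAt
  filter_upwards [h3.eventually hs2] with z hz
  have := hfg z.1 z.2.1 (s z.2.2)
  rw [hz] at this
  exact this

theorem contMDiff_of_lift {ι : P → Fin n → ℝ}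
    (hι : ContMDiff 𝓘(ℝ, Fin n → ℝ) 𝓘(ℝ, Fin n → ℝ) ∞ ι)
    {f : ℝ × S2 × P × Torus n → ℝ} {g : ℝ × E3 × (Fin n → ℝ) × (Fin n → ℝ) → ℝ}
    (hfg : ∀ t x p q, f (t, x, p, torusMk q) = g (t, x, ι p, q)) (hg : ContDiff ℝ ∞ g) :
    ContMDiff (𝓘(ℝ, ℝ).prod (prodModel n)) 𝓘(ℝ, ℝ) ∞ f := by
  rintro ⟨t, x, p, Q⟩
  obtain ⟨q, rfl⟩ := torusMk_surjective Q
  obtain ⟨s, hs1, hs2, hs3, hs4⟩ := exists_torus_section q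
  have b1 : ContMDiffAt (𝓘(ℝ, ℝ).prod (prodModel n)) (prodModel n) ∞
    (fun z : ℝ × S2 × P × Torus n => z.2) (t, x, p, torusMk q) := contMDiffAt_snd
  have b2 : ContMDiffAt (𝓘(ℝ, ℝ).prod (prodModel n)) (𝓘(ℝ, Fin n → ℝ).prod 𝓘(ℝ, Fin n → ℝ)) ∞
    (fun z : ℝ × S2 × P × Torus n => z.2.2) (t, x, p, torusMk q) :=
      ContMDiffAt.comp (t, x, p, torusMk q) (contMDiffAt_snd (I := 𝓡 2) (M := S2)) b1
  have c1 : ContMDiffAt (𝓘(ℝ, ℝ).prod (prodModel n)) 𝓘(ℝ, E3) ∞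
    (fun z : ℝ × S2 × P × Torus n => (z.2.1 : E3)) (t, x, p, torusMk q) :=
      ContMDiffAt.comp (t, x, p, torusMk q) (contMDiff_coe_sphere x)
        (ContMDiffAt.comp (t, x, p, torusMk q) (contMDiffAt_fst (I := 𝓡 2) (M := S2)) b1)
  have c2 : ContMDiffAt (𝓘(ℝ, ℝ).prod (prodModel n)) 𝓘(ℝ, Fin n → ℝ) ∞
    (fun z : ℝ × S2 × P × Torus n => ι z.2.2.1) (t, x, p, torusMk q) :=
      ContMDiffAt.comp (t, x, p, torusMk q) (hι p)
        (ContMDiffAt.comp (t, x, p, torusMk q) (contMDiffAt_fst (I := 𝓘(ℝ, Fin n → ℝ)) (M := P)) b2)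
  have c3 : ContMDiffAt (𝓘(ℝ, ℝ).prod (prodModel n)) 𝓘(ℝ, Fin n → ℝ) ∞
    (fun z : ℝ × S2 × P × Torus n => s z.2.2.2) (t, x, p, torusMk q) :=
      ContMDiffAt.comp (t, x, p, torusMk q) hs3
        (ContMDiffAt.comp (t, x, p, torusMk q) (contMDiffAt_snd (I := 𝓘(ℝ, Fin n → ℝ)) (M := P)) b2)
  have c0 : ContMDiffAt (𝓘(ℝ, ℝ).prod (prodModel n)) 𝓘(ℝ, ℝ) ∞
    (fun z : ℝ × S2 × P × Torus n => z.1) (t, x, p, torusMk q) := contMDiffAt_fst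
  have d := c0.prodMk_space (c1.prodMk_space (c2.prodMk_space c3))
  have e := (hg.contMDiff.contMDiffAt).comp (t, x, p, torusMk q) d
  refine e.congr_of_eventuallyEq ?_
  have h3 : Filter.Tendsto (fun z : ℝ × S2 × P × Torus n => z.2.2.2)
      (nhds (t, x, p, torusMk q)) (nhds (torusMk q)) :=
    (continuous_snd.comp (continuous_snd.comp continuous_snd)).continuousAt
  filter_upwards [h3.eventually hs2] with z hz
  have := hfg z.1 z.2.1 z.2.2.1 (s z.2.2.2)
  rw [hz] at this
  exact this

end

/-! ### Hamilton's equations on `S² × ℝⁿ × Tⁿ` -/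

theorem continuous_torusMk {n : ℕ} : Continuous (torusMk (n := n)) := by
  unfold torusMk
  fun_prop

theorem torusMk_eq_iff {n : ℕ} (q q' : Fin n → ℝ) :
    torusMk q = torusMk q' ↔ ∀ i, ∃ m : ℤ, q i - q' i = m := by
  rw [funext_iff]
  refine forall_congr' fun i => ?_
  rw [torusMk, torusMk, ← sub_eq_zero, ← AddCircle.coe_sub, AddCircle.coe_eq_zero_iff]
  simp [eq_comm]

/-- In the preferred charts, the projection `ℝ^n → T^n` is a translation. -/
theorem chart_torusMk_eventually {n : ℕ} (q₀ : Fin n → ℝ) :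
    ∀ᶠ q in nhds q₀, chartAt (Fin n → ℝ) (torusMk q₀) (torusMk q) =
      q + (chartAt (Fin n → ℝ) (torusMk q₀) (torusMk q₀) - q₀) := by
  set c := chartAt (Fin n → ℝ) (torusMk q₀)
  set m := c (torusMk q₀) - q₀ with hm
  have h0 : torusMk (c (torusMk q₀)) = torusMk q₀ := torusMk_chartAt _ _ (mem_chart_source _ _)
  have h1 : ∀ q, torusMk (q + m) = torusMk q := by
    intro q
    rw [torusMk_eq_iff] at h0 ⊢
    intro i
    obtain ⟨k, hk⟩ := h0 i
    exact ⟨k, by simpa [hm] using hk⟩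
  have h2 : ∀ᶠ q in nhds q₀, q + m ∈ c.target := by
    have h3 : Filter.Tendsto (fun q : Fin n → ℝ => q + m) (nhds q₀) (nhds (q₀ + m)) :=
      (continuous_id.add continuous_const).continuousAt
    refine h3 (c.open_target.mem_nhds ?_)
    have : q₀ + m = c (torusMk q₀) := by simp [hm]
    rw [this]
    exact c.map_source (mem_chart_source _ _)
  filter_upwards [h2] with q hq
  have h4 : c (c.symm (q + m)) = q + m := c.right_inv hq
  have h5 : c.symm (q + m) = torusMk (q + m) := rfl
  rw [h5, h1] at h4
  exact h4

theorem hasMFDerivAt_torusMk {n : ℕ} (q : Fin n → ℝ) :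
    HasMFDerivAt 𝓘(ℝ, Fin n → ℝ) 𝓘(ℝ, Fin n → ℝ) torusMk q
      (ContinuousLinearMap.id ℝ (Fin n → ℝ)) := by
  refine ⟨continuous_torusMk.continuousAt, ?_⟩
  have h : HasFDerivAt (fun q' : Fin n → ℝ => chartAt (Fin n → ℝ) (torusMk q) (torusMk q'))
      (ContinuousLinearMap.id ℝ (Fin n → ℝ)) q :=
    ((hasFDerivAt_id q).add_const _).congr_of_eventuallyEq (chart_torusMk_eventually q)
  exact h.hasFDerivWithinAt

theorem hasDerivAt_of_hasMFDerivAt {E : Type*} [NormedAddCommGroup E] [NormedSpace ℝ E]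
    {f : ℝ → E} {t : ℝ} {L : ℝ →L[ℝ] E} (h : HasMFDerivAt 𝓘(ℝ, ℝ) 𝓘(ℝ, E) f t L) :
    HasDerivAt f (L 1) t := by
  have h' : HasFDerivAt f L t := HasMFDerivAt.hasFDerivAt h
  exact h'.hasDerivAt

/-- A continuous lift of a differentiable curve in `T^n` is differentiable, with the same velocity. -/
theorem hasDerivAt_of_torusMk {n : ℕ} {q : ℝ → Fin n → ℝ} {t : ℝ} {v : Fin n → ℝ}
    (hq : ContinuousAt q t)
    (h : HasMFDerivAt 𝓘(ℝ, ℝ) 𝓘(ℝ, Fin n → ℝ) (fun s => torusMk (q s)) t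
      ((1 : ℝ →L[ℝ] ℝ).smulRight v)) : HasDerivAt q v t := by
  have h1 := HasMFDerivAt.comp (f := fun s => torusMk (q s)) t
    (hasMFDerivAt_torus_chart (torusMk (q t))) h
  have h2 : HasFDerivAt (fun s => chartAt (Fin n → ℝ) (torusMk (q t)) (torusMk (q s)))
      ((1 : ℝ →L[ℝ] ℝ).smulRight v) t := HasMFDerivAt.hasFDerivAt h1
  have h3 := (h2.hasDerivAt.sub_const
    (chartAt (Fin n → ℝ) (torusMk (q t)) (torusMk (q t)) - q t)).congr_of_eventuallyEq
    (f₁ := q) (by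
      filter_upwards [hq.eventually (chart_torusMk_eventually (q t))] with s hs
      rw [hs]; simp)
  simpa using h3

/-- Hamilton's equations in the coordinates of `ℝ³ × ℝ^n × ℝ^n` at a point over `x`: the velocity
`(u, a, b)` of a Hamiltonian with differential `g'` is `u = x × ∂ₓg`, `a = -∂_q g`, `b = ∂_p g`. -/
def HamiltonEquations {n : ℕ} (x : E3) (g' : E3 × (Fin n → ℝ) × (Fin n → ℝ) →L[ℝ] ℝ)
    (u : E3) (a b : Fin n → ℝ) : Prop :=
  (u 0 = x 1 * g' (EuclideanSpace.single 2 1, 0, 0) - x 2 * g' (EuclideanSpace.single 1 1, 0, 0) ∧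
   u 1 = x 2 * g' (EuclideanSpace.single 0 1, 0, 0) - x 0 * g' (EuclideanSpace.single 2 1, 0, 0) ∧
   u 2 = x 0 * g' (EuclideanSpace.single 1 1, 0, 0) - x 1 * g' (EuclideanSpace.single 0 1, 0, 0)) ∧
  (∀ j, a j = -g' (0, 0, Pi.single j 1)) ∧ ∀ j, b j = g' (0, Pi.single j 1, 0)

theorem E3_decomp (w : E3) : w = w 0 • EuclideanSpace.single 0 1 + w 1 • EuclideanSpace.single 1 1 +
    w 2 • (EuclideanSpace.single 2 1 : E3) := by
  ext i
  fin_cases i <;> simp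

theorem linear_E3_apply (L : E3 →L[ℝ] ℝ) (w : E3) : L w =
    w 0 * L (EuclideanSpace.single 0 1) + w 1 * L (EuclideanSpace.single 1 1) +
      w 2 * L (EuclideanSpace.single 2 1) := by
  conv_lhs => rw [E3_decomp w]
  simp

/-- The contraction of the area form of the sphere with `u ∈ TₓS²` equals `-L` on `TₓS²` exactly
when `u = x × L`. -/
theorem areaForm_contract_iff (x : S2) (L : E3 →L[ℝ] ℝ) (v : E2) :
    (∀ w : E2, areaForm x v w = -L (sphereD x w)) ↔
    (sphereD x v 0 =
        (x : E3) 1 * L (EuclideanSpace.single 2 1) - (x : E3) 2 * L (EuclideanSpace.single 1 1) ∧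
      sphereD x v 1 =
        (x : E3) 2 * L (EuclideanSpace.single 0 1) - (x : E3) 0 * L (EuclideanSpace.single 2 1) ∧
      sphereD x v 2 =
        (x : E3) 0 * L (EuclideanSpace.single 1 1) - (x : E3) 1 * L (EuclideanSpace.single 0 1)) := by
  set u := sphereD x v with hu
  set l0 := L (EuclideanSpace.single 0 1)
  set l1 := L (EuclideanSpace.single 1 1)
  set l2 := L (EuclideanSpace.single 2 1)
  have hux : (x : E3) 0 * u 0 + (x : E3) 1 * u 1 + (x : E3) 2 * u 2 = 0 := by
    rw [← E3_inner]; exact inner_sphereD x v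
  have hx := S2_normSq x
  constructor
  · intro h
    have key : ∀ w : E3, (x : E3) 0 * w 0 + (x : E3) 1 * w 1 + (x : E3) 2 * w 2 = 0 →
        tripleProduct x u w = -(w 0 * l0 + w 1 * l1 + w 2 * l2) := by
      intro w hw
      rw [← E3_inner] at hw
      obtain ⟨w', rfl⟩ := (mem_range_sphereD x w).2 hw
      rw [← linear_E3_apply, ← h w', areaForm_apply]
    -- test against the vectors `eᵢ × x`
    have k0 := key !₂[0, -(x : E3) 2, (x : E3) 1] (by simp; ring)
    have k1 := key !₂[(x : E3) 2, 0, -(x : E3) 0] (by simp; ring)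
    have k2 := key !₂[-(x : E3) 1, (x : E3) 0, 0] (by simp; ring)
    rw [tripleProduct_apply] at k0 k1 k2
    simp at k0 k1 k2
    refine ⟨?_, ?_, ?_⟩
    · linear_combination (x : E3) 0 * hux - k0 - u 0 * hx
    · linear_combination (x : E3) 1 * hux - k1 - u 1 * hx
    · linear_combination (x : E3) 2 * hux - k2 - u 2 * hx
  · rintro ⟨h0, h1, h2⟩ w
    have hw : (x : E3) 0 * sphereD x w 0 + (x : E3) 1 * sphereD x w 1 +
        (x : E3) 2 * sphereD x w 2 = 0 := by
      rw [← E3_inner]; exact inner_sphereD x w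
    rw [areaForm_apply, tripleProduct_apply, ← hu, linear_E3_apply, h0, h1, h2]
    linear_combination ((x : E3) 0 * l0 + (x : E3) 1 * l1 + (x : E3) 2 * l2) * hw -
      (sphereD x w 0 * l0 + sphereD x w 1 * l1 + sphereD x w 2 * l2) * hx

section
variable {n : ℕ} {P : Type} [TopologicalSpace P] [ChartedSpace (Fin n → ℝ) P]

/-- The Hamiltonian vectors of a function on `S² × P × T^n` whose differential is induced by the linear
form `g'` on `ℝ³ × ℝ^n × ℝ^n` are the solutions of Hamilton's equations. -/
theorem isHamiltonianVector_iff {f : S2 × P × Torus n → ℝ} {z : S2 × P × Torus n}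
    {g' : E3 × (Fin n → ℝ) × (Fin n → ℝ) →L[ℝ] ℝ}
    (hf : HasMFDerivAt (prodModel n) 𝓘(ℝ, ℝ) f z
      (g'.comp ((sphereD z.1).prodMap (ContinuousLinearMap.id ℝ _))))
    (v : E2 × (Fin n → ℝ) × (Fin n → ℝ)) :
    IsHamiltonianVector (productForm areaForm n P) f z v ↔
      HamiltonEquations (z.1 : E3) g' (sphereD z.1 v.1) v.2.1 v.2.2 := by
  have h1 : ∀ w : E2 × (Fin n → ℝ) × (Fin n → ℝ), mvfderiv (prodModel n) f z w =
      g' (sphereD z.1 w.1, w.2.1, w.2.2) := by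
    intro w
    have : mvfderiv (prodModel n) f z =
        g'.comp ((sphereD z.1).prodMap (ContinuousLinearMap.id ℝ _)) := by
      have := hf.mfderiv
      unfold mvfderiv
      rw [this]
      rfl
    rw [this]
    rfl
  have hs : ∀ w : Fin n → ℝ, w = ∑ j, w j • (Pi.single j 1 : Fin n → ℝ) := fun w => by
    have := pi_eq_sum_univ' w
    convert this using 3 with j
  unfold HamiltonEquations
  have hc := areaForm_contract_iff z.1 (g'.comp (ContinuousLinearMap.inl ℝ _ _)) v.1
  have h2 : ∀ u : E3, (g'.comp (ContinuousLinearMap.inl ℝ E3 ((Fin n → ℝ) × (Fin n → ℝ)))) u =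
      g' (u, 0, 0) := fun u => rfl
  simp only [h2] at hc
  rw [← hc]
  have hz : areaForm z.1 v.1 (0 : E2) = 0 := map_zero (areaForm z.1 v.1)
  constructor
  · intro h
    refine ⟨?_, ?_, ?_⟩
    · intro w
      have := h ((w, 0, 0) : E2 × (Fin n → ℝ) × (Fin n → ℝ))
      rw [productForm_apply] at this
      erw [h1] at this
      simpa using this
    · intro j
      have := h ((0, 0, Pi.single j 1) : E2 × (Fin n → ℝ) × (Fin n → ℝ))
      rw [productForm_apply] at this
      erw [h1] at this
      rw [show areaForm z.1 v.1 ((0, _, _) : E2 × (Fin n → ℝ) × (Fin n → ℝ)).1 = 0 from hz] at this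
      simpa [Pi.single_apply] using this
    · intro j
      have := h ((0, Pi.single j 1, 0) : E2 × (Fin n → ℝ) × (Fin n → ℝ))
      rw [productForm_apply] at this
      erw [h1] at this
      rw [show areaForm z.1 v.1 ((0, _, _) : E2 × (Fin n → ℝ) × (Fin n → ℝ)).1 = 0 from hz] at this
      simpa [Pi.single_apply] using this
  · rintro ⟨ha, hb, hc⟩ (w : E2 × (Fin n → ℝ) × (Fin n → ℝ))
    rw [productForm_apply]
    erw [h1]
    have e1 : g' (sphereD z.1 w.1, w.2.1, w.2.2) = g' (sphereD z.1 w.1, 0, 0) +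
        (∑ j, w.2.1 j * g' (0, Pi.single j 1, 0) + ∑ j, w.2.2 j * g' (0, 0, Pi.single j 1)) := by
      have e2 : ∑ j, w.2.1 j * g' (0, Pi.single j 1, 0) = g' (0, w.2.1, 0) := by
        conv_rhs => rw [hs w.2.1]
        have := map_sum (g'.comp
          ((ContinuousLinearMap.inr ℝ E3 ((Fin n → ℝ) × (Fin n → ℝ))).comp
            (ContinuousLinearMap.inl ℝ (Fin n → ℝ) (Fin n → ℝ))))
          (fun j => w.2.1 j • (Pi.single j 1 : Fin n → ℝ)) Finset.univ
        simp only [map_smul] at this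
        exact this.symm
      have e3 : ∑ j, w.2.2 j * g' (0, 0, Pi.single j 1) = g' (0, 0, w.2.2) := by
        conv_rhs => rw [hs w.2.2]
        have := map_sum (g'.comp
          ((ContinuousLinearMap.inr ℝ E3 ((Fin n → ℝ) × (Fin n → ℝ))).comp
            (ContinuousLinearMap.inr ℝ (Fin n → ℝ) (Fin n → ℝ))))
          (fun j => w.2.2 j • (Pi.single j 1 : Fin n → ℝ)) Finset.univ
        simp only [map_smul] at this
        exact this.symm
      rw [e2, e3, ← map_add, ← map_add]
      congr 1
      ext <;> simp
    rw [e1, ha w.1, neg_add]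
    congr 1
    rw [← Finset.sum_add_distrib, ← Finset.sum_neg_distrib]
    refine Finset.sum_congr rfl fun j _ => ?_
    rw [hb, hc]
    ring

/-- A trajectory on `S² × P × T^n`, together with a lift of its torus component to `ℝ^n`, solves
Hamilton's equations in coordinates. -/
theorem hamiltonEquations_of_trajectory {ι : P → Fin n → ℝ}
    (hι : ∀ p, HasMFDerivAt 𝓘(ℝ, Fin n → ℝ) 𝓘(ℝ, Fin n → ℝ) ι p
      (ContinuousLinearMap.id ℝ (Fin n → ℝ)))
    {F : UnitAddCircle → S2 × P × Torus n → ℝ} {g : E3 × (Fin n → ℝ) × (Fin n → ℝ) → ℝ}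
    {t : ℝ} (hfg : ∀ x p q, F t (x, p, torusMk q) = g (x, ι p, q))
    (hg : Differentiable ℝ g)
    {x : ℝ → S2} {p : ℝ → P} {q : ℝ → Fin n → ℝ} (hq : ContinuousAt q t)
    {v : E2 × (Fin n → ℝ) × (Fin n → ℝ)}
    (hv : IsHamiltonianVector (productForm areaForm n P) (F t) (x t, p t, torusMk (q t)) v)
    (hγ : HasMFDerivAt 𝓘(ℝ, ℝ) (prodModel n) (fun s => (x s, p s, torusMk (q s))) t
      ((1 : ℝ →L[ℝ] ℝ).smulRight v)) :
    ∃ u a b, HasDerivAt (fun s => (x s : E3)) u t ∧ HasDerivAt (fun s => ι (p s)) a t ∧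
      HasDerivAt q b t ∧ HamiltonEquations (x t : E3) (fderiv ℝ g (x t, ι (p t), q t)) u a b := by
  have h0 := hasMFDerivAt_of_lift hι hfg (x := x t) (p := p t) (q := q t) (hg _).hasFDerivAt
  refine ⟨sphereD (x t) v.1, v.2.1, v.2.2, ?_, ?_, ?_, (isHamiltonianVector_iff h0 v).1 hv⟩
  · have h1 := HasMFDerivAt.comp (f := fun s => (x s, p s, torusMk (q s))) t
      (hasMFDerivAt_fst (I := 𝓡 2) (I' := 𝓘(ℝ, Fin n → ℝ).prod 𝓘(ℝ, Fin n → ℝ)) (M := S2)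
        (M' := P × Torus n) (x t, p t, torusMk (q t))) hγ
    have h2 := HasMFDerivAt.comp (f := x) t (hasMFDerivAt_sphere_coe (x t)) h1
    refine (hasDerivAt_of_hasMFDerivAt h2).congr_deriv ?_
    change sphereD (x t) ((1 : ℝ) • v.1) = _
    rw [one_smul]
  · have h1 := HasMFDerivAt.comp (f := fun s => (x s, p s, torusMk (q s))) t
      (hasMFDerivAt_snd (I := 𝓡 2) (I' := 𝓘(ℝ, Fin n → ℝ).prod 𝓘(ℝ, Fin n → ℝ)) (M := S2)
        (M' := P × Torus n) (x t, p t, torusMk (q t))) hγ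
    have h1' := HasMFDerivAt.comp (f := fun s => (p s, torusMk (q s))) t
      (hasMFDerivAt_fst (I := 𝓘(ℝ, Fin n → ℝ)) (I' := 𝓘(ℝ, Fin n → ℝ)) (M := P) (M' := Torus n)
        (p t, torusMk (q t))) h1
    have h2 := HasMFDerivAt.comp (f := p) t (hι (p t)) h1'
    refine (hasDerivAt_of_hasMFDerivAt h2).congr_deriv ?_
    change (1 : ℝ) • v.2.1 = _
    rw [one_smul]
  · have h1 := HasMFDerivAt.comp (f := fun s => (x s, p s, torusMk (q s))) t
      (hasMFDerivAt_snd (I := 𝓡 2) (I' := 𝓘(ℝ, Fin n → ℝ).prod 𝓘(ℝ, Fin n → ℝ)) (M := S2)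
        (M' := P × Torus n) (x t, p t, torusMk (q t))) hγ
    have h1' := HasMFDerivAt.comp (f := fun s => (p s, torusMk (q s))) t
      (hasMFDerivAt_snd (I := 𝓘(ℝ, Fin n → ℝ)) (I' := 𝓘(ℝ, Fin n → ℝ)) (M := P) (M' := Torus n)
        (p t, torusMk (q t))) h1
    exact hasDerivAt_of_torusMk hq h1'

/-- Conversely, solutions of Hamilton's equations in coordinates that stay on the sphere project to
trajectories on `S² × ℝ^n × T^n`. -/
theorem trajectory_of_hamiltonEquations {F : UnitAddCircle → S2 × (Fin n → ℝ) × Torus n → ℝ}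
    {g : E3 × (Fin n → ℝ) × (Fin n → ℝ) → ℝ}
    {t : ℝ} (hfg : ∀ x p q, F t (x, p, torusMk q) = g (x, p, q))
    (hg : Differentiable ℝ g)
    {x : ℝ → S2} {p : ℝ → Fin n → ℝ} {q : ℝ → Fin n → ℝ}
    (hx : ContDiff ℝ 1 (fun s => (x s : E3)))
    {u : E3} {a b : Fin n → ℝ} (hu : HasDerivAt (fun s => (x s : E3)) u t) (ha : HasDerivAt p a t)
    (hb : HasDerivAt q b t)
    (h : HamiltonEquations (x t : E3) (fderiv ℝ g (x t, p t, q t)) u a b) :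
    ∃ v : TangentSpace (prodModel n) (x t, p t, torusMk (q t)),
      IsHamiltonianVector (productForm areaForm n (Fin n → ℝ)) (F t) (x t, p t, torusMk (q t)) v ∧
      HasMFDerivAt 𝓘(ℝ, ℝ) (prodModel n) (fun s => (x s, p s, torusMk (q s))) t
        ((1 : ℝ →L[ℝ] ℝ).smulRight v) := by
  have h0 := hasMFDerivAt_of_lift (ι := id) (fun p => (hasFDerivAt_id p).hasMFDerivAt) hfg
    (x := x t) (p := p t) (q := q t) (hg _).hasFDerivAt
  have h1 : ContMDiff 𝓘(ℝ, ℝ) (𝓡 2) 1 x :=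
    ContMDiff.codRestrict_sphere (n := 2) hx.contMDiff (fun s => (x s).2)
  have h2 := ((h1 t).mdifferentiableAt one_ne_zero).hasMFDerivAt
  set x' : ℝ →L[ℝ] E2 := mfderiv 𝓘(ℝ, ℝ) (𝓡 2) x t
  have h3' : x' = (1 : ℝ →L[ℝ] ℝ).smulRight (x' 1) :=
    ContinuousLinearMap.ext_ring (one_smul ℝ (x' 1)).symm
  have h3 : HasMFDerivAt 𝓘(ℝ, ℝ) (𝓡 2) x t ((1 : ℝ →L[ℝ] ℝ).smulRight (x' 1)) :=
    Eq.subst (motive := fun L : ℝ →L[ℝ] E2 => HasMFDerivAt 𝓘(ℝ, ℝ) (𝓡 2) x t L) h3' h2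
  have h4 := HasMFDerivAt.comp (f := x) t (hasMFDerivAt_sphere_coe (x t)) h3
  have h5 : u = sphereD (x t) (x' 1) := by
    refine hu.unique ((hasDerivAt_of_hasMFDerivAt h4).congr_deriv ?_)
    change sphereD (x t) ((1 : ℝ) • x' 1) = _
    rw [one_smul]
  refine ⟨(x' 1, a, b), (isHamiltonianVector_iff h0 (x' 1, a, b)).2 ?_, ?_⟩
  · rw [h5] at h; exact h
  · have h6 := HasMFDerivAt.comp (f := q) t (hasMFDerivAt_torusMk (q t))
      hb.hasFDerivAt.hasMFDerivAt
    have h7 := HasMFDerivAt.prodMk h3 (HasMFDerivAt.prodMk ha.hasFDerivAt.hasMFDerivAt h6)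
    convert! h7 using 1

end

/-! ### The twisted Hamiltonians and their trajectories -/

/-- The sheared momentum `P = p + 2πz eₖ`. -/
def shear {n : ℕ} (k : Fin n) (x : E3) (p : Fin n → ℝ) : Fin n → ℝ :=
  p + (2 * Real.pi * x 2) • (Pi.single k 1 : Fin n → ℝ)

/-- The Hamiltonian `z M(P) + b W(P) (x sin Θ + y cos Θ)`, where `P = p + 2πz eₖ` and
`Θ = 2πqₖ + t M(P)`. The summand `t M(P)` of `Θ` adapts the frame to the rotation about the `z`-axis
with angular velocity `M(P)` that the first term `z M(P)` generates. -/
def twistHamiltonian {n : ℕ} (k : Fin n) (M W : (Fin n → ℝ) → ℝ) (t b : ℝ)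
    (w : E3 × (Fin n → ℝ) × (Fin n → ℝ)) : ℝ :=
  w.1 2 * M (shear k w.1 w.2.1) + b * W (shear k w.1 w.2.1) *
    (w.1 0 * Real.sin (2 * Real.pi * w.2.2 k + t * M (shear k w.1 w.2.1)) +
      w.1 1 * Real.cos (2 * Real.pi * w.2.2 k + t * M (shear k w.1 w.2.1)))

section
variable {n : ℕ} {k : Fin n} {M W : (Fin n → ℝ) → ℝ}

theorem contDiff_E3_coord (i : Fin 3) : ContDiff ℝ ∞ (fun x : E3 => x i) := by fun_prop

theorem contDiff_shear {m : WithTop ℕ∞} : ContDiff ℝ m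
    (fun w : E3 × (Fin n → ℝ) => shear k w.1 w.2) := by
  unfold shear
  fun_prop

theorem contDiff_twistHamiltonian (hM : ContDiff ℝ ∞ M) (hW : ContDiff ℝ ∞ W) {b : ℝ → ℝ}
    (hb : ContDiff ℝ ∞ b) : ContDiff ℝ ∞
      (fun w : ℝ × E3 × (Fin n → ℝ) × (Fin n → ℝ) => twistHamiltonian k M W w.1 (b w.1) w.2) := by
  have hP : ContDiff ℝ ∞ (fun w : ℝ × E3 × (Fin n → ℝ) × (Fin n → ℝ) => shear k w.2.1 w.2.2.1) := by
    unfold shear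
    fun_prop
  have h1 := hM.comp hP
  have h2 := hW.comp hP
  simp only [Function.comp_def] at h1 h2
  unfold twistHamiltonian
  fun_prop

theorem hasDerivAt_E3_coord {x : ℝ → E3} {u : E3} {t : ℝ} (h : HasDerivAt x u t) (i : Fin 3) :
    HasDerivAt (fun s => x s i) (u i) t := by
  have := (EuclideanSpace.proj (𝕜 := ℝ) i : E3 →L[ℝ] ℝ).hasFDerivAt.comp_hasDerivAt t h
  exact this

theorem hasDerivAt_shear {x : ℝ → E3} {p : ℝ → Fin n → ℝ} {u : E3} {a : Fin n → ℝ} {t : ℝ}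
    (hx : HasDerivAt x u t) (hp : HasDerivAt p a t) :
    HasDerivAt (fun s => shear k (x s) (p s)) (shear k u a) t := by
  unfold shear
  exact hp.add (((hasDerivAt_E3_coord hx 2).const_mul (2 * Real.pi)).smul_const _)

/-- The differential of `twistHamiltonian`, with `P` and `Θ` as there and `m = dM(δP)`. -/
theorem fderiv_twistHamiltonian_apply (hM : Differentiable ℝ M) (hW : Differentiable ℝ W) (t b : ℝ)
    (w v : E3 × (Fin n → ℝ) × (Fin n → ℝ)) :
    fderiv ℝ (twistHamiltonian k M W t b) w v =
      let P := shear k w.1 w.2.1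
      let Θ := 2 * Real.pi * w.2.2 k + t * M P
      let m := fderiv ℝ M P (shear k v.1 v.2.1)
      v.1 2 * M P + w.1 2 * m +
      b * (fderiv ℝ W P (shear k v.1 v.2.1) * (w.1 0 * Real.sin Θ + w.1 1 * Real.cos Θ) +
        W P * (v.1 0 * Real.sin Θ + v.1 1 * Real.cos Θ +
          (w.1 0 * Real.cos Θ - w.1 1 * Real.sin Θ) * (2 * Real.pi * v.2.2 k + t * m))) := by
  have hd : DifferentiableAt ℝ (twistHamiltonian k M W t b) w := by
    have hP : Differentiable ℝ (fun w : E3 × (Fin n → ℝ) × (Fin n → ℝ) => shear k w.1 w.2.1) :=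
      ContDiff.differentiable (n := 1) ((contDiff_shear (k := k)).comp
        (contDiff_fst.prodMk (contDiff_fst.comp contDiff_snd))) one_ne_zero
    have hc : ∀ i : Fin 3, Differentiable ℝ (fun w : E3 × (Fin n → ℝ) × (Fin n → ℝ) => w.1 i) :=
      fun i => ContDiff.differentiable ((contDiff_E3_coord i).comp contDiff_fst) (by simp)
    have hc0 := hc 0
    have hc1 := hc 1
    have hc2 := hc 2
    have h1 := hM.comp hP
    have h2 := hW.comp hP
    simp only [Function.comp_def] at h1 h2
    unfold twistHamiltonian
    fun_prop
  have hl : HasDerivAt (fun s : ℝ => w + s • v) v 0 := by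
    simpa using ((hasDerivAt_id (0 : ℝ)).smul_const v).const_add w
  have hd' : HasFDerivAt (twistHamiltonian k M W t b) (fderiv ℝ (twistHamiltonian k M W t b) w)
      (w + (0 : ℝ) • v) := by
    simpa using hd.hasFDerivAt
  have h1 := hd'.comp_hasDerivAt (0 : ℝ) hl
  have l1 : HasDerivAt (fun s : ℝ => (w + s • v).1) v.1 0 := by
    simpa using ((hasDerivAt_id (0 : ℝ)).smul_const v.1).const_add w.1
  have l2 : HasDerivAt (fun s : ℝ => (w + s • v).2.1) v.2.1 0 := by
    simpa using ((hasDerivAt_id (0 : ℝ)).smul_const v.2.1).const_add w.2.1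
  have l3 : HasDerivAt (fun s : ℝ => (w + s • v).2.2 k) (v.2.2 k) 0 := by
    simpa using ((hasDerivAt_id (0 : ℝ)).mul_const (v.2.2 k)).const_add (w.2.2 k)
  have lP := hasDerivAt_shear (k := k) l1 l2
  have e0 : w + (0 : ℝ) • v = w := by simp
  have hM' : HasFDerivAt M (fderiv ℝ M (shear k w.1 w.2.1))
      (shear k (w + (0 : ℝ) • v).1 (w + (0 : ℝ) • v).2.1) := by
    rw [e0]; exact (hM _).hasFDerivAt
  have hW' : HasFDerivAt W (fderiv ℝ W (shear k w.1 w.2.1))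
      (shear k (w + (0 : ℝ) • v).1 (w + (0 : ℝ) • v).2.1) := by
    rw [e0]; exact (hW _).hasFDerivAt
  have lM := hM'.comp_hasDerivAt (0 : ℝ) lP
  have lW := hW'.comp_hasDerivAt (0 : ℝ) lP
  have lΘ := (l3.const_mul (2 * Real.pi)).add (lM.const_mul t)
  have h2 := ((hasDerivAt_E3_coord l1 2).mul lM).add ((lW.const_mul b).mul
    (((hasDerivAt_E3_coord l1 0).mul lΘ.sin).add ((hasDerivAt_E3_coord l1 1).mul lΘ.cos)))
  have h3 := h1.unique h2
  rw [h3]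
  simp only [Function.comp_def, Pi.add_apply, Pi.mul_apply, e0]
  ring

/-- Hamilton's equations of `twistHamiltonian`. Here `y0, y1` are the horizontal coordinates in the
rotating frame and `S j` is the partial derivative in the direction `pⱼ`. -/
theorem twistHamiltonian_equations (hM : Differentiable ℝ M) (hW : Differentiable ℝ W) {t b : ℝ}
    {x : E3} {p q : Fin n → ℝ} {u : E3} {a c : Fin n → ℝ} :
    HamiltonEquations x (fderiv ℝ (twistHamiltonian k M W t b) (x, p, q)) u a c ↔
    (let P := shear k x p
     let Θ := 2 * Real.pi * q k + t * M P
     let y0 := x 0 * Real.cos Θ - x 1 * Real.sin Θ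
     let y1 := x 0 * Real.sin Θ + x 1 * Real.cos Θ
     let S := fun j => x 2 * fderiv ℝ M P (Pi.single j 1) + b * (fderiv ℝ W P (Pi.single j 1) * y1 +
       W P * (y0 * (t * fderiv ℝ M P (Pi.single j 1))))
     (u 0 = x 1 * (M P + 2 * Real.pi * S k) - x 2 * (b * W P * Real.cos Θ) ∧
      u 1 = x 2 * (b * W P * Real.sin Θ) - x 0 * (M P + 2 * Real.pi * S k) ∧
      u 2 = b * W P * y0) ∧
     (∀ j, a j = -(2 * Real.pi * (b * W P * y0) * (Pi.single k 1 : Fin n → ℝ) j)) ∧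
     ∀ j, c j = S j) := by
  have s0 : shear k (EuclideanSpace.single 0 1) (0 : Fin n → ℝ) = 0 := by simp [shear]
  have s1 : shear k (EuclideanSpace.single 1 1) (0 : Fin n → ℝ) = 0 := by simp [shear]
  have s2 : shear k (EuclideanSpace.single 2 1) (0 : Fin n → ℝ) =
    (2 * Real.pi) • (Pi.single k 1 : Fin n → ℝ) := by simp [shear]
  have s3 : ∀ v : Fin n → ℝ, shear k 0 v = v := fun v => by simp [shear]
  simp only [HamiltonEquations, fderiv_twistHamiltonian_apply hM hW, s0, s1, s2, s3, map_zero,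
    map_smul, smul_eq_mul]
  have i01 : (EuclideanSpace.single 0 1 : E3) 1 = 0 := by simp
  have i02 : (EuclideanSpace.single 0 1 : E3) 2 = 0 := by simp
  have i00 : (EuclideanSpace.single 0 1 : E3) 0 = 1 := by simp
  have i10 : (EuclideanSpace.single 1 1 : E3) 0 = 0 := by simp
  have i12 : (EuclideanSpace.single 1 1 : E3) 2 = 0 := by simp
  have i11 : (EuclideanSpace.single 1 1 : E3) 1 = 1 := by simp
  have i20 : (EuclideanSpace.single 2 1 : E3) 0 = 0 := by simp
  have i21 : (EuclideanSpace.single 2 1 : E3) 1 = 0 := by simp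
  have i22 : (EuclideanSpace.single 2 1 : E3) 2 = 1 := by simp
  simp only [i01, i02, i00, i10, i12, i11, i20, i21, i22, Pi.zero_apply, PiLp.zero_apply]
  have hsingle : ∀ j, (Pi.single j 1 : Fin n → ℝ) k = (Pi.single k 1 : Fin n → ℝ) j := fun j => by
    simp [Pi.single_apply, eq_comm]
  refine and_congr (and_congr ?_ (and_congr ?_ ?_)) (and_congr (forall_congr' fun j => ?_)
    (forall_congr' fun j => ?_))
  · constructor <;> intro h <;> rw [h] <;> ring
  · constructor <;> intro h <;> rw [h] <;> ring
  · constructor <;> intro h <;> rw [h] <;> ring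
  · rw [hsingle]
    constructor <;> intro h <;> rw [h] <;> ring
  · constructor <;> intro h <;> rw [h] <;> ring

theorem eq_of_hasDerivAt_zero {E : Type*} [NormedAddCommGroup E] [NormedSpace ℝ E] {f : ℝ → E}
    (hf : ContinuousOn f (Set.Icc 0 1)) (h : ∀ t ∈ Set.Ico (0 : ℝ) 1, HasDerivAt f 0 t) :
    ∀ t ∈ Set.Icc (0 : ℝ) 1, f t = f 0 :=
  constant_of_has_deriv_right_zero hf fun t ht => (h t ht).hasDerivWithinAt

/-- The time-one displacement along the trajectories of `twistHamiltonian`. In the rotating frame with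
coordinates `(y0, y1, z)` a trajectory rotates about the second axis through the angle `W(P) B(t)`,
so that `P` and `y1` are conserved, and `W(P) = π` implies `z(1) = -z(0)`. The equation for `qₖ` is
integrated by means of the conserved quantity `qₖ - t z ∂ₖM(P) - B y1 ∂ₖW(P)`. -/
theorem twistHamiltonian_displacement (hM : Differentiable ℝ M) (hW : Differentiable ℝ W)
    {b B : ℝ → ℝ} (hB : ∀ t, HasDerivAt B (b t) t) (hB0 : B 0 = 0) (hB1 : B 1 = 1)
    {x : ℝ → E3} {p q : ℝ → Fin n → ℝ} (hx : Continuous x) (hp : Continuous p) (hq : Continuous q)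
    (hx1 : ∀ t, (x t) 0 ^ 2 + (x t) 1 ^ 2 + (x t) 2 ^ 2 = 1)
    (h : ∀ t ∈ Set.Ico (0 : ℝ) 1, ∃ u a c, HasDerivAt x u t ∧ HasDerivAt p a t ∧ HasDerivAt q c t ∧
      HamiltonEquations (x t) (fderiv ℝ (twistHamiltonian k M W t (b t)) (x t, p t, q t)) u a c) :
    ∃ y : ℝ, |y| ≤ 1 ∧ q 1 k - q 0 k = x 1 2 * fderiv ℝ M (shear k (x 0) (p 0)) (Pi.single k 1) +
        y * fderiv ℝ W (shear k (x 0) (p 0)) (Pi.single k 1) ∧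
      (W (shear k (x 0) (p 0)) = Real.pi → x 1 2 = - x 0 2) := by
  set P := shear k (x 0) (p 0) with hP
  have hxi : ∀ i : Fin 3, Continuous fun t => x t i := fun i => by fun_prop
  have hqk : Continuous fun t => q t k := by fun_prop
  have hBc : Continuous B := continuous_iff_continuousAt.2 fun t => (hB t).continuousAt
  -- the sheared momentum is conserved
  have hPc : ∀ t ∈ Set.Icc (0 : ℝ) 1, shear k (x t) (p t) = P := by
    refine eq_of_hasDerivAt_zero (f := fun t => shear k (x t) (p t)) ?_ ?_
    · unfold shear
      fun_prop
    · intro t ht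
      obtain ⟨u, a, c, hu, ha, hc, he⟩ := h t ht
      obtain ⟨⟨h0, h1, h2⟩, h3, h4⟩ := (twistHamiltonian_equations hM hW).1 he
      refine (hasDerivAt_shear (k := k) hu ha).congr_deriv ?_
      funext j
      simp only [shear, Pi.add_apply, Pi.smul_apply, h2, h3, smul_eq_mul, Pi.zero_apply]
      ring
  set m := fderiv ℝ M P (Pi.single k 1)
  set w := fderiv ℝ W P (Pi.single k 1)
  let Θ : ℝ → ℝ := fun t => 2 * Real.pi * q t k + t * M P
  let y0 : ℝ → ℝ := fun t => x t 0 * Real.cos (Θ t) - x t 1 * Real.sin (Θ t)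
  let y1 : ℝ → ℝ := fun t => x t 0 * Real.sin (Θ t) + x t 1 * Real.cos (Θ t)
  have hΘc : Continuous Θ := by fun_prop
  have hy0c : Continuous y0 := by fun_prop
  have hy1c : Continuous y1 := by fun_prop
  -- the equations of motion in the rotating frame
  have key : ∀ t ∈ Set.Ico (0 : ℝ) 1, HasDerivAt y0 (-(b t * W P * x t 2)) t ∧ HasDerivAt y1 0 t ∧
      HasDerivAt (fun t => x t 2) (b t * W P * y0 t) t ∧
      HasDerivAt (fun t => q t k) (x t 2 * m + b t * (w * y1 t + W P * (y0 t * (t * m)))) t := by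
    intro t ht
    obtain ⟨u, a, c, hu, ha, hc, he⟩ := h t ht
    obtain ⟨⟨h0, h1, h2⟩, h3, h4⟩ := (twistHamiltonian_equations hM hW).1 he
    rw [hPc t (Set.Ico_subset_Icc_self ht)] at h0 h1 h2 h4
    have d0 := hasDerivAt_E3_coord hu 0
    have d1 := hasDerivAt_E3_coord hu 1
    have d2 := hasDerivAt_E3_coord hu 2
    have dq := (hasDerivAt_pi.1 hc) k
    have dΘ : HasDerivAt Θ _ t :=
      (dq.const_mul (2 * Real.pi)).add ((hasDerivAt_id t).mul_const (M P))
    refine ⟨?_, ?_, ?_, ?_⟩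
    · refine ((d0.mul dΘ.cos).sub (d1.mul dΘ.sin)).congr_deriv ?_
      rw [h0, h1, ← h4]
      simp only [Θ]
      linear_combination (-(b t * W P * x t 2)) *
        Real.sin_sq_add_cos_sq (2 * Real.pi * q t k + t * M P)
    · refine ((d0.mul dΘ.sin).add (d1.mul dΘ.cos)).congr_deriv ?_
      rw [h0, h1, ← h4]
      simp only [Θ]
      ring
    · exact d2.congr_deriv h2
    · exact dq.congr_deriv (h4 k)
  have m0 : (0 : ℝ) ∈ Set.Icc (0 : ℝ) 1 := ⟨le_rfl, zero_le_one⟩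
  have m1 : (1 : ℝ) ∈ Set.Icc (0 : ℝ) 1 := ⟨zero_le_one, le_rfl⟩
  refine ⟨y1 0, ?_, ?_, ?_⟩
  · have hs := Real.sin_sq_add_cos_sq (Θ 0)
    have : (y1 0) ^ 2 + (y0 0) ^ 2 + (x 0 2) ^ 2 = 1 := by
      simp only [y0, y1]
      linear_combination ((x 0 0) ^ 2 + (x 0 1) ^ 2) * hs + hx1 0
    rw [abs_le]
    constructor <;> nlinarith [sq_nonneg (y0 0), sq_nonneg (x 0 2)]
  · have hc := eq_of_hasDerivAt_zero (f := fun t => q t k - t * x t 2 * m - B t * y1 t * w)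
      (by fun_prop) (fun t ht => by
        obtain ⟨k0, k1, k2, k3⟩ := key t ht
        refine ((k3.sub (((hasDerivAt_id t).mul k2).mul_const m)).sub
          (((hB t).mul k1).mul_const w)).congr_deriv ?_
        simp only [id]
        ring) 1 m1
    have hc1 := eq_of_hasDerivAt_zero (f := y1) (by fun_prop) (fun t ht => (key t ht).2.1) 1 m1
    simp only [hB0, hB1, hc1] at hc
    linear_combination hc
  · intro hWP
    -- the third coordinate in the frame that follows the rotation is constant
    have hc := eq_of_hasDerivAt_zero
      (f := fun t => - y0 t * Real.sin (W P * B t) + x t 2 * Real.cos (W P * B t))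
      (by fun_prop) (fun t ht => by
        obtain ⟨k0, k1, k2, k3⟩ := key t ht
        have kB := (hB t).const_mul (W P)
        refine ((k0.neg.mul kB.sin).add (k2.mul kB.cos)).congr_deriv ?_
        simp only [Pi.neg_apply]
        ring) 1 m1
    simp only [hB0, hB1, hWP, mul_one, mul_zero, Real.sin_pi, Real.cos_pi, Real.sin_zero,
      Real.cos_zero] at hc
    linear_combination -hc

end

/-! ### Lifts of loops in the torus -/

/-- Two lifts of the same map to the circle differ by a constant. -/
theorem eq_add_const_of_coe_eq {A : Type*} [TopologicalSpace A] [PreconnectedSpace A]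
    {f g : A → ℝ} (hf : Continuous f) (hg : Continuous g)
    (h : ∀ a, (f a : UnitAddCircle) = g a) (a a' : A) : f a - g a = f a' - g a' := by
  have h1 : ∀ a, ∃ m : ℤ, f a - g a = m := by
    intro a
    have h2 := sub_eq_zero.2 (h a)
    rw [← AddCircle.coe_sub, AddCircle.coe_eq_zero_iff] at h2
    obtain ⟨m, hm⟩ := h2
    exact ⟨m, by simpa using hm.symm⟩
  choose m hm using h1
  have hc : Continuous m := by
    have : Continuous fun a => (m a : ℝ) := by
      simp only [← hm]; fun_prop
    exact Int.isClosedEmbedding_coe_real.isEmbedding.continuous_iff.2 this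
  rw [hm, hm, PreconnectedSpace.constant inferInstance hc]

theorem exists_real_lift {A : Type*} [TopologicalSpace A] [SimplyConnectedSpace A]
    [LocallyPathConnectedSpace A] {f : A → UnitAddCircle} (hf : Continuous f) :
    ∃ g : A → ℝ, Continuous g ∧ ∀ a, (g a : UnitAddCircle) = f a := by
  obtain ⟨a₀⟩ : Nonempty A := inferInstance
  obtain ⟨e₀, he⟩ := QuotientAddGroup.mk_surjective (f a₀)
  obtain ⟨F, hF, -⟩ := (AddCircle.isCoveringMap_coe (1 : ℝ)).existsUnique_continuousMap_lifts
    ⟨f, hf⟩ a₀ e₀ he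
  exact ⟨F, F.continuous, fun a => congrFun hF.2 a⟩

theorem exists_torus_lift {n : ℕ} {f : ℝ → Torus n} (hf : Continuous f) :
    ∃ q : ℝ → Fin n → ℝ, Continuous q ∧ ∀ t, torusMk (q t) = f t := by
  have h : ∀ j, ∃ g : ℝ → ℝ, Continuous g ∧ ∀ t, (g t : UnitAddCircle) = f t j := fun j =>
    exists_real_lift (by fun_prop)
  choose g hg hgf using h
  exact ⟨fun t j => g j t, by fun_prop, fun t => funext fun j => hgf j t⟩

/-- The increment over one period of a lift is an invariant of the free homotopy class. -/
theorem lift_increment_of_homotopic {z : C(UnitAddCircle, UnitAddCircle)} {e : ℤ}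
    (h : ContinuousMap.Homotopic z ⟨fun t => e • t, by fun_prop⟩)
    {q : ℝ → ℝ} (hq : Continuous q) (hqz : ∀ t : ℝ, (q t : UnitAddCircle) = z t) :
    q 1 - q 0 = e := by
  obtain ⟨H⟩ := h
  have hc : Continuous fun w : ℝ × ℝ =>
      H (Set.projIcc 0 1 zero_le_one w.1, (w.2 : UnitAddCircle)) := by
    have : Continuous fun t : ℝ => (t : UnitAddCircle) := AddCircle.continuous_mk' 1
    fun_prop
  -- lift the homotopy and compare it with the given lifts along the sides of the square
  obtain ⟨g, hg, hgH⟩ := exists_real_lift hc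
  have h0 := eq_add_const_of_coe_eq (f := fun t => g (0, t)) (g := q) (by fun_prop) hq
    (fun t => by simp [hgH, hqz]) 1 0
  have h1 := eq_add_const_of_coe_eq (f := fun t => g (1, t)) (g := fun t => e * t) (by fun_prop)
    (by fun_prop) (fun t => by
      rw [hgH, Set.projIcc_right, ← zsmul_eq_mul]
      exact H.apply_one _) 1 0
  have h2 := eq_add_const_of_coe_eq (f := fun s => g (s, 1)) (g := fun s => g (s, 0)) (by fun_prop)
    (by fun_prop) (fun s => by
      rw [hgH, hgH]
      congr 2
      simp) 1 0
  linarith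

/-- The torus component of a loop in the class `(0_M, e)` has the increment `e` over one period. -/
theorem lift_increment_of_class {M : Type} [TopologicalSpace M] {x₀ : M} {n : ℕ}
    {R : Fin n → {r : ℝ // 0 < r}} {e : Fin n → ℤ} {z : C(UnitAddCircle, M × box R × Torus n)}
    (h : FreeLoopClass.mk z = FreeLoopClass.mk (standardLoop x₀ R e)) {q : ℝ → Fin n → ℝ}
    (hq : Continuous q) (hqz : ∀ t : ℝ, torusMk (q t) = (z t).2.2) (k : Fin n) :
    q 1 k - q 0 k = e k := by
  have h1 : ContinuousMap.Homotopic z (standardLoop x₀ R e) := Quotient.exact h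
  let pr : C(M × box R × Torus n, UnitAddCircle) := ⟨fun w => w.2.2 k, by fun_prop⟩
  have h2 := ContinuousMap.Homotopic.comp (ContinuousMap.Homotopic.refl pr) h1
  exact lift_increment_of_homotopic (q := fun t => q t k) h2 (by fun_prop)
    (fun t => congrFun (hqz t) k)

/-! ### Hamiltonians on products with the torus -/

/-- The representative in `[0, 1)` of a point of the circle. -/
def circleRep (t : UnitAddCircle) : ℝ := AddCircle.equivIco (1 : ℝ) 0 t

theorem circleRep_coe (t : ℝ) : circleRep (t : UnitAddCircle) = Int.fract t := by
  rw [circleRep, AddCircle.coe_equivIco_mk_apply]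
  simp

theorem coe_circleRep (t : UnitAddCircle) : (circleRep t : UnitAddCircle) = t :=
  (AddCircle.equivIco (1 : ℝ) 0).symm_apply_apply t

section
variable {n : ℕ} {P : Type}

/-- The function on `S¹ × (S² × P × T^n)` given by `G` on representatives in `[0, 1)` of the
circle-valued variables, where `P` is mapped to `ℝ^n` by `ι`. -/
def toHamiltonian (ι : P → Fin n → ℝ) (G : ℝ → E3 × (Fin n → ℝ) × (Fin n → ℝ) → ℝ)
    (t : UnitAddCircle) (z : S2 × P × Torus n) : ℝ :=
  G (circleRep t) (z.1, ι z.2.1, fun j => circleRep (z.2.2 j))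

theorem toHamiltonian_apply {ι : P → Fin n → ℝ} {G : ℝ → E3 × (Fin n → ℝ) × (Fin n → ℝ) → ℝ}
    (hG : ∀ t x p q q', torusMk q = torusMk q' → G t (x, p, q) = G t (x, p, q'))
    (t : ℝ) (x : S2) (p : P) (q : Fin n → ℝ) :
    toHamiltonian ι G t (x, p, torusMk q) = G (Int.fract t) (x, ι p, q) := by
  rw [toHamiltonian, circleRep_coe]
  exact hG _ _ _ _ _ (funext fun j => coe_circleRep _)

variable [TopologicalSpace P] [T2Space P] [ChartedSpace (Fin n → ℝ) P]

theorem isHamiltonian_toHamiltonian {ι : P → Fin n → ℝ}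
    (hι : ContMDiff 𝓘(ℝ, Fin n → ℝ) 𝓘(ℝ, Fin n → ℝ) ∞ ι)
    {G : ℝ → E3 × (Fin n → ℝ) × (Fin n → ℝ) → ℝ}
    (hG : ∀ t x p q q', torusMk q = torusMk q' → G t (x, p, q) = G t (x, p, q'))
    (hG2 : ContDiff ℝ ∞ (fun w : ℝ × E3 × (Fin n → ℝ) × (Fin n → ℝ) => G (Int.fract w.1) w.2))
    {C : Set P} (hC : IsCompact C) (hG3 : ∀ t (x : S2) q, ∀ p ∉ C, G t (x, ι p, q) = 0) :
    IsHamiltonian (prodModel n) (toHamiltonian ι G) := by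
  constructor
  · exact contMDiff_of_lift (g := fun w => G (Int.fract w.1) w.2) hι
      (fun t x p q => toHamiltonian_apply hG t x p q) hG2
  · refine HasCompactSupport.intro (K := Set.univ ×ˢ (Set.univ ×ˢ (C ×ˢ Set.univ)))
      (isCompact_univ.prod (isCompact_univ.prod (hC.prod isCompact_univ))) ?_
    rintro ⟨t, x, p, q⟩ h
    exact hG3 _ _ _ _ fun hp => h ⟨trivial, trivial, hp, trivial⟩

end

/-- `twistHamiltonian` is well defined on the torus. -/
theorem twistHamiltonian_periodic {n : ℕ} {k : Fin n} {M W : (Fin n → ℝ) → ℝ} {t b : ℝ} (x : E3)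
    (p q q' : Fin n → ℝ) (h : torusMk q = torusMk q') :
    twistHamiltonian k M W t b (x, p, q) = twistHamiltonian k M W t b (x, p, q') := by
  obtain ⟨m, hm⟩ := (torusMk_eq_iff q q').1 h k
  have h1 : 2 * Real.pi * q k + t * M (shear k x p) =
      2 * Real.pi * q' k + t * M (shear k x p) + m * (2 * Real.pi) := by
    rw [← hm]; ring
  simp only [twistHamiltonian, h1, Real.sin_add_int_mul_two_pi, Real.cos_add_int_mul_two_pi]

/-- A time-dependent family of the form `twistHamiltonian` extends smoothly and periodically from
`[0, 1)` to `ℝ` when its time-dependent part vanishes near the endpoints. -/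
theorem contDiff_twistHamiltonian_fract {n : ℕ} {k : Fin n} {M W : (Fin n → ℝ) → ℝ}
    (hM : ContDiff ℝ ∞ M) (hW : ContDiff ℝ ∞ W) {b : ℝ → ℝ} (hb : ContDiff ℝ ∞ b)
    (hb0 : ∀ t < 1 / 4, b t = 0) (hb1 : ∀ t > 3 / 4, b t = 0) :
    ContDiff ℝ ∞ (fun w : ℝ × E3 × (Fin n → ℝ) × (Fin n → ℝ) =>
      twistHamiltonian k M W (Int.fract w.1) (b (Int.fract w.1)) w.2) := by
  have h0 := contDiff_twistHamiltonian (k := k) hM hW hb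
  rw [contDiff_iff_contDiffAt]
  intro w
  by_cases hw : Int.fract w.1 = 0
  -- at integral times, `b` vanishes on both sides, and what is left does not depend on time
  · have h1 : ContDiff ℝ ∞ (fun w : ℝ × E3 × (Fin n → ℝ) × (Fin n → ℝ) =>
        twistHamiltonian k M W 0 0 w.2) := by
      have := contDiff_twistHamiltonian (k := k) hM hW (b := fun _ => 0) contDiff_const
      refine (congrArg (ContDiff ℝ ∞) (funext fun w => ?_)).mp this
      simp [twistHamiltonian]
    refine h1.contDiffAt.congr_of_eventuallyEq ?_
    have h2 : ∀ᶠ s in nhds w.1, |s - w.1| < 1 / 4 := by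
      filter_upwards [Metric.ball_mem_nhds w.1 (by norm_num : (0 : ℝ) < 1 / 4)] with s hs
      simpa [Real.dist_eq] using hs
    filter_upwards [continuous_fst.continuousAt.eventually h2] with v hv
    have hb' : b (Int.fract v.1) = 0 := by
      have e1 : w.1 = (⌊w.1⌋ : ℝ) := by
        rw [Int.fract] at hw; linarith
      rw [abs_lt] at hv
      by_cases hv0 : w.1 ≤ v.1
      · have : ⌊v.1⌋ = ⌊w.1⌋ := by
          rw [Int.floor_eq_iff]; constructor <;> linarith [hv.2]
        refine hb0 _ ?_
        rw [Int.fract, this]; linarith [hv.2]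
      · have : ⌊v.1⌋ = ⌊w.1⌋ - 1 := by
          rw [Int.floor_eq_iff]; push_cast; constructor <;> linarith [hv.1]
        refine hb1 _ ?_
        rw [Int.fract, this]; push_cast; linarith [hv.1]
    simp [twistHamiltonian, hb']
  · have h1 : ContDiff ℝ ∞ (fun v : ℝ × E3 × (Fin n → ℝ) × (Fin n → ℝ) =>
        twistHamiltonian k M W (v.1 - ⌊w.1⌋) (b (v.1 - ⌊w.1⌋)) v.2) :=
      h0.comp ((contDiff_fst.sub contDiff_const).prodMk contDiff_snd)
    refine h1.contDiffAt.congr_of_eventuallyEq ?_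
    have h2 : ∀ᶠ s in nhds w.1, ⌊s⌋ = ⌊w.1⌋ := by
      have h3 : (⌊w.1⌋ : ℝ) < w.1 := by
        have := Int.fract_nonneg w.1
        rw [Int.fract] at this hw
        rcases this.lt_or_eq with h | h
        · linarith
        · exact absurd h.symm hw
      filter_upwards [Ioo_mem_nhds h3 (Int.lt_floor_add_one w.1)] with s hs
      rw [Int.floor_eq_iff]
      exact ⟨hs.1.le, hs.2⟩
    filter_upwards [continuous_fst.continuousAt.eventually h2] with v hv
    rw [Int.fract, hv]

/-! ### Cutoff functions -/

theorem exists_smooth_cutoff (E : Type*) [NormedAddCommGroup E] [NormedSpace ℝ E]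
    [HasContDiffBump E] {a b : ℝ} (ha : 0 < a) (hab : a < b) :
    ∃ f : E → ℝ, ContDiff ℝ ∞ f ∧ (∀ x, ‖x‖ ≤ a → f x = 1) ∧ (∀ x, b ≤ ‖x‖ → f x = 0) ∧
      ∀ x, 0 ≤ f x ∧ f x ≤ 1 := by
  let f : ContDiffBump (0 : E) := ⟨a, b, ha, hab⟩
  exact ⟨f, f.contDiff, fun x hx => f.one_of_mem_closedBall (by simpa using hx),
    fun x hx => f.zero_of_le_dist (by simpa using hx), fun x => ⟨f.nonneg, f.le_one⟩⟩

/-- Stretching a cutoff function makes its slope as small as desired. The bounds are chosen so that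
`7 > 2π` and `π / 4 < 1`. -/
theorem exists_slow_cutoff : ∃ L : ℝ, 7 < L ∧ ∃ χ : ℝ → ℝ, ContDiff ℝ ∞ χ ∧
    (∀ s, |s| ≤ 7 → χ s = 1) ∧ (∀ s, L ≤ |s| → χ s = 0) ∧ (∀ s, 0 ≤ χ s ∧ χ s ≤ 1) ∧
    ∀ s, |deriv χ s| ≤ 1 / 4 := by
  obtain ⟨f, hf, hf1, hf2, hf3⟩ := exists_smooth_cutoff ℝ (zero_lt_one) (one_lt_two)
  have hfs : HasCompactSupport f := HasCompactSupport.intro (isCompact_closedBall (0 : ℝ) 2)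
    fun x hx => hf2 x (by simp at hx; simpa using hx.le)
  have hd : Continuous (deriv f) := hf.continuous_deriv (by simp)
  obtain ⟨C, hC⟩ := hfs.deriv.exists_bound_of_continuous hd
  set l := max 7 (4 * C) with hl
  have hl7 : 7 ≤ l := le_max_left _ _
  have hlC : 4 * C ≤ l := le_max_right _ _
  have hl0 : 0 < l := by linarith
  refine ⟨2 * l, by linarith, fun s => f (s / l), by fun_prop, ?_, ?_, fun s => hf3 _, ?_⟩
  · intro s hs
    refine hf1 _ ?_
    rw [Real.norm_eq_abs, abs_div, abs_of_pos hl0, div_le_one hl0]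
    linarith
  · intro s hs
    refine hf2 _ ?_
    rw [Real.norm_eq_abs, abs_div, abs_of_pos hl0, le_div_iff₀ hl0]
    linarith
  · intro s
    have h1 : HasDerivAt (fun s => f (s / l)) (deriv f (s / l) * (1 / l)) s :=
      HasDerivAt.comp s (hf.differentiable (by simp) (s / l)).hasDerivAt
        ((hasDerivAt_id s).div_const l)
    rw [h1.deriv, abs_mul, abs_of_pos (by positivity : 0 < 1 / l), mul_one_div, div_le_iff₀ hl0]
    have := hC (s / l)
    rw [Real.norm_eq_abs] at this
    linarith

/-- A smooth path from `0` to `1` that is constant near the endpoints. -/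
theorem exists_time_profile : ∃ B b : ℝ → ℝ, (∀ t, HasDerivAt B (b t) t) ∧ B 0 = 0 ∧ B 1 = 1 ∧
    ContDiff ℝ ∞ b ∧ (∀ t < 1 / 4, b t = 0) ∧ (∀ t > 3 / 4, b t = 0) ∧ ∃ β, ∀ t, |b t| ≤ β := by
  let B : ℝ → ℝ := fun t => Real.smoothTransition (2 * t - 1 / 2)
  have hB : ContDiff ℝ ∞ B := Real.smoothTransition.contDiff.comp (by fun_prop)
  have hb := (contDiff_infty_iff_deriv.1 hB).2
  have hb0 : ∀ t < 1 / 4, deriv B t = 0 := by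
    intro t ht
    have : B =ᶠ[nhds t] fun _ => 0 := by
      filter_upwards [Iio_mem_nhds ht] with s hs
      exact Real.smoothTransition.zero_of_nonpos (by simp at hs; linarith)
    rw [this.deriv_eq]; simp
  have hb1 : ∀ t > 3 / 4, deriv B t = 0 := by
    intro t ht
    have : B =ᶠ[nhds t] fun _ => 1 := by
      filter_upwards [Ioi_mem_nhds ht] with s hs
      exact Real.smoothTransition.one_of_one_le (by simp at hs; linarith)
    rw [this.deriv_eq]; simp
  refine ⟨B, deriv B, fun t => (hB.differentiable (by simp) t).hasDerivAt,
    Real.smoothTransition.zero_of_nonpos (by norm_num),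
    Real.smoothTransition.one_of_one_le (by norm_num), hb, hb0, hb1, ?_⟩
  have hs : HasCompactSupport (deriv B) :=
    HasCompactSupport.intro (K := Set.Icc (1 / 4) (3 / 4)) isCompact_Icc fun t ht => by
      rw [Set.mem_Icc, not_and_or, not_le, not_le] at ht
      exact ht.elim (hb0 t) (hb1 t)
  obtain ⟨β, hβ⟩ := hs.exists_bound_of_continuous hb.continuous
  exact ⟨β, fun t => by simpa using hβ t⟩

section
variable {n : ℕ} (k : Fin n)

/-- The vector `p` with its `k`-th coordinate replaced by `0`. -/
def dropCoord (p : Fin n → ℝ) : Fin n → ℝ := p - p k • (Pi.single k 1 : Fin n → ℝ)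

theorem dropCoord_apply_ne {p : Fin n → ℝ} {j : Fin n} (h : j ≠ k) : dropCoord k p j = p j := by
  simp [dropCoord, h]

theorem dropCoord_add_single (p : Fin n → ℝ) (s : ℝ) :
    dropCoord k (p + s • (Pi.single k 1 : Fin n → ℝ)) = dropCoord k p := by
  funext j
  simp [dropCoord]
  ring

theorem contDiff_dropCoord {m : WithTop ℕ∞} : ContDiff ℝ m (dropCoord k) := by
  unfold dropCoord
  fun_prop

/-- The `k`-th partial derivative of a product `f(pₖ) g(p₁, …, p̂ₖ, …, pₙ)`. -/
theorem fderiv_mul_dropCoord {f : ℝ → ℝ} {g : (Fin n → ℝ) → ℝ} (hf : ContDiff ℝ ∞ f)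
    (hg : ContDiff ℝ ∞ g) (p : Fin n → ℝ) :
    fderiv ℝ (fun p => f (p k) * g (dropCoord k p)) p (Pi.single k 1) =
      deriv f (p k) * g (dropCoord k p) := by
  have h0 : ContDiff ℝ ∞ (fun p => f (p k) * g (dropCoord k p)) :=
    (hf.comp (contDiff_apply ℝ ℝ k)).mul (hg.comp (contDiff_dropCoord k))
  have hl : HasDerivAt (fun s : ℝ => p + s • (Pi.single k 1 : Fin n → ℝ)) (Pi.single k 1) 0 := by
    simpa using ((hasDerivAt_id (0 : ℝ)).smul_const (Pi.single k 1 : Fin n → ℝ)).const_add p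
  have h1 : HasFDerivAt (fun p => f (p k) * g (dropCoord k p))
      (fderiv ℝ (fun p => f (p k) * g (dropCoord k p)) p)
      (p + (0 : ℝ) • (Pi.single k 1 : Fin n → ℝ)) := by
    simpa using (h0.differentiable (by simp) p).hasFDerivAt
  have h2 := h1.comp_hasDerivAt (0 : ℝ) hl
  have h3 : HasDerivAt (fun s : ℝ => f (p k + s) * g (dropCoord k p))
      (deriv f (p k) * g (dropCoord k p)) 0 := by
    have h4 : HasDerivAt f (deriv f (p k)) (p k + 0) := by
      simpa using (hf.differentiable (by simp) (p k)).hasDerivAt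
    exact (h4.comp_const_add (p k) 0).mul_const _
  refine h2.unique (h3.congr_of_eventuallyEq (Filter.Eventually.of_forall fun s => ?_))
  simp [dropCoord_add_single]

end

/-- The profiles of the Hamiltonian without periodic trajectories: `M` is large where the image of
`C_ε` under the shear lies, and `W = π` on the support of `M`, so that the rotation by the angle `W`
exchanges the two hemispheres there; outside this support, `W` has slope less than `1` in the
direction `k`. Both are products of a function of `pₖ` and one of the other coordinates. -/
theorem exists_profiles : ∃ L : ℝ, 7 < L ∧ ∀ (n : ℕ) (k : Fin n) (c ρ : ℝ), 0 < ρ →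
    ∃ M W : (Fin n → ℝ) → ℝ, ContDiff ℝ ∞ M ∧ ContDiff ℝ ∞ W ∧
      (∀ s, |s| ≤ 2 * Real.pi → M (s • Pi.single k 1) = c * s ∧ W (s • Pi.single k 1) = Real.pi) ∧
      (∀ p, L ≤ |p k| ∨ ρ ≤ ‖dropCoord k p‖ → M p = 0 ∧ W p = 0) ∧
      (∀ p, |W p| ≤ Real.pi) ∧
      ∀ p, (W p = Real.pi ∧ fderiv ℝ W p (Pi.single k 1) = 0) ∨
        (fderiv ℝ M p (Pi.single k 1) = 0 ∧ |fderiv ℝ W p (Pi.single k 1)| < 1) := by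
  obtain ⟨L, hL, χ₂, hχ₂, h21, h20, h2b, h2d⟩ := exists_slow_cutoff
  refine ⟨L, hL, fun n k c ρ hρ => ?_⟩
  -- `2π < 6.4 < 6.5 < 7`: the cutoff for `M` contains the sheared circles and lies where `χ₂ = 1`
  obtain ⟨χ₁, hχ₁, h11, h10, h1b⟩ := exists_smooth_cutoff ℝ (a := 6.4) (b := 6.5)
    (by norm_num) (by norm_num)
  obtain ⟨κ₁, hκ₁, k11, k10, k1b⟩ := exists_smooth_cutoff (Fin n → ℝ) (a := ρ / 4) (b := ρ / 3)
    (by linarith) (by linarith)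
  obtain ⟨κ₂, hκ₂, k21, k20, k2b⟩ := exists_smooth_cutoff (Fin n → ℝ) (a := ρ / 2) (b := ρ)
    (by linarith) (by linarith)
  have hpi := Real.pi_pos
  have hpi2 := Real.pi_lt_d2
  have hm : ContDiff ℝ ∞ (fun s => c * s * χ₁ s) := by fun_prop
  have hw : ContDiff ℝ ∞ (fun s => Real.pi * χ₂ s) := by fun_prop
  have hwd : ∀ s, deriv (fun s => Real.pi * χ₂ s) s = Real.pi * deriv χ₂ s := fun s =>
    deriv_const_mul _ (hχ₂.differentiable (by simp) s)
  refine ⟨fun p => (fun s => c * s * χ₁ s) (p k) * κ₁ (dropCoord k p),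
    fun p => (fun s => Real.pi * χ₂ s) (p k) * κ₂ (dropCoord k p),
    (hm.comp (contDiff_apply ℝ ℝ k)).mul (hκ₁.comp (contDiff_dropCoord k)),
    (hw.comp (contDiff_apply ℝ ℝ k)).mul (hκ₂.comp (contDiff_dropCoord k)), ?_, ?_, ?_, ?_⟩
  · intro s hs
    have e0 : dropCoord k (s • (Pi.single k 1 : Fin n → ℝ)) = 0 := by
      funext j; simp [dropCoord]
    have e1 := h11 s (by rw [Real.norm_eq_abs]; linarith)
    have e2 := h21 s (by linarith)
    have e3 := k11 0 (by simp; linarith)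
    have e4 := k21 0 (by simp; linarith)
    simp [e0, e1, e2, e3, e4]
  · rintro p (hp | hp)
    · simp [h10 (p k) (by rw [Real.norm_eq_abs]; linarith), h20 (p k) hp]
    · simp [k10 (dropCoord k p) (by linarith), k20 _ hp]
  · intro p
    obtain ⟨a1, a2⟩ := h2b (p k)
    obtain ⟨b1, b2⟩ := k2b (dropCoord k p)
    simp only
    rw [abs_of_nonneg (by positivity), mul_assoc]
    have : χ₂ (p k) * κ₂ (dropCoord k p) ≤ 1 := mul_le_one₀ a2 b1 b2
    nlinarith
  · intro p
    rw [fderiv_mul_dropCoord k hm hκ₁, fderiv_mul_dropCoord k hw hκ₂, hwd]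
    have hslope : |Real.pi * deriv χ₂ (p k) * κ₂ (dropCoord k p)| < 1 := by
      obtain ⟨b1, b2⟩ := k2b (dropCoord k p)
      rw [abs_mul, abs_mul, abs_of_pos hpi, abs_of_nonneg b1]
      have := h2d (p k)
      have h3 : |deriv χ₂ (p k)| * κ₂ (dropCoord k p) ≤ 1 / 4 := by
        have := mul_le_mul this b2 b1 (by norm_num)
        linarith
      rw [mul_assoc]
      nlinarith
    by_cases h1 : κ₁ (dropCoord k p) = 0
    · right
      exact ⟨by rw [h1, mul_zero], hslope⟩
    have h2 : ‖dropCoord k p‖ < ρ / 3 := by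
      by_contra! h; exact h1 (k10 _ h)
    by_cases h3 : |p k| < 7
    · left
      have e1 : χ₂ =ᶠ[nhds (p k)] fun _ => 1 := by
        filter_upwards [(isOpen_lt continuous_abs continuous_const).mem_nhds h3] with s hs
        exact h21 s (le_of_lt hs)
      refine ⟨?_, ?_⟩
      · simp [h21 _ h3.le, k21 (dropCoord k p) (by linarith)]
      · rw [e1.deriv_eq]; simp
    · right
      refine ⟨?_, hslope⟩
      have e1 : (fun s => c * s * χ₁ s) =ᶠ[nhds (p k)] fun _ => 0 := by
        have : 6.5 < |p k| := by linarith
        filter_upwards [(isOpen_lt continuous_const continuous_abs).mem_nhds this] with s hs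
        rw [h10 s (le_of_lt hs), mul_zero]
      rw [e1.deriv_eq]; simp

/-! ### The capacity of a pair of parallel circles -/

theorem hasMFDerivAt_box_val {n : ℕ} {R : Fin n → {r : ℝ // 0 < r}} (p : box R) :
    HasMFDerivAt 𝓘(ℝ, Fin n → ℝ) 𝓘(ℝ, Fin n → ℝ) (Subtype.val : box R → Fin n → ℝ) p
      (ContinuousLinearMap.id ℝ (Fin n → ℝ)) := by
  have h := (mdifferentiableAt_extChartAt (I := 𝓘(ℝ, Fin n → ℝ))
    (mem_chart_source (Fin n → ℝ) p)).hasMFDerivAt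
  rw [mfderiv_extChartAt_self] at h
  exact h

theorem twistHamiltonian_le {n : ℕ} {k : Fin n} {M W : (Fin n → ℝ) → ℝ} {t b β : ℝ} (hb : |b| ≤ β)
    (hW : ∀ p, |W p| ≤ Real.pi) (x : S2) (p q : Fin n → ℝ) :
    (x : E3) 2 * M (shear k x p) - β * Real.pi ≤ twistHamiltonian k M W t b (x, p, q) := by
  unfold twistHamiltonian
  set Θ := 2 * Real.pi * q k + t * M (shear k x p)
  have h1 : |(x : E3) 0 * Real.sin Θ + (x : E3) 1 * Real.cos Θ| ≤ 1 := by
    rw [← sq_le_one_iff_abs_le_one]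
    nlinarith [Real.sin_sq_add_cos_sq Θ, S2_normSq x, sq_nonneg ((x : E3) 2),
      sq_nonneg ((x : E3) 0 * Real.cos Θ - (x : E3) 1 * Real.sin Θ)]
  have h2 : |b * W (shear k x p) * ((x : E3) 0 * Real.sin Θ + (x : E3) 1 * Real.cos Θ)| ≤
      β * Real.pi := by
    rw [abs_mul, abs_mul]
    have h3 := mul_le_mul hb (hW (shear k x p)) (abs_nonneg _) ((abs_nonneg b).trans hb)
    have h4 := mul_le_mul h3 h1 (abs_nonneg _)
      ((by positivity : 0 ≤ |b| * |W (shear k x p)|).trans h3)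
    linarith
  have h5 := (abs_le.1 h2).1
  linarith

/-- For every `K` there is a Hamiltonian that is at least `K` on `C_ε × {0} × T^n` and has no
`1`-periodic trajectory in the class `(0, e)`. The constant `L + 2π` bounds the size of its support in
the direction `pₖ`: the profiles have size `L`, and the shear moves `pₖ` by at most `2π`. -/
theorem relativeCapacity_circlePair_eq_top : ∃ E : ℝ, 0 < E ∧ ∀ ε : ℝ, 0 < ε →
    ∀ (n : ℕ) (R : Fin n → {r : ℝ // 0 < r}) (e : Fin n → ℤ),
      (∃ k, E < (R k : ℝ) ∧ e k ≠ 0) →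
        relativeCapacity areaForm (circlePair ε) R e = ⊤ := by
  obtain ⟨L, hL, hprof⟩ := exists_profiles
  have hpi := Real.pi_pos
  refine ⟨L + 2 * Real.pi, by linarith, ?_⟩
  rintro ε hε n R e ⟨k, hRk, hek⟩
  obtain ⟨B, b, hB, hB0, hB1, hbs, hb0, hb1, β, hβ⟩ := exists_time_profile
  obtain ⟨ρ, hρ, hρR⟩ : ∃ ρ : ℝ, 0 < ρ ∧ ∀ j, ρ < R j := by
    have : Nonempty (Fin n) := ⟨k⟩
    obtain ⟨j, hj⟩ := Finite.exists_min fun j => (R j : ℝ)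
    exact ⟨R j / 2, half_pos (R j).2, fun i => (half_lt_self (R j).2).trans_le (hj i)⟩
  simp only [relativeCapacity, bpsCapacity, iInf_eq_top]
  rintro K ⟨hK, hF⟩
  exfalso
  -- on the circles `z M(2πz eₖ) = 2πcε²`, and the other term is at least `-βπ`
  obtain ⟨M, W, hM, hW, hMW, hsupp, hWb, hcases⟩ :=
    hprof n k ((K + β * Real.pi) / (2 * Real.pi * ε ^ 2)) ρ hρ
  have hMd := hM.differentiable (by simp)
  have hWd := hW.differentiable (by simp)
  let G : ℝ → E3 × (Fin n → ℝ) × (Fin n → ℝ) → ℝ := fun t => twistHamiltonian k M W t (b t)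
  have hG1 : ∀ t x p q q', torusMk q = torusMk q' → G t (x, p, q) = G t (x, p, q') :=
    fun t x p q q' h => twistHamiltonian_periodic x p q q' h
  have hι : ContMDiff 𝓘(ℝ, Fin n → ℝ) 𝓘(ℝ, Fin n → ℝ) ∞ (Subtype.val : box R → Fin n → ℝ) :=
    contMDiff_subtype_val
  -- the Hamiltonian is supported in a compact part of the box
  let C₀ : Set (Fin n → ℝ) := {p | |p k| ≤ L + 2 * Real.pi ∧ ‖dropCoord k p‖ ≤ ρ}
  have hC₀b : C₀ ⊆ (box R : Set (Fin n → ℝ)) := by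
    rintro p ⟨h1, h2⟩ j
    by_cases hj : j = k
    · rw [hj]; exact h1.trans_lt hRk
    · rw [← dropCoord_apply_ne k (p := p) hj, ← Real.norm_eq_abs]
      exact ((norm_le_pi_norm _ j).trans h2).trans_lt (hρR j)
  have hC₀ : IsCompact C₀ := by
    refine Metric.isCompact_of_isClosed_isBounded ?_ ?_
    · have := (contDiff_dropCoord (m := 1) k).continuous
      exact (isClosed_le (f := fun p : Fin n → ℝ => |p k|) (by fun_prop) continuous_const).inter
        (isClosed_le (f := fun p : Fin n → ℝ => ‖dropCoord k p‖) (by fun_prop) continuous_const)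
    · refine (Metric.isBounded_closedBall (x := (0 : Fin n → ℝ)) (r := L + 2 * Real.pi + ρ)).subset ?_
      rintro p ⟨h1, h2⟩
      rw [mem_closedBall_zero_iff, pi_norm_le_iff_of_nonneg (by linarith)]
      intro j
      by_cases hj : j = k
      · rw [hj, Real.norm_eq_abs]; linarith
      · rw [← dropCoord_apply_ne k (p := p) hj]
        have := norm_le_pi_norm (dropCoord k p) j
        linarith
  have hC : IsCompact ((Subtype.val : box R → Fin n → ℝ) ⁻¹' C₀) :=
    Topology.IsInducing.subtypeVal.isCompact_preimage_iff (by rwa [Subtype.range_val]) |>.2 hC₀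
  have hG3 : ∀ t (x : S2) q, ∀ p ∉ ((Subtype.val : box R → Fin n → ℝ) ⁻¹' C₀),
      G t (x, (p : Fin n → ℝ), q) = 0 := by
    intro t x q p hp
    have hz : |(x : E3) 2| ≤ 1 := by
      rw [← sq_le_one_iff_abs_le_one]
      nlinarith [S2_normSq x, sq_nonneg ((x : E3) 0), sq_nonneg ((x : E3) 1)]
    have hS : M (shear k x p) = 0 ∧ W (shear k x p) = 0 := by
      refine hsupp _ ?_
      have e1 : dropCoord k (shear k x p) = dropCoord k (p : Fin n → ℝ) := dropCoord_add_single k _ _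
      have e2 : (shear k x p) k = (p : Fin n → ℝ) k + 2 * Real.pi * (x : E3) 2 := by simp [shear]
      rw [Set.mem_preimage, Set.mem_ofPred_eq, not_and_or, not_le, not_le] at hp
      rw [e1, e2]
      refine hp.imp (fun h => ?_) (fun h => h.le)
      have h3 := abs_sub_abs_le_abs_sub ((p : Fin n → ℝ) k) (-(2 * Real.pi * (x : E3) 2))
      rw [abs_neg, abs_mul, abs_of_pos (by positivity : 0 < 2 * Real.pi), sub_neg_eq_add] at h3
      nlinarith
    simp [G, twistHamiltonian, hS]
  have hHam : IsHamiltonian (prodModel n) (toHamiltonian (Subtype.val : box R → Fin n → ℝ) G) :=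
    isHamiltonian_toHamiltonian hι hG1 (contDiff_twistHamiltonian_fract hM hW hbs hb0 hb1) hC hG3
  obtain ⟨z, hz, htraj⟩ := hF _ hHam (by
    rintro t ⟨x, p, Q⟩ ⟨hx, hp⟩
    obtain ⟨q, rfl⟩ := torusMk_surjective Q
    obtain ⟨t, rfl⟩ := QuotientAddGroup.mk_surjective t
    rw [show ((QuotientAddGroup.mk t : UnitAddCircle)) = ((t : ℝ) : UnitAddCircle) from rfl,
      toHamiltonian_apply hG1]
    simp only at hp
    rw [hp]
    refine le_trans ?_ (twistHamiltonian_le (hβ _) hWb x 0 q)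
    have hsq : (x : E3) 2 ^ 2 = ε ^ 2 := by
      rcases hx with h | h <;> simp only at h <;> rw [h]
      ring
    have hz1 : |(x : E3) 2| ≤ 1 := by
      rw [← sq_le_one_iff_abs_le_one]
      nlinarith [S2_normSq x, sq_nonneg ((x : E3) 0), sq_nonneg ((x : E3) 1)]
    have e1 : shear k x (0 : Fin n → ℝ) = (2 * Real.pi * (x : E3) 2) • Pi.single k 1 := by
      simp [shear]
    rw [e1, (hMW _ (by
      rw [abs_mul, abs_of_pos (by positivity : 0 < 2 * Real.pi)]; nlinarith)).1]
    have e2 : (x : E3) 2 *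
        ((K + β * Real.pi) / (2 * Real.pi * ε ^ 2) * (2 * Real.pi * (x : E3) 2)) =
        K + β * Real.pi := by
      have : (x : E3) 2 ≠ 0 := by
        intro h
        rw [h] at hsq
        nlinarith [pow_pos hε 2]
      rw [← hsq]
      field_simp
    rw [e2]; linarith)
  have hzc : Continuous fun t : ℝ => z (t : UnitAddCircle) :=
    z.continuous.comp (AddCircle.continuous_mk' 1)
  obtain ⟨q, hq, hqz⟩ := exists_torus_lift (f := fun t : ℝ => (z t).2.2) (by fun_prop)
  have hcurve : (fun t : ℝ => z (t : UnitAddCircle)) =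
      fun t : ℝ => ((z t).1, (z t).2.1, torusMk (q t)) := by
    funext t; rw [hqz]
  have hinc := lift_increment_of_class hz hq hqz k
  rw [hcurve] at htraj
  have hx10 : z ((1 : ℝ) : UnitAddCircle) = z ((0 : ℝ) : UnitAddCircle) := by
    congr 1
    simp
  obtain ⟨y, hy, hdisp, hflip⟩ := twistHamiltonian_displacement hMd hWd hB hB0 hB1
    (x := fun t => ((z t).1 : E3)) (p := fun t => ((z t).2.1 : Fin n → ℝ)) (q := q) (k := k)
    (by fun_prop) (by fun_prop) hq (fun t => S2_normSq _) (fun t ht => by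
      obtain ⟨v, hv, hγ⟩ := htraj t
      have hft : Int.fract t = t := Int.fract_eq_self.2 ht
      exact hamiltonEquations_of_trajectory hasMFDerivAt_box_val (x := fun t => (z t).1)
        (p := fun t => (z t).2.1) (g := twistHamiltonian k M W t (b t))
        (fun x p q => by rw [toHamiltonian_apply hG1, hft])
        (ContDiff.differentiable (n := ∞)
          ((contDiff_twistHamiltonian (b := fun _ => b t) hM hW contDiff_const).comp
            (contDiff_const.prodMk contDiff_id)) (by simp)) hq.continuousAt hv hγ)
  rw [hinc, hx10] at hdisp
  rw [hx10] at hflip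
  set P₀ := shear k ((z ((0 : ℝ) : UnitAddCircle)).1 : E3)
    ((z ((0 : ℝ) : UnitAddCircle)).2.1 : Fin n → ℝ)
  rcases hcases P₀ with ⟨h1, h2⟩ | ⟨h1, h2⟩
  -- the trajectory stays on the equator at integral times, and `qₖ` returns to its initial value
  · have h3 := hflip h1
    have h4 : ((z ((0 : ℝ) : UnitAddCircle)).1 : E3) 2 = 0 := by linarith
    rw [h2, h4] at hdisp
    simp at hdisp
    exact hek hdisp
  -- the increment of `qₖ` is an integer of absolute value less than `1`
  · rw [h1, mul_zero, zero_add] at hdisp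
    have h5 : |(e k : ℝ)| < 1 := by
      rw [hdisp, abs_mul]
      have := mul_le_of_le_one_left (abs_nonneg (fderiv ℝ W P₀ (Pi.single k 1))) hy
      linarith
    have h6 : |e k| < 1 := by exact_mod_cast h5
    exact hek (Int.abs_lt_one_iff.1 h6)

/-! ### Stable displacement of a pair of parallel circles -/

theorem isClosed_circlePair (ε : ℝ) : IsClosed (circlePair ε) := by
  have h : Continuous fun x : S2 => (x : E3) 2 := by fun_prop
  exact (isClosed_eq h continuous_const).union (isClosed_eq h continuous_const)

section
variable {n : ℕ} (k : Fin n) (W : (Fin n → ℝ) → ℝ)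

/-- The coordinates, in `ℝ³ × ℝ^n × ℝ^n`, of the flow of `twistHamiltonian k 0 W` on
`S² × ℝ^n × T^n`. In the frame that rotates with `2πqₖ` it is the rotation about the second axis
with angular velocity `W(P)`, where `P = shear k x p` is conserved. -/
def twistFlow (t : ℝ) (w : E3 × (Fin n → ℝ) × (Fin n → ℝ)) : E3 × (Fin n → ℝ) × (Fin n → ℝ) :=
  let P := shear k w.1 w.2.1
  let Θ₀ := 2 * Real.pi * w.2.2 k
  let y0 := w.1 0 * Real.cos Θ₀ - w.1 1 * Real.sin Θ₀
  let y1 := w.1 0 * Real.sin Θ₀ + w.1 1 * Real.cos Θ₀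
  let y0t := y0 * Real.cos (W P * t) - w.1 2 * Real.sin (W P * t)
  let y2t := y0 * Real.sin (W P * t) + w.1 2 * Real.cos (W P * t)
  let q := fun j => w.2.2 j + t * (y1 * fderiv ℝ W P (Pi.single j 1))
  let Θ := 2 * Real.pi * q k
  (!₂[y0t * Real.cos Θ + y1 * Real.sin Θ, y1 * Real.cos Θ - y0t * Real.sin Θ, y2t],
    w.2.1 + (2 * Real.pi * (w.1 2 - y2t)) • (Pi.single k 1 : Fin n → ℝ), q)

theorem twistFlow_normSq (t : ℝ) (w : E3 × (Fin n → ℝ) × (Fin n → ℝ)) :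
    (twistFlow k W t w).1 0 ^ 2 + (twistFlow k W t w).1 1 ^ 2 + (twistFlow k W t w).1 2 ^ 2 =
      w.1 0 ^ 2 + w.1 1 ^ 2 + w.1 2 ^ 2 := by
  simp only [twistFlow]
  simp
  set P := shear k w.1 w.2.1
  set Θ₀ := 2 * Real.pi * w.2.2 k
  set y1 := w.1 0 * Real.sin Θ₀ + w.1 1 * Real.cos Θ₀ with hy1
  set Θ := 2 * Real.pi * (w.2.2 k + t * (y1 * fderiv ℝ W P (Pi.single k 1)))
  set y0 := w.1 0 * Real.cos Θ₀ - w.1 1 * Real.sin Θ₀ with hy0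
  have h1 := Real.sin_sq_add_cos_sq Θ
  have h2 := Real.sin_sq_add_cos_sq Θ₀
  have h3 := Real.sin_sq_add_cos_sq (W P * t)
  have e1 : y0 ^ 2 + y1 ^ 2 = w.1 0 ^ 2 + w.1 1 ^ 2 := by
    rw [hy0, hy1]
    linear_combination (w.1 0 ^ 2 + w.1 1 ^ 2) * h2
  linear_combination ((y0 * Real.cos (W P * t) - w.1 2 * Real.sin (W P * t)) ^ 2 + y1 ^ 2) * h1 +
    (y0 ^ 2 + w.1 2 ^ 2) * h3 + e1

theorem twistFlow_zero (w : E3 × (Fin n → ℝ) × (Fin n → ℝ)) : twistFlow k W 0 w = w := by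
  have h := Real.sin_sq_add_cos_sq (2 * Real.pi * w.2.2 k)
  refine Prod.ext ?_ (Prod.ext ?_ ?_)
  · ext i
    fin_cases i <;> simp [twistFlow]
    · linear_combination w.1 0 * h
    · linear_combination w.1 1 * h
  · simp [twistFlow]
  · simp [twistFlow]

/-- The curves `t ↦ twistFlow k W t w` solve Hamilton's equations of `twistHamiltonian k 0 W 0 1`. -/
theorem twistFlow_equations {W : (Fin n → ℝ) → ℝ} (hW : Differentiable ℝ W)
    (w : E3 × (Fin n → ℝ) × (Fin n → ℝ)) :
    ContDiff ℝ 1 (fun t => (twistFlow k W t w).1) ∧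
    ∀ t, ∃ u a c, HasDerivAt (fun t => (twistFlow k W t w).1) u t ∧
      HasDerivAt (fun t => (twistFlow k W t w).2.1) a t ∧
      HasDerivAt (fun t => (twistFlow k W t w).2.2) c t ∧
      HamiltonEquations (twistFlow k W t w).1
        (fderiv ℝ (twistHamiltonian k (fun _ => 0) W 0 1) (twistFlow k W t w)) u a c := by
  set P := shear k w.1 w.2.1 with hP
  set Θ₀ := 2 * Real.pi * w.2.2 k with hΘ₀
  set y0 := w.1 0 * Real.cos Θ₀ - w.1 1 * Real.sin Θ₀ with hy0
  set y1 := w.1 0 * Real.sin Θ₀ + w.1 1 * Real.cos Θ₀ with hy1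
  let y0t : ℝ → ℝ := fun t => y0 * Real.cos (W P * t) - w.1 2 * Real.sin (W P * t)
  let y2t : ℝ → ℝ := fun t => y0 * Real.sin (W P * t) + w.1 2 * Real.cos (W P * t)
  let d : Fin n → ℝ := fun j => fderiv ℝ W P (Pi.single j 1)
  let Θ : ℝ → ℝ := fun t => 2 * Real.pi * (w.2.2 k + t * (y1 * d k))
  have hx : ∀ t, (twistFlow k W t w).1 = !₂[y0t t * Real.cos (Θ t) + y1 * Real.sin (Θ t),
    y1 * Real.cos (Θ t) - y0t t * Real.sin (Θ t), y2t t] := fun t => rfl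
  have hxc : ContDiff ℝ 1 (fun t => (twistFlow k W t w).1) := by
    rw [contDiff_euclidean]
    intro i
    simp only [hx]
    fin_cases i <;> simp <;> fun_prop
  refine ⟨hxc, fun t => ?_⟩
  have d1 : HasDerivAt (fun s => W P * s) (W P) t := by
    simpa using (hasDerivAt_id t).const_mul (W P)
  have dy0 : HasDerivAt y0t (-(W P * y2t t)) t := by
    refine ((d1.cos.const_mul y0).sub (d1.sin.const_mul (w.1 2))).congr_deriv ?_
    simp only [y2t]; ring
  have dy2 : HasDerivAt y2t (W P * y0t t) t := by
    refine ((d1.sin.const_mul y0).add (d1.cos.const_mul (w.1 2))).congr_deriv ?_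
    simp only [y0t]; ring
  have dq : ∀ j, HasDerivAt (fun s => w.2.2 j + s * (y1 * d j)) (y1 * d j) t := fun j => by
    simpa using ((hasDerivAt_id t).mul_const (y1 * d j)).const_add (w.2.2 j)
  have dΘ : HasDerivAt Θ (2 * Real.pi * (y1 * d k)) t := (dq k).const_mul _
  have hu := (hxc.differentiable one_ne_zero t).hasDerivAt
  have hsh : shear k (twistFlow k W t w).1 (twistFlow k W t w).2.1 = P := by
    funext j
    simp [shear, twistFlow, hP]
    ring
  have hs := Real.sin_sq_add_cos_sq (Θ t)
  have c0 : (twistFlow k W t w).1 0 = y0t t * Real.cos (Θ t) + y1 * Real.sin (Θ t) := by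
    rw [hx]; simp
  have c1 : (twistFlow k W t w).1 1 = y1 * Real.cos (Θ t) - y0t t * Real.sin (Θ t) := by
    rw [hx]; simp
  have c2 : (twistFlow k W t w).1 2 = y2t t := by
    rw [hx]; simp
  refine ⟨_, (-(2 * Real.pi * (W P * y0t t))) • (Pi.single k 1 : Fin n → ℝ), fun j => y1 * d j, hu,
    ?_, hasDerivAt_pi.2 dq, ?_⟩
  · refine ((((dy2.const_sub (w.1 2)).const_mul (2 * Real.pi)).smul_const
      (Pi.single k 1 : Fin n → ℝ)).const_add w.2.1).congr_deriv ?_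
    congr 1
    ring
  · refine (twistHamiltonian_equations (x := (twistFlow k W t w).1) (p := (twistFlow k W t w).2.1)
      (q := (twistFlow k W t w).2.2) (differentiable_const 0) hW).2 ?_
    have hΘ : 2 * Real.pi * (twistFlow k W t w).2.2 k + 0 * 0 = Θ t := by
      simp only [zero_mul, add_zero]; rfl
    have hf : fderiv ℝ (fun _ : Fin n → ℝ => (0 : ℝ)) P = 0 := by simp
    simp only [hsh, hΘ, hf, c0, c1, c2]
    have k0 : (y0t t * Real.cos (Θ t) + y1 * Real.sin (Θ t)) * Real.cos (Θ t) -
        (y1 * Real.cos (Θ t) - y0t t * Real.sin (Θ t)) * Real.sin (Θ t) = y0t t := by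
      linear_combination y0t t * hs
    have k1 : (y0t t * Real.cos (Θ t) + y1 * Real.sin (Θ t)) * Real.sin (Θ t) +
        (y1 * Real.cos (Θ t) - y0t t * Real.sin (Θ t)) * Real.cos (Θ t) = y1 := by
      linear_combination y1 * hs
    rw [k0, k1]
    refine ⟨⟨?_, ?_, ?_⟩, ?_, ?_⟩
    · refine (hasDerivAt_E3_coord hu 0).unique ?_
      simp only [hx]
      refine ((dy0.mul dΘ.cos).add (dΘ.sin.const_mul y1)).congr_deriv ?_
      simp
      ring
    · refine (hasDerivAt_E3_coord hu 1).unique ?_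
      simp only [hx]
      refine ((dΘ.cos.const_mul y1).sub (dy0.mul dΘ.sin)).congr_deriv ?_
      simp
      ring
    · refine (hasDerivAt_E3_coord hu 2).unique ?_
      simp only [hx]
      refine dy2.congr_deriv ?_
      simp
    · intro j
      simp
    · intro j
      simp [d]
      ring

end

/-- For every `n ≥ 1`, the pair of circles is displaced by the flow of `twistHamiltonian` with
`W = π` near the sheared circles: it reflects `z` and so shifts the momentum by `4πz ≠ 0`. -/
theorem nStablyDisplaceable_circlePair {n : ℕ} (k : Fin n) {ε : ℝ} (hε : 0 < ε) :
    NStablyDisplaceable n areaForm (circlePair ε) := by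
  obtain ⟨L, hL, hprof⟩ := exists_profiles
  obtain ⟨M, W, -, hW, hMW, hsupp, -, -⟩ := hprof n k 0 1 one_pos
  have hpi := Real.pi_pos
  have hWd := hW.differentiable (by simp)
  let G : ℝ → E3 × (Fin n → ℝ) × (Fin n → ℝ) → ℝ :=
    fun _ => twistHamiltonian k (fun _ => 0) W 0 1
  have hG1 : ∀ t x p q q', torusMk q = torusMk q' → G t (x, p, q) = G t (x, p, q') :=
    fun t x p q q' h => twistHamiltonian_periodic x p q q' h
  have hG2 : ContDiff ℝ ∞ (twistHamiltonian k (fun _ => 0) W 0 1) :=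
    (contDiff_twistHamiltonian (b := fun _ => 1) contDiff_const hW contDiff_const).comp
      (contDiff_const.prodMk contDiff_id)
  have hz1 : ∀ x : S2, |(x : E3) 2| ≤ 1 := fun x => by
    rw [← sq_le_one_iff_abs_le_one]
    nlinarith [S2_normSq x, sq_nonneg ((x : E3) 0), sq_nonneg ((x : E3) 1)]
  have hG3 : ∀ t (x : S2) q, ∀ p ∉ (Metric.closedBall 0 (L + 2 * Real.pi) : Set (Fin n → ℝ)),
      G t (x, (id p : Fin n → ℝ), q) = 0 := by
    intro t x q p hp
    have hS : W (shear k x p) = 0 := by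
      by_contra hne
      have hne' : ¬ (L ≤ |shear k x p k| ∨ 1 ≤ ‖dropCoord k (shear k x p)‖) :=
        fun h => hne (hsupp _ h).2
      rw [not_or, not_le, not_le] at hne'
      obtain ⟨h1, h2⟩ := hne'
      have e1 : dropCoord k (shear k x p) = dropCoord k p := dropCoord_add_single k _ _
      have e2 : (shear k x p) k = p k + 2 * Real.pi * (x : E3) 2 := by simp [shear]
      rw [e1] at h2
      rw [e2] at h1
      refine hp ?_
      rw [mem_closedBall_zero_iff, pi_norm_le_iff_of_nonneg (by linarith)]
      intro j
      by_cases hj : j = k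
      · rw [hj, Real.norm_eq_abs]
        have h3 := abs_sub_abs_le_abs_sub (p k) (-(2 * Real.pi * (x : E3) 2))
        rw [abs_neg, abs_mul, abs_of_pos (by positivity : 0 < 2 * Real.pi), sub_neg_eq_add] at h3
        have := hz1 x
        nlinarith
      · rw [← dropCoord_apply_ne k (p := p) hj]
        have := norm_le_pi_norm (dropCoord k p) j
        linarith
    simp [G, twistHamiltonian, hS]
  have hHam : IsHamiltonian (prodModel n) (toHamiltonian (id : (Fin n → ℝ) → Fin n → ℝ) G) :=
    isHamiltonian_toHamiltonian contMDiff_id hG1 (hG2.comp contDiff_snd)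
      (isCompact_closedBall _ _) hG3
  let lift : S2 × (Fin n → ℝ) × Torus n → E3 × (Fin n → ℝ) × (Fin n → ℝ) :=
    fun z => (z.1, z.2.1, fun j => circleRep (z.2.2 j))
  have hnorm : ∀ t z, (twistFlow k W t (lift z)).1 ∈ Metric.sphere (0 : E3) 1 := by
    intro t z
    rw [mem_sphere_zero_iff_norm, ← sq_eq_sq₀ (norm_nonneg _) zero_le_one,
      ← real_inner_self_eq_norm_sq, E3_inner]
    have := (twistFlow_normSq k W t (lift z)).trans (S2_normSq z.1)
    linarith
  let φ : ℝ → S2 × (Fin n → ℝ) × Torus n → S2 × (Fin n → ℝ) × Torus n := fun t z =>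
    (⟨(twistFlow k W t (lift z)).1, hnorm t z⟩, (twistFlow k W t (lift z)).2.1,
      torusMk (twistFlow k W t (lift z)).2.2)
  refine ⟨_, φ, hHam, fun z => ⟨?_, fun t => ?_⟩, ?_⟩
  · simp only [φ, twistFlow_zero]
    exact Prod.ext rfl (Prod.ext rfl (funext fun j => coe_circleRep _))
  · obtain ⟨hx, h⟩ := twistFlow_equations k hWd (lift z)
    obtain ⟨u, a, c, hu, ha, hc, he⟩ := h t
    exact trajectory_of_hamiltonEquations (F := toHamiltonian id G)
      (g := twistHamiltonian k (fun _ => 0) W 0 1) (fun x p q => toHamiltonian_apply hG1 t x p q)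
      (hG2.differentiable (by simp)) (x := fun t => ⟨(twistFlow k W t (lift z)).1, hnorm t z⟩)
      (p := fun t => (twistFlow k W t (lift z)).2.1)
      (q := fun t => (twistFlow k W t (lift z)).2.2) hx hu ha hc he
  · have hcl : IsClosed {z : S2 × (Fin n → ℝ) × Torus n | z.1 ∈ circlePair ε ∧ z.2.1 = 0} :=
      ((isClosed_circlePair ε).preimage continuous_fst).inter
        (isClosed_eq (continuous_fst.comp continuous_snd) continuous_const)
    rw [hcl.closure_eq, Set.disjoint_left]
    rintro _ ⟨-, h2⟩ ⟨⟨x, p, Q⟩, ⟨hx, hp⟩, rfl⟩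
    simp only at hx hp
    have hx0 : (x : E3) 2 ≠ 0 := by
      rcases hx with h | h <;> rw [h]
      exacts [hε.ne', neg_ne_zero.2 hε.ne']
    have hW1 : W (shear k (x : E3) p) = Real.pi := by
      have e1 : shear k x p = (2 * Real.pi * (x : E3) 2) • Pi.single k 1 := by simp [shear, hp]
      rw [e1]
      refine (hMW _ ?_).2
      rw [abs_mul, abs_of_pos (by positivity : 0 < 2 * Real.pi)]
      have := hz1 x
      nlinarith
    have h3 := congrFun h2 k
    rw [hp] at hW1
    simp [φ, twistFlow, lift, hp, hW1] at h3
    exact hx0 (by linarith)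

/-! ### The area form is symplectic -/

theorem areaForm_self (x : S2) (v : E2) : areaForm x v v = 0 := by
  rw [areaForm_apply, tripleProduct_apply]
  ring

/-- In a chart, the area form is the triple product of the position with the partial derivatives of
the inverse chart as a map into `ℝ³`. -/
theorem areaForm_inChart_apply (x₀ : S2) {y : E2} (hy : y ∈ (extChartAt (𝓡 2) x₀).target)
    (u v : E2) :
    areaForm.inChart x₀ y u v = tripleProduct ((extChartAt (𝓡 2) x₀).symm y : S2)
      (fderiv ℝ (fun y => (((extChartAt (𝓡 2) x₀).symm y : S2) : E3)) y u)
      (fderiv ℝ (fun y => (((extChartAt (𝓡 2) x₀).symm y : S2) : E3)) y v) := by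
  have h1 : MDifferentiableAt 𝓘(ℝ, E2) (𝓡 2) (extChartAt (𝓡 2) x₀).symm y := by
    have h2 :=
      (contMDiffOn_extChartAt_symm (I := 𝓡 2) (n := 1) x₀).mdifferentiableOn one_ne_zero y hy
    exact h2.mdifferentiableAt ((isOpen_extChartAt_target x₀).mem_nhds hy)
  have h3 := HasMFDerivAt.comp y (hasMFDerivAt_sphere_coe ((extChartAt (𝓡 2) x₀).symm y))
    h1.hasMFDerivAt
  let D : E2 →L[ℝ] E2 := mfderiv 𝓘(ℝ, E2) (𝓡 2) (extChartAt (𝓡 2) x₀).symm y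
  have h4 : HasFDerivAt (fun y => (((extChartAt (𝓡 2) x₀).symm y : S2) : E3))
      ((sphereD ((extChartAt (𝓡 2) x₀).symm y)).comp D) y :=
    HasMFDerivAt.hasFDerivAt h3
  rw [h4.fderiv]
  rfl

theorem areaForm_inChart_contDiffOn (x₀ : S2) :
    ContDiffOn ℝ ∞ (areaForm.inChart x₀) (extChartAt (𝓡 2) x₀).target := by
  set f : E2 → E3 := fun y => (((extChartAt (𝓡 2) x₀).symm y : S2) : E3) with hf
  have ho : IsOpen (extChartAt (𝓡 2) x₀).target := isOpen_extChartAt_target x₀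
  have hfs : ContDiffOn ℝ ∞ f (extChartAt (𝓡 2) x₀).target :=
    ((contMDiff_coe_sphere (n := 2)).comp_contMDiffOn
      (contMDiffOn_extChartAt_symm (I := 𝓡 2) (n := ∞) x₀)).contDiffOn
  have hf' : ContDiffOn ℝ ∞ (fderiv ℝ f) (extChartAt (𝓡 2) x₀).target :=
    hfs.fderiv_of_isOpen ho (by simp)
  rw [contDiffOn_clm_apply]
  intro u
  rw [contDiffOn_clm_apply]
  intro v
  have c : ∀ i, ContDiffOn ℝ ∞ (fun y => f y i) (extChartAt (𝓡 2) x₀).target := fun i =>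
    (contDiff_E3_coord i).comp_contDiffOn hfs
  have cd : ∀ (w : E2) i, ContDiffOn ℝ ∞ (fun y => fderiv ℝ f y w i) (extChartAt (𝓡 2) x₀).target :=
    fun w i => (contDiff_E3_coord i).comp_contDiffOn (hf'.clm_apply contDiffOn_const)
  have : ContDiffOn ℝ ∞ (fun y =>
      f y 0 * (fderiv ℝ f y u 1 * fderiv ℝ f y v 2 - fderiv ℝ f y u 2 * fderiv ℝ f y v 1) +
      f y 1 * (fderiv ℝ f y u 2 * fderiv ℝ f y v 0 - fderiv ℝ f y u 0 * fderiv ℝ f y v 2) +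
      f y 2 * (fderiv ℝ f y u 0 * fderiv ℝ f y v 1 - fderiv ℝ f y u 1 * fderiv ℝ f y v 0))
      (extChartAt (𝓡 2) x₀).target :=
    (((c 0).mul (((cd u 1).mul (cd v 2)).sub ((cd u 2).mul (cd v 1)))).add
      ((c 1).mul (((cd u 2).mul (cd v 0)).sub ((cd u 0).mul (cd v 2))))).add
      ((c 2).mul (((cd u 0).mul (cd v 1)).sub ((cd u 1).mul (cd v 0))))
  refine this.congr fun y hy => ?_
  rw [areaForm_inChart_apply x₀ hy, tripleProduct_apply]

theorem alternating_E2_apply {A : E2 →L[ℝ] E2 →L[ℝ] ℝ} (hA : ∀ u, A u u = 0) (u v : E2) :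
    A u v = (u 0 * v 1 - u 1 * v 0) * A (EuclideanSpace.single 0 1) (EuclideanSpace.single 1 1) := by
  have hd : ∀ w : E2,
      w = w 0 • EuclideanSpace.single 0 1 + w 1 • (EuclideanSpace.single 1 1 : E2) := by
    intro w
    ext i
    fin_cases i <;> simp
  have h01 := hA (EuclideanSpace.single 0 1 + EuclideanSpace.single 1 1)
  have h0 := hA (EuclideanSpace.single 0 1)
  have h1 := hA (EuclideanSpace.single 1 1)
  simp only [map_add, add_apply, h0, h1] at h01
  conv_lhs => rw [hd u, hd v]
  simp only [map_add, map_smul, add_apply, smul_apply,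
    smul_eq_mul, h0, h1]
  linear_combination u 1 * v 0 * h01

/-- Every two-form on a surface is closed: its exterior derivative is an alternating trilinear form
in dimension two. -/
theorem cyclic_fderiv_eq_zero {σ : E2 → E2 →L[ℝ] E2 →L[ℝ] ℝ} {y : E2}
    (hd : DifferentiableAt ℝ σ y) (hσ : ∀ y u, σ y u u = 0) (u v w : E2) :
    fderiv ℝ σ y u v w + fderiv ℝ σ y v w u + fderiv ℝ σ y w u v = 0 := by
  have hA : ∀ w u : E2, fderiv ℝ σ y w u u = 0 := by
    intro w u
    have h1 := (hd.hasFDerivAt.clm_apply (hasFDerivAt_const u y)).clm_apply (hasFDerivAt_const u y)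
    simp only [hσ] at h1
    have h2 := DFunLike.congr_fun (h1.unique (hasFDerivAt_const 0 y)) w
    simpa using h2
  have hc : ∀ u v w : E2, fderiv ℝ σ y u v w = (v 0 * w 1 - v 1 * w 0) *
      (u 0 * fderiv ℝ σ y (EuclideanSpace.single 0 1) (EuclideanSpace.single 0 1)
          (EuclideanSpace.single 1 1) +
        u 1 * fderiv ℝ σ y (EuclideanSpace.single 1 1) (EuclideanSpace.single 0 1)
          (EuclideanSpace.single 1 1)) := by
    intro u v w
    rw [alternating_E2_apply (hA u)]
    congr 1
    have hu : u = u 0 • EuclideanSpace.single 0 1 + u 1 • (EuclideanSpace.single 1 1 : E2) := by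
      ext i
      fin_cases i <;> simp
    conv_lhs => rw [hu]
    simp only [map_add, map_smul, add_apply, smul_apply, smul_eq_mul]
  rw [hc u v w, hc v w u, hc w u v]
  ring

theorem areaForm_inChart_self (x₀ : S2) (y u : E2) : areaForm.inChart x₀ y u u = 0 := by
  let D : E2 →L[ℝ] E2 := mfderiv 𝓘(ℝ, E2) (𝓡 2) (extChartAt (𝓡 2) x₀).symm y
  exact areaForm_self ((extChartAt (𝓡 2) x₀).symm y) (D u)

theorem areaForm_inChart_closed (x₀ : S2) {y : E2} (hy : y ∈ (extChartAt (𝓡 2) x₀).target)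
    (u v w : E2) : fderiv ℝ (areaForm.inChart x₀) y u v w + fderiv ℝ (areaForm.inChart x₀) y v w u +
      fderiv ℝ (areaForm.inChart x₀) y w u v = 0 := by
  have hd : DifferentiableAt ℝ (areaForm.inChart x₀) y :=
    ((areaForm_inChart_contDiffOn x₀).differentiableOn (by simp) y hy).differentiableAt
      ((isOpen_extChartAt_target x₀).mem_nhds hy)
  exact cyclic_fderiv_eq_zero hd (areaForm_inChart_self x₀) u v w

theorem areaForm_nondegenerate (x : S2) (v : E2) (h : ∀ w, areaForm x v w = 0) : v = 0 := by
  have h1 := (areaForm_contract_iff x 0 v).1 (fun w => by rw [zero_apply, neg_zero]; exact h w)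
  simp only [zero_apply, mul_zero, sub_zero] at h1
  refine sphereD_injective x (Eq.trans ?_ (map_zero (sphereD x)).symm)
  ext i
  fin_cases i
  exacts [h1.1, h1.2.1, h1.2.2]

theorem areaForm_isSymplectic : areaForm.IsSymplectic where
  alternating := areaForm_self
  nondegenerate := areaForm_nondegenerate
  smooth := areaForm_inChart_contDiffOn
  closed x₀ _ hy := areaForm_inChart_closed x₀ hy

/-! ### Volume-preserving flows in `ℝ³` -/

theorem det_E3_eq (f : E3 →L[ℝ] E3) :
    f.det = (Matrix.of fun i j : Fin 3 => f (EuclideanSpace.single j 1) i).det := by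
  rw [ContinuousLinearMap.det, ← LinearMap.det_toMatrix (EuclideanSpace.basisFun (Fin 3) ℝ).toBasis]
  congr 1

theorem abs_mul_le_sq {a b L : ℝ} (ha : |a| ≤ L) (hb : |b| ≤ L) : |a * b| ≤ L ^ 2 := by
  rw [abs_mul, sq]
  exact mul_le_mul ha hb (abs_nonneg _) ((abs_nonneg _).trans ha)

theorem abs_mul_mul_le_cube {a b c L : ℝ} (ha : |a| ≤ L) (hb : |b| ≤ L) (hc : |c| ≤ L) :
    |a * b * c| ≤ L ^ 3 := by
  rw [abs_mul, pow_succ]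
  exact mul_le_mul (abs_mul_le_sq ha hb) hc (abs_nonneg _) (by positivity)

/-- The determinant of `1 + hB` has no linear term in `h` if `B` is trace-free. -/
theorem det_id_add_smul_ge {B : E3 →L[ℝ] E3} {L : ℝ} (hB : ‖B‖ ≤ L)
    (htr : ∑ i : Fin 3, B (EuclideanSpace.single i 1) i = 0) {h : ℝ} (h0 : 0 ≤ h) (h1 : h ≤ 1) :
    1 - (6 * L ^ 2 + 6 * L ^ 3) * h ^ 2 ≤ (ContinuousLinearMap.id ℝ E3 + h • B).det := by
  have hb : ∀ i j : Fin 3, |B (EuclideanSpace.single j 1) i| ≤ L := fun i j => by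
    have h2 := PiLp.norm_apply_le (B (EuclideanSpace.single j 1)) i
    have h3 := B.le_opNorm (EuclideanSpace.single j 1)
    rw [Real.norm_eq_abs] at h2
    simp only [EuclideanSpace.single, PiLp.norm_single, norm_one, mul_one] at h3
    linarith
  rw [det_E3_eq, Matrix.det_fin_three]
  rw [Fin.sum_univ_three] at htr
  simp only [Matrix.of_apply, add_apply, ContinuousLinearMap.coe_id', id_eq,
    FunLike.coe_smul, Pi.smul_apply, PiLp.add_apply, PiLp.smul_apply, smul_eq_mul]
  simp only [EuclideanSpace.single, PiLp.ofLp_single, Pi.single_apply]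
  simp only [EuclideanSpace.single] at htr hb
  generalize hm : (fun i j : Fin 3 => B (PiLp.single 2 j 1) i) = m at *
  have hm' : ∀ i j : Fin 3, B (PiLp.single 2 j 1) i = m i j := fun i j => by rw [← hm]
  simp only [hm'] at *
  simp only [if_true, if_neg (show ¬(0 : Fin 3) = 1 by decide),
    if_neg (show ¬(0 : Fin 3) = 2 by decide), if_neg (show ¬(1 : Fin 3) = 0 by decide),
    if_neg (show ¬(1 : Fin 3) = 2 by decide), if_neg (show ¬(2 : Fin 3) = 0 by decide),
    if_neg (show ¬(2 : Fin 3) = 1 by decide)]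
  have q1 := abs_le.mp (abs_mul_le_sq (hb 0 0) (hb 1 1))
  have q2 := abs_le.mp (abs_mul_le_sq (hb 0 0) (hb 2 2))
  have q3 := abs_le.mp (abs_mul_le_sq (hb 1 1) (hb 2 2))
  have q4 := abs_le.mp (abs_mul_le_sq (hb 0 1) (hb 1 0))
  have q5 := abs_le.mp (abs_mul_le_sq (hb 0 2) (hb 2 0))
  have q6 := abs_le.mp (abs_mul_le_sq (hb 1 2) (hb 2 1))
  have c1 := abs_le.mp (abs_mul_mul_le_cube (hb 0 0) (hb 1 1) (hb 2 2))
  have c2 := abs_le.mp (abs_mul_mul_le_cube (hb 0 0) (hb 1 2) (hb 2 1))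
  have c3 := abs_le.mp (abs_mul_mul_le_cube (hb 0 1) (hb 1 0) (hb 2 2))
  have c4 := abs_le.mp (abs_mul_mul_le_cube (hb 0 1) (hb 1 2) (hb 2 0))
  have c5 := abs_le.mp (abs_mul_mul_le_cube (hb 0 2) (hb 1 0) (hb 2 1))
  have c6 := abs_le.mp (abs_mul_mul_le_cube (hb 0 2) (hb 1 1) (hb 2 0))
  have hL : 0 ≤ L := (norm_nonneg _).trans hB
  have hh : h ^ 3 ≤ h ^ 2 := pow_le_pow_of_le_one h0 h1 (by norm_num)
  have e2 : -(6 * L ^ 2) ≤ m 0 0 * m 1 1 + m 0 0 * m 2 2 + m 1 1 * m 2 2 - m 0 1 * m 1 0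
      - m 0 2 * m 2 0 - m 1 2 * m 2 1 := by linarith [q1.1, q2.1, q3.1, q4.2, q5.2, q6.2]
  have e3 : -(6 * L ^ 3) ≤ m 0 0 * m 1 1 * m 2 2 - m 0 0 * m 1 2 * m 2 1 - m 0 1 * m 1 0 * m 2 2
      + m 0 1 * m 1 2 * m 2 0 + m 0 2 * m 1 0 * m 2 1 - m 0 2 * m 1 1 * m 2 0 := by
    linarith [c1.1, c2.2, c3.2, c4.1, c5.1, c6.2]
  have f2 := mul_le_mul_of_nonneg_right e2 (by positivity : 0 ≤ h ^ 2)
  have f3 := mul_le_mul_of_nonneg_right e3 (by positivity : 0 ≤ h ^ 3)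
  have f4 := mul_le_mul_of_nonneg_left hh (by positivity : 0 ≤ 6 * L ^ 3)
  linear_combination f2 + f3 + f4 - h * htr

/-- One step of length `h` of the Euler scheme, followed for the time-dependent field `G`. -/
def eulerStep (G : ℝ × E3 → E3) (h t : ℝ) (x : E3) : E3 := x + h • G (t, x)

/-- The Euler scheme with step size `h`, started at time `0`. -/
def eulerScheme (G : ℝ × E3 → E3) (h : ℝ) : ℕ → E3 → E3
  | 0 => id
  | j + 1 => fun x => eulerStep G h (j * h) (eulerScheme G h j x)

/-- A time-dependent vector field on `ℝ³` that is bounded, globally Lipschitz and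
divergence-free. -/
structure IsSolenoidal (G : ℝ × E3 → E3) (A : ℝ) (L : NNReal) : Prop where
  differentiable : Differentiable ℝ G
  lipschitz : LipschitzWith L G
  bounded : ∀ z, ‖G z‖ ≤ A
  divergence : ∀ t x, ∑ i : Fin 3,
    (fderiv ℝ (fun y => G (t, y)) x (EuclideanSpace.single i 1)) i = 0

namespace IsSolenoidal

variable {G : ℝ × E3 → E3} {A : ℝ} {L : NNReal}

theorem lipschitz_space (hG : IsSolenoidal G A L) (t : ℝ) : LipschitzWith L (fun x => G (t, x)) := by
  have h := hG.lipschitz.comp (LipschitzWith.prodMk_left t)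
  rw [mul_one] at h
  exact h

theorem differentiable_space (hG : IsSolenoidal G A L) (t : ℝ) :
    Differentiable ℝ (fun x => G (t, x)) := by
  have := hG.differentiable
  fun_prop

theorem continuous_eulerStep (hG : IsSolenoidal G A L) (h t : ℝ) : Continuous (eulerStep G h t) := by
  have := (hG.differentiable_space t).continuous
  exact continuous_id.add (this.const_smul h)

theorem continuous_eulerScheme (hG : IsSolenoidal G A L) (h : ℝ) (j : ℕ) :
    Continuous (eulerScheme G h j) := by
  induction j with
  | zero => exact continuous_id
  | succ j ih => exact (hG.continuous_eulerStep h _).comp ih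

theorem eulerStep_injective (hG : IsSolenoidal G A L) {h : ℝ} (h0 : 0 ≤ h) (hL : h * L < 1) (t : ℝ) :
    Function.Injective (eulerStep G h t) := by
  intro x y hxy
  have h1 : x - y = h • (G (t, y) - G (t, x)) := by
    unfold eulerStep at hxy
    rw [smul_sub, sub_eq_sub_iff_add_eq_add, hxy, add_comm]
  have h2 := (hG.lipschitz_space t).norm_sub_le y x
  have h3 : ‖x - y‖ ≤ h * (L * ‖x - y‖) := by
    calc ‖x - y‖ = h * ‖G (t, y) - G (t, x)‖ := by
          conv_lhs => rw [h1]
          rw [norm_smul, Real.norm_of_nonneg h0]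
      _ ≤ h * (L * ‖x - y‖) := by rw [norm_sub_rev x y]; gcongr
  have h4 : ‖x - y‖ ≤ 0 := by
    by_contra hc
    push Not at hc
    nlinarith
  exact sub_eq_zero.mp (norm_le_zero_iff.mp h4)

theorem volume_eulerStep_ge (hG : IsSolenoidal G A L) {h : ℝ} (h0 : 0 ≤ h) (h1 : h ≤ 1)
    (hL : h * L < 1) (t : ℝ) {K : Set E3} (hK : IsCompact K) :
    ENNReal.ofReal (1 - (6 * (L : ℝ) ^ 2 + 6 * L ^ 3) * h ^ 2) * MeasureTheory.volume K
      ≤ MeasureTheory.volume (eulerStep G h t '' K) := by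
  have hd : ∀ x ∈ K, HasFDerivWithinAt (eulerStep G h t)
      (ContinuousLinearMap.id ℝ E3 + h • fderiv ℝ (fun y => G (t, y)) x) K x := fun x _ =>
    ((hasFDerivAt_id x).add
      ((hG.differentiable_space t x).hasFDerivAt.const_smul h)).hasFDerivWithinAt
  rw [← MeasureTheory.lintegral_abs_det_fderiv_eq_addHaar_image MeasureTheory.volume
    hK.measurableSet hd (hG.eulerStep_injective h0 hL t).injOn, ← MeasureTheory.setLIntegral_const]
  refine MeasureTheory.lintegral_mono fun x => ENNReal.ofReal_le_ofReal ?_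
  exact (det_id_add_smul_ge (norm_fderiv_le_of_lipschitz ℝ (hG.lipschitz_space t))
    (hG.divergence t x) h0 h1).trans (le_abs_self _)

theorem volume_eulerScheme_ge (hG : IsSolenoidal G A L) {h : ℝ} (h0 : 0 ≤ h) (h1 : h ≤ 1)
    (hL : h * L < 1) {K : Set E3} (hK : IsCompact K) (j : ℕ) :
    ENNReal.ofReal (1 - (6 * (L : ℝ) ^ 2 + 6 * L ^ 3) * h ^ 2) ^ j * MeasureTheory.volume K
      ≤ MeasureTheory.volume (eulerScheme G h j '' K) := by
  induction j with
  | zero => simp [eulerScheme]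
  | succ j ih =>
    have h2 := hG.volume_eulerStep_ge h0 h1 hL (j * h)
      (hK.image (hG.continuous_eulerScheme h j))
    rw [Set.image_image] at h2
    rw [pow_succ', mul_assoc]
    exact (mul_le_mul_right ih _).trans h2

/-- The Euler scheme has local error of second order. -/
theorem eulerStep_error (hG : IsSolenoidal G A L) {c : ℝ → E3} {t h : ℝ} (h0 : 0 ≤ h)
    (hc : ∀ s ∈ Set.Icc t (t + h), HasDerivAt c (G (s, c s)) s) :
    ‖c (t + h) - eulerStep G h t (c t)‖ ≤ L * (1 + A) * h ^ 2 := by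
  have hA : 0 ≤ A := (norm_nonneg _).trans (hG.bounded 0)
  have h1 : ∀ s ∈ Set.Icc t (t + h), ‖c s - c t‖ ≤ A * (s - t) :=
    norm_image_sub_le_of_norm_deriv_le_segment' (fun s hs => (hc s hs).hasDerivWithinAt)
      fun s _ => hG.bounded _
  have h2 := norm_image_sub_le_of_norm_deriv_le_segment' (f := fun s => c s - s • G (t, c t))
    (f' := fun s => G (s, c s) - G (t, c t)) (C := L * (1 + A) * h) (a := t) (b := t + h)
    (fun s hs => by
      have := (hc s hs).sub ((hasDerivAt_id s).smul_const (G (t, c t)))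
      simp only [one_smul] at this
      exact this.hasDerivWithinAt)
    (fun s hs => by
      have h3 := hG.lipschitz.norm_sub_le (s, c s) (t, c t)
      have h4 := h1 s ⟨hs.1, hs.2.le⟩
      have h5 : ‖((s, c s) : ℝ × E3) - (t, c t)‖ ≤ (1 + A) * h := by
        rw [Prod.mk_sub_mk, Prod.norm_mk, max_le_iff, Real.norm_of_nonneg (by linarith [hs.1])]
        have h6 : s - t ≤ h := by linarith [hs.2]
        constructor
        · nlinarith
        · nlinarith [mul_le_mul_of_nonneg_left h6 hA]
      calc _ ≤ _ := h3
        _ ≤ L * ((1 + A) * h) := by gcongr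
        _ = _ := by ring) (t + h) ⟨by linarith, le_rfl⟩
  have h3 : c (t + h) - (t + h) • G (t, c t) - (c t - t • G (t, c t))
      = c (t + h) - eulerStep G h t (c t) := by
    unfold eulerStep
    module
  rw [h3] at h2
  calc _ ≤ _ := h2
    _ = _ := by ring

/-- The local errors of order `h²` accumulate with the factor `1 + hL` per step. -/
theorem eulerScheme_error (hG : IsSolenoidal G A L) {c : ℝ → E3} {h : ℝ} (h0 : 0 ≤ h) {N : ℕ}
    (hN : N * h ≤ 1) (hc : ∀ s ∈ Set.Icc (0 : ℝ) 1, HasDerivAt c (G (s, c s)) s) :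
    ∀ j ≤ N, ‖c (j * h) - eulerScheme G h j (c 0)‖
      ≤ j * (L * (1 + A) * h ^ 2) * (1 + h * L) ^ j := by
  have hA : 0 ≤ A := (norm_nonneg _).trans (hG.bounded 0)
  intro j
  induction j with
  | zero => intro _; simp [eulerScheme]
  | succ j ih =>
    intro hj
    have ih := ih (by omega)
    have hj1 : ((j : ℝ) + 1) * h ≤ 1 := by
      have : ((j : ℝ) + 1) ≤ N := by exact_mod_cast hj
      nlinarith
    have h1 := hG.eulerStep_error (c := c) (t := j * h) h0 (fun s hs => hc s
      ⟨(by positivity : (0 : ℝ) ≤ j * h).trans hs.1, by linarith [hs.2]⟩)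
    set y := eulerScheme G h j (c 0) with hy
    have h2 : ‖eulerStep G h (j * h) (c (j * h)) - eulerStep G h (j * h) y‖
        ≤ (1 + h * L) * ‖c (j * h) - y‖ := by
      have h3 := (hG.lipschitz_space (j * h)).norm_sub_le (c (j * h)) y
      have h4 : eulerStep G h (j * h) (c (j * h)) - eulerStep G h (j * h) y
          = (c (j * h) - y) + h • (G (j * h, c (j * h)) - G (j * h, y)) := by
        unfold eulerStep; module
      rw [h4]
      refine (norm_add_le _ _).trans ?_
      rw [norm_smul, Real.norm_of_nonneg h0]
      nlinarith [mul_le_mul_of_nonneg_left h3 h0]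
    have h5 : ((j + 1 : ℕ) : ℝ) * h = j * h + h := by push_cast; ring
    have h6 : eulerScheme G h (j + 1) (c 0) = eulerStep G h (j * h) y := rfl
    rw [h5, h6]
    have hC : 0 ≤ L * (1 + A) * h ^ 2 := by positivity
    have hq : 1 ≤ 1 + h * (L : ℝ) := by nlinarith [L.coe_nonneg]
    have hp : 1 ≤ (1 + h * (L : ℝ)) ^ (j + 1) := one_le_pow₀ hq
    calc ‖c (j * h + h) - eulerStep G h (j * h) y‖
        ≤ ‖c (j * h + h) - eulerStep G h (j * h) (c (j * h))‖
          + ‖eulerStep G h (j * h) (c (j * h)) - eulerStep G h (j * h) y‖ :=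
          norm_sub_le_norm_sub_add_norm_sub _ _ _
      _ ≤ L * (1 + A) * h ^ 2 + (1 + h * L) * (j * (L * (1 + A) * h ^ 2) * (1 + h * L) ^ j) :=
          add_le_add h1 (h2.trans (mul_le_mul_of_nonneg_left ih (by linarith)))
      _ ≤ L * (1 + A) * h ^ 2 * (1 + h * L) ^ (j + 1)
          + (1 + h * L) * (j * (L * (1 + A) * h ^ 2) * (1 + h * L) ^ j) :=
          add_le_add (le_mul_of_one_le_right hC hp) le_rfl
      _ = _ := by push_cast; ring

/-- After time one, the Euler scheme with step size `1 / N` has error of order `1 / N`. -/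
theorem eulerScheme_error_le (hG : IsSolenoidal G A L) {c : ℝ → E3} {N : ℕ} (hN : 0 < N)
    (hc : ∀ s ∈ Set.Icc (0 : ℝ) 1, HasDerivAt c (G (s, c s)) s) :
    ‖c 1 - eulerScheme G (1 / N) N (c 0)‖ ≤ L * (1 + A) * Real.exp L / N := by
  have hA : 0 ≤ A := (norm_nonneg _).trans (hG.bounded 0)
  have hN' : (0 : ℝ) < N := by exact_mod_cast hN
  have hNh : (N : ℝ) * (1 / N) = 1 := by field_simp
  have h1 := hG.eulerScheme_error (c := c) (h := 1 / N) (by positivity) (N := N) hNh.le hc N le_rfl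
  rw [hNh] at h1
  have h2 : (1 + 1 / (N : ℝ) * L) ^ N ≤ Real.exp L := by
    calc (1 + 1 / (N : ℝ) * L) ^ N ≤ (Real.exp (1 / N * L)) ^ N :=
          pow_le_pow_left₀ (by positivity) (by linarith [Real.add_one_le_exp (1 / (N : ℝ) * L)]) _
      _ = Real.exp L := by rw [← Real.exp_nat_mul]; congr 1; field_simp
  calc _ ≤ _ := h1
    _ ≤ N * (L * (1 + A) * (1 / N) ^ 2) * Real.exp L := by gcongr
    _ = _ := by field_simp

/-- The time-one map of the flow of a divergence-free field depends continuously on the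
starting point. -/
theorem continuousOn_timeOne (hG : IsSolenoidal G A L) {c : E3 → ℝ → E3} {K : Set E3}
    (hc0 : ∀ x ∈ K, c x 0 = x)
    (hc : ∀ x ∈ K, ∀ s ∈ Set.Icc (0 : ℝ) 1, HasDerivAt (c x) (G (s, c x s)) s) :
    ContinuousOn (fun x => c x 1) K := by
  refine LipschitzOnWith.continuousOn (K := ⟨Real.exp L, (Real.exp_pos _).le⟩) ?_
  refine LipschitzOnWith.of_dist_le_mul fun x hx y hy => ?_
  have h := dist_le_of_trajectories_ODE (v := fun t x => G (t, x)) (fun t => hG.lipschitz_space t)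
    (fun t ht => (hc x hx t ht).continuousAt.continuousWithinAt)
    (fun t ht => (hc x hx t ⟨ht.1, ht.2.le⟩).hasDerivWithinAt)
    (fun t ht => (hc y hy t ht).continuousAt.continuousWithinAt)
    (fun t ht => (hc y hy t ⟨ht.1, ht.2.le⟩).hasDerivWithinAt)
    le_rfl 1 ⟨zero_le_one, le_rfl⟩
  rw [hc0 x hx, hc0 y hy, sub_zero, mul_one, mul_comm] at h
  exact h

/-- **Liouville's theorem**, as an inequality: the time-one map of a divergence-free field does not
decrease the volume of compact sets. It is the limit of the Euler schemes with step `1 / N`, each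
step of which decreases the volume by a factor `1 - O(1 / N²)` at most. -/
theorem volume_le_volume_timeOne (hG : IsSolenoidal G A L) {c : E3 → ℝ → E3} {K : Set E3}
    (hK : IsCompact K) (hc0 : ∀ x ∈ K, c x 0 = x)
    (hc : ∀ x ∈ K, ∀ s ∈ Set.Icc (0 : ℝ) 1, HasDerivAt (c x) (G (s, c x s)) s) :
    MeasureTheory.volume K ≤ MeasureTheory.volume ((fun x => c x 1) '' K) := by
  have hcpt : IsCompact ((fun x => c x 1) '' K) :=
    hK.image_of_continuousOn (hG.continuousOn_timeOne hc0 hc)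
  set D : ℝ := 6 * (L : ℝ) ^ 2 + 6 * L ^ 3 with hD
  set C : ℝ := L * (1 + A) * Real.exp L with hC
  have hCN : Filter.Tendsto (fun N : ℕ => C / N) Filter.atTop (nhds 0) :=
    tendsto_const_div_atTop_nhds_zero_nat C
  have hDN : Filter.Tendsto (fun N : ℕ => 1 - D / N) Filter.atTop (nhds 1) := by
    simpa using (tendsto_const_div_atTop_nhds_zero_nat D).const_sub 1
  -- the Euler images of `K` lie in the `C / N`-neighbourhood of the image under the flow
  have hlim := (tendsto_measure_cthickening_of_isCompact (μ := MeasureTheory.volume) hcpt).comp hCN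
  have hlim2 : Filter.Tendsto (fun N : ℕ => ENNReal.ofReal (1 - D / N) * MeasureTheory.volume K)
      Filter.atTop (nhds (MeasureTheory.volume K)) := by
    have h := ENNReal.Tendsto.mul_const (b := MeasureTheory.volume K)
      ((ENNReal.continuous_ofReal.tendsto 1).comp hDN) (Or.inl (by simp))
    rw [ENNReal.ofReal_one, one_mul] at h
    exact h
  refine le_of_tendsto_of_tendsto hlim2 hlim ?_
  obtain ⟨N₀, hN₀⟩ := exists_nat_gt (max (L : ℝ) D)
  filter_upwards [Filter.eventually_ge_atTop (max N₀ 1)] with N hN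
  have hN1 : 1 ≤ N := (le_max_right _ _).trans hN
  have hN1' : (1 : ℝ) ≤ N := by exact_mod_cast hN1
  have hNpos : (0 : ℝ) < N := by linarith
  have hN2 : (N₀ : ℝ) ≤ N := by exact_mod_cast (le_max_left _ _).trans hN
  have hLN : (L : ℝ) < N := ((le_max_left _ _).trans_lt hN₀).trans_le hN2
  have hDN' : D < N := ((le_max_right _ _).trans_lt hN₀).trans_le hN2
  have h1 := hG.volume_eulerScheme_ge (h := 1 / N) (by positivity)
    (by rw [div_le_one hNpos]; exact hN1') (by rw [one_div_mul_eq_div, div_lt_one hNpos]; exact hLN)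
    hK N
  have hD2 : 0 ≤ 1 - D * (1 / (N : ℝ)) ^ 2 := by
    have : D * (1 / (N : ℝ)) ^ 2 ≤ 1 := by
      rw [div_pow, one_pow, mul_one_div, div_le_one (by positivity)]
      nlinarith
    linarith
  have h2 : 1 - D / N ≤ (1 - D * (1 / (N : ℝ)) ^ 2) ^ N := by
    have := one_add_mul_le_pow (a := -(D * (1 / (N : ℝ)) ^ 2)) (by linarith) N
    rw [← sub_eq_add_neg] at this
    refine le_trans (le_of_eq ?_) this
    field_simp
    ring
  calc ENNReal.ofReal (1 - D / N) * MeasureTheory.volume K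
      ≤ ENNReal.ofReal (1 - D * (1 / (N : ℝ)) ^ 2) ^ N * MeasureTheory.volume K := by
        rw [← ENNReal.ofReal_pow hD2]
        gcongr
    _ ≤ _ := h1
    _ ≤ _ := by
        refine MeasureTheory.measure_mono ?_
        rintro _ ⟨x, hx, rfl⟩
        have h3 := hG.eulerScheme_error_le (c := c x) (N := N) (by omega) (hc x hx)
        rw [hc0 x hx, ← dist_eq_norm, dist_comm] at h3
        exact Metric.mem_cthickening_of_dist_le _ (c x 1) _ _ ⟨x, hx, rfl⟩ h3

end IsSolenoidal

/-! ### Hamiltonian isotopies of the sphere preserve area -/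

/-- The radial projection `ℝ³ ∖ {0} → S²`; its value at `0` is arbitrary. -/
def radial (x : E3) : S2 :=
  if h : x = 0 then Classical.arbitrary S2 else ⟨‖x‖⁻¹ • x, by
    rw [mem_sphere_zero_iff_norm, norm_smul, norm_inv, norm_norm,
      inv_mul_cancel₀ (norm_ne_zero_iff.mpr h)]⟩

theorem coe_radial {x : E3} (h : x ≠ 0) : (radial x : E3) = ‖x‖⁻¹ • x := by
  rw [radial, dif_neg h]

theorem norm_smul_radial {x : E3} (h : x ≠ 0) : ‖x‖ • (radial x : E3) = x := by
  rw [coe_radial h, smul_smul, mul_inv_cancel₀ (norm_ne_zero_iff.mpr h), one_smul]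

theorem coe_S2_ne_zero (y : S2) : (y : E3) ≠ 0 := ne_zero_of_mem_unit_sphere y

theorem radial_smul {r : ℝ} (hr : 0 < r) {x : E3} (hx : x ≠ 0) : radial (r • x) = radial x := by
  apply Subtype.ext
  rw [coe_radial hx, coe_radial (smul_ne_zero hr.ne' hx), norm_smul, Real.norm_of_nonneg hr.le,
    smul_smul]
  congr 1
  field_simp

theorem radial_coe (y : S2) : radial (y : E3) = y := by
  apply Subtype.ext
  rw [coe_radial (coe_S2_ne_zero y)]
  simp

theorem contMDiffAt_radial {x : E3} (hx : x ≠ 0) : ContMDiffAt 𝓘(ℝ, E3) (𝓡 2) ∞ radial x := by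
  let U : TopologicalSpace.Opens E3 := ⟨{0}ᶜ, isOpen_compl_singleton⟩
  have h1 : ContMDiff 𝓘(ℝ, E3) 𝓘(ℝ, E3) ∞ (fun y : U => ‖(y : E3)‖⁻¹ • (y : E3)) := by
    intro y
    have hy : (y : E3) ≠ 0 := y.2
    have h2 : ContDiffAt ℝ ∞ (fun y : E3 => ‖y‖⁻¹ • y) y :=
      ((contDiffAt_norm ℝ hy).inv (norm_ne_zero_iff.mpr hy)).smul contDiffAt_id
    exact contMDiffAt_subtype_iff.mpr h2.contMDiffAt
  have h3 := h1.codRestrict_sphere (n := 2) (fun y : U => by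
    have hy : (y : E3) ≠ 0 := y.2
    rw [← coe_radial hy]
    exact (radial _).2)
  have h4 : ContMDiff 𝓘(ℝ, E3) (𝓡 2) ∞ (fun y : U => radial (y : E3)) :=
    h3.congr fun y => Subtype.ext (coe_radial (x := (y : E3)) y.2)
  exact contMDiffAt_subtype_iff.mp (h4 ⟨x, hx⟩)

theorem continuousAt_radial {x : E3} (hx : x ≠ 0) : ContinuousAt radial x :=
  (contMDiffAt_radial hx).continuousAt

/-- A cutoff function of the squared norm: it is `1` on `[1/8, 9/8]`, a neighbourhood of the values
`[1/4, 1]` on the shell `1/2 ≤ ‖x‖ ≤ 1`, and `0` outside `(1/16, 19/16)`. -/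
def radialCutoff : ContDiffBump (5 / 8 : ℝ) := ⟨1 / 2, 9 / 16, by norm_num, by norm_num⟩

theorem radialCutoff_eq_one {s : ℝ} (h1 : 1 / 8 ≤ s) (h2 : s ≤ 9 / 8) : radialCutoff s = 1 := by
  apply radialCutoff.one_of_mem_closedBall
  rw [Metric.mem_closedBall, Real.dist_eq, abs_le]
  constructor <;> simp only [radialCutoff] <;> linarith

theorem radialCutoff_eq_zero {s : ℝ} (h : s ≤ 1 / 16 ∨ 19 / 16 ≤ s) : radialCutoff s = 0 := by
  apply radialCutoff.zero_of_le_dist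
  rw [Real.dist_eq, le_abs]
  rcases h with h | h
  · right; simp only [radialCutoff]; linarith
  · left; simp only [radialCutoff]; linarith

/-- The extension of a function on the sphere to a compactly supported function on `ℝ³` that is
homogeneous of degree one near the shell `1/2 ≤ ‖x‖ ≤ 1`. -/
def homogeneousExt (f : S2 → ℝ) (x : E3) : ℝ := radialCutoff (‖x‖ ^ 2) * ‖x‖ * f (radial x)

theorem homogeneousExt_coe (f : S2 → ℝ) (y : S2) : homogeneousExt f (y : E3) = f y := by
  rw [homogeneousExt, radial_coe, norm_eq_of_mem_sphere, radialCutoff_eq_one] <;> norm_num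

theorem homogeneousExt_eq_zero (f : S2 → ℝ) {x : E3} (h : ‖x‖ ^ 2 ≤ 1 / 16 ∨ 19 / 16 ≤ ‖x‖ ^ 2) :
    homogeneousExt f x = 0 := by
  rw [homogeneousExt, radialCutoff_eq_zero h, zero_mul, zero_mul]

theorem homogeneousExt_smul_eventuallyEq (f : S2 → ℝ) {r : ℝ} (h1 : 1 / 2 ≤ r) (h2 : r ≤ 1)
    (y : S2) : (fun x => homogeneousExt f (r • x)) =ᶠ[nhds (y : E3)]
      fun x => r * homogeneousExt f x := by
  have hc : ContinuousAt (fun x : E3 => ‖x‖ ^ 2) (y : E3) := by fun_prop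
  have hy : ‖(y : E3)‖ ^ 2 = 1 := by rw [norm_eq_of_mem_sphere]; norm_num
  have h3 : ∀ᶠ x in nhds (y : E3), ‖x‖ ^ 2 ∈ Set.Ioo (1 / 2 : ℝ) (9 / 8) :=
    hc.eventually (Ioo_mem_nhds (by simp only [hy]; norm_num) (by simp only [hy]; norm_num))
  filter_upwards [h3] with x hx
  have hx0 : x ≠ 0 := by rintro rfl; norm_num at hx
  have hr : 0 < r := by linarith
  have h4 : ‖r • x‖ ^ 2 = r ^ 2 * ‖x‖ ^ 2 := by rw [norm_smul, mul_pow, Real.norm_eq_abs, sq_abs]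
  have h5 : 1 / 4 ≤ r ^ 2 := by nlinarith
  have h6 : r ^ 2 ≤ 1 := by nlinarith
  have h7 := hx.1
  have h8 := hx.2
  unfold homogeneousExt
  rw [h4, radial_smul hr hx0, radialCutoff_eq_one (by nlinarith) (by nlinarith),
    radialCutoff_eq_one (by nlinarith) (by nlinarith), norm_smul, Real.norm_of_nonneg hr.le]
  ring

theorem contDiff_homogeneousExt {F : UnitAddCircle → S2 → ℝ} (hF : IsHamiltonian (𝓡 2) F) :
    ContDiff ℝ ∞ (fun z : ℝ × E3 => homogeneousExt (F z.1) z.2) := by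
  rw [contDiff_iff_contDiffAt]
  rintro ⟨t, x⟩
  by_cases hx : x = 0
  · refine ContDiffAt.congr_of_eventuallyEq (f := fun _ => (0 : ℝ)) contDiffAt_const ?_
    have hc : ContinuousAt (fun z : ℝ × E3 => ‖z.2‖ ^ 2) (t, x) := by fun_prop
    have h0 : ‖(t, x).2‖ ^ 2 < (1 / 16 : ℝ) := by simp [hx]
    filter_upwards [hc.eventually (gt_mem_nhds h0)] with z hz
    exact homogeneousExt_eq_zero _ (Or.inl hz.le)
  · have h1 : ContMDiffAt 𝓘(ℝ, ℝ × E3) (𝓘(ℝ, ℝ).prod (𝓡 2)) ∞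
        (fun z : ℝ × E3 => (z.1, radial z.2)) (t, x) := by
      refine ContMDiffAt.prodMk contDiff_fst.contMDiff.contMDiffAt ?_
      exact ContMDiffAt.comp (t, x) (I' := 𝓘(ℝ, E3)) (g := radial) (f := Prod.snd)
        (contMDiffAt_radial hx) contDiff_snd.contMDiff.contMDiffAt
    have h2 : ContDiffAt ℝ ∞ (fun z : ℝ × E3 => F z.1 (radial z.2)) (t, x) :=
      ContMDiffAt.contDiffAt (ContMDiffAt.comp (t, x) (hF.smooth (t, radial x)) h1)
    have h3 : ContDiffAt ℝ ∞ (fun z : ℝ × E3 => ‖z.2‖) (t, x) :=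
      ContDiffAt.norm ℝ contDiffAt_snd hx
    have h4 : ContDiffAt ℝ ∞ (fun z : ℝ × E3 => radialCutoff (‖z.2‖ ^ 2)) (t, x) :=
      radialCutoff.contDiff.contDiffAt.comp (t, x) (h3.pow 2)
    exact (h4.mul h3).mul h2

/-- The vector field `x ↦ x × ∇f(x)` on `ℝ³`. On the sphere it is the Hamiltonian vector field of
the restriction of `f`. -/
def rotField (f : E3 → ℝ) (x : E3) : E3 :=
  let L := fderiv ℝ f x
  !₂[x 1 * L (EuclideanSpace.single 2 1) - x 2 * L (EuclideanSpace.single 1 1),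
    x 2 * L (EuclideanSpace.single 0 1) - x 0 * L (EuclideanSpace.single 2 1),
    x 0 * L (EuclideanSpace.single 1 1) - x 1 * L (EuclideanSpace.single 0 1)]

/-- The field `x × ∇f` is divergence-free, by the symmetry of the second derivative of `f`. -/
theorem divergence_rotField {f : E3 → ℝ} (hf : ContDiff ℝ ∞ f) (x : E3) :
    ∑ i : Fin 3, (fderiv ℝ (rotField f) x (EuclideanSpace.single i 1)) i = 0 := by
  have hd : DifferentiableAt ℝ (fderiv ℝ f) x :=
    ((hf.fderiv_right (m := ∞) (by exact_mod_cast le_rfl)).differentiable (by simp)) x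
  set B := fderiv ℝ (fderiv ℝ f) x with hB
  have hp : ∀ w : E3, HasFDerivAt (fun y => fderiv ℝ f y w)
      ((ContinuousLinearMap.apply ℝ ℝ w).comp B) x := fun w =>
    (ContinuousLinearMap.apply ℝ ℝ w).hasFDerivAt.comp x hd.hasFDerivAt
  have hs : ∀ v w, B v w = B w v := fun v w =>
    (hf.contDiffAt.isSymmSndFDerivAt (x := x) (by
      rw [minSmoothness_of_isRCLikeNormedField]
      exact WithTop.coe_le_coe.mpr (le_top : (2 : ℕ∞) ≤ ⊤))) v w
  have hc : ∀ i : Fin 3, HasFDerivAt (fun y : E3 => y i)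
      (EuclideanSpace.proj (𝕜 := ℝ) i : E3 →L[ℝ] ℝ) x := fun i =>
    (EuclideanSpace.proj (𝕜 := ℝ) i : E3 →L[ℝ] ℝ).hasFDerivAt
  have hR : DifferentiableAt ℝ (rotField f) x := by
    rw [differentiableAt_euclidean]
    intro i
    have h0 := fun w => (hp w).differentiableAt
    have h1 := fun i => (hc i).differentiableAt
    fin_cases i
    · exact ((h1 1).mul (h0 _)).sub ((h1 2).mul (h0 _))
    · exact ((h1 2).mul (h0 _)).sub ((h1 0).mul (h0 _))
    · exact ((h1 0).mul (h0 _)).sub ((h1 1).mul (h0 _))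
  have hcomp : ∀ (i : Fin 3) (D : E3 →L[ℝ] ℝ), HasFDerivAt (fun y => rotField f y i) D x →
      ∀ w, (fderiv ℝ (rotField f) x w) i = D w := by
    intro i D hD w
    have h1 : HasFDerivAt (fun y => rotField f y i)
        ((EuclideanSpace.proj (𝕜 := ℝ) i : E3 →L[ℝ] ℝ).comp (fderiv ℝ (rotField f) x)) x :=
      (EuclideanSpace.proj (𝕜 := ℝ) i : E3 →L[ℝ] ℝ).hasFDerivAt.comp x hR.hasFDerivAt
    rw [← h1.unique hD]
    rfl
  rw [Fin.sum_univ_three,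
    hcomp 0 _ (((hc 1).mul (hp (EuclideanSpace.single 2 1))).sub
      ((hc 2).mul (hp (EuclideanSpace.single 1 1)))),
    hcomp 1 _ (((hc 2).mul (hp (EuclideanSpace.single 0 1))).sub
      ((hc 0).mul (hp (EuclideanSpace.single 2 1)))),
    hcomp 2 _ (((hc 0).mul (hp (EuclideanSpace.single 1 1))).sub
      ((hc 1).mul (hp (EuclideanSpace.single 0 1))))]
  simp [hs (EuclideanSpace.single 1 1) (EuclideanSpace.single 0 1),
    hs (EuclideanSpace.single 2 1) (EuclideanSpace.single 0 1),
    hs (EuclideanSpace.single 2 1) (EuclideanSpace.single 1 1)]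

/-- A continuous function of `(t, x)` that is periodic in `t` and vanishes for large `x` is
bounded. -/
theorem exists_bound_of_periodic {W : Type*} [NormedAddCommGroup W] {g : ℝ × E3 → W}
    (hg : Continuous g) (hper : ∀ t x, g (t + 1, x) = g (t, x)) {R : ℝ}
    (hsupp : ∀ t x, R < ‖x‖ → g (t, x) = 0) : ∃ C : ℝ, 0 ≤ C ∧ ∀ z, ‖g z‖ ≤ C := by
  obtain ⟨C, hC⟩ := ((isCompact_Icc (a := (0 : ℝ)) (b := 1)).prod
    (isCompact_closedBall (0 : E3) R)).exists_bound_of_continuousOn hg.continuousOn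
  refine ⟨max C 0, le_max_right _ _, ?_⟩
  rintro ⟨t, x⟩
  by_cases hx : R < ‖x‖
  · rw [hsupp t x hx, norm_zero]; exact le_max_right _ _
  · have hp : Function.Periodic (fun s => g (s, x)) 1 := fun s => hper s x
    have h1 : g (Int.fract t, x) = g (t, x) := by
      have := hp.sub_int_mul_eq ⌊t⌋ (x := t)
      rw [mul_one, Int.self_sub_floor] at this
      exact this
    rw [← h1]
    exact (hC _ ⟨⟨Int.fract_nonneg t, (Int.fract_lt_one t).le⟩, by
      rw [mem_closedBall_zero_iff]; exact not_lt.mp hx⟩).trans (le_max_left _ _)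

/-- The extension to `ℝ³` of the Hamiltonian vector field of `F`. -/
def extField (F : UnitAddCircle → S2 → ℝ) (z : ℝ × E3) : E3 :=
  rotField (homogeneousExt (F z.1)) z.2

theorem contDiff_rotField {g : ℝ × E3 → ℝ} (hg : ContDiff ℝ ∞ g) :
    ContDiff ℝ ∞ (fun z : ℝ × E3 => rotField (fun x => g (z.1, x)) z.2) := by
  have h1 : ∀ (z : ℝ × E3) (w : E3),
      fderiv ℝ (fun x => g (z.1, x)) z.2 w = fderiv ℝ g z (0, w) := by
    intro z w
    have h2 := ((hg.differentiable (by simp)) z).hasFDerivAt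
    have h3 : HasFDerivAt (fun x : E3 => ((z.1, x) : ℝ × E3))
        (ContinuousLinearMap.inr ℝ ℝ E3) z.2 := hasFDerivAt_prodMk_right z.1 z.2
    have h4 : HasFDerivAt (fun x => g (z.1, x)) _ z.2 := HasFDerivAt.comp (g := g) z.2 h2 h3
    rw [h4.fderiv]
    simp
  have h2 : ∀ w : E3, ContDiff ℝ ∞ (fun z : ℝ × E3 => fderiv ℝ (fun x => g (z.1, x)) z.2 w) := by
    intro w
    simp only [h1]
    exact (hg.fderiv_right (m := ∞) (by exact_mod_cast le_rfl)).clm_apply contDiff_const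
  have h3 : ∀ i : Fin 3, ContDiff ℝ ∞ (fun z : ℝ × E3 => z.2 i) := fun i => by fun_prop
  rw [contDiff_euclidean]
  intro i
  fin_cases i
  · exact ((h3 1).mul (h2 _)).sub ((h3 2).mul (h2 _))
  · exact ((h3 2).mul (h2 _)).sub ((h3 0).mul (h2 _))
  · exact ((h3 0).mul (h2 _)).sub ((h3 1).mul (h2 _))

theorem contDiff_extField {F : UnitAddCircle → S2 → ℝ} (hF : IsHamiltonian (𝓡 2) F) :
    ContDiff ℝ ∞ (extField F) :=
  contDiff_rotField (contDiff_homogeneousExt hF)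

theorem contDiff_homogeneousExt_slice {F : UnitAddCircle → S2 → ℝ} (hF : IsHamiltonian (𝓡 2) F)
    (t : ℝ) : ContDiff ℝ ∞ (homogeneousExt (F t)) :=
  ContDiff.comp (g := fun z : ℝ × E3 => homogeneousExt (F z.1) z.2) (f := fun x => (t, x))
    (contDiff_homogeneousExt hF) (contDiff_prodMk_right t)

theorem rotField_eq_zero {f : E3 → ℝ} {x : E3} (h : f =ᶠ[nhds x] fun _ => 0) : rotField f x = 0 := by
  have h1 : fderiv ℝ f x = 0 := by rw [h.fderiv_eq]; simp
  ext i
  fin_cases i <;> simp [rotField, h1]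

theorem extField_eq_zero (F : UnitAddCircle → S2 → ℝ) (t : ℝ) {x : E3} (hx : 2 < ‖x‖) :
    extField F (t, x) = 0 := by
  apply rotField_eq_zero
  filter_upwards [continuous_norm.continuousAt.eventually (lt_mem_nhds hx)] with y hy
  exact homogeneousExt_eq_zero _ (Or.inr (by nlinarith))

theorem extField_add_one (F : UnitAddCircle → S2 → ℝ) (t : ℝ) (x : E3) :
    extField F (t + 1, x) = extField F (t, x) := by
  unfold extField
  simp

theorem isSolenoidal_extField {F : UnitAddCircle → S2 → ℝ} (hF : IsHamiltonian (𝓡 2) F) :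
    ∃ A L, IsSolenoidal (extField F) A L := by
  have hs := contDiff_extField hF
  obtain ⟨A, -, hA⟩ := exists_bound_of_periodic hs.continuous (extField_add_one F)
    (fun t x hx => extField_eq_zero F t hx)
  obtain ⟨L, hL0, hL⟩ := exists_bound_of_periodic (g := fderiv ℝ (extField F)) (R := 2)
    (hs.continuous_fderiv (by simp))
    (fun t x => by
      have h1 : (fun z : ℝ × E3 => extField F (z + (1, 0))) = extField F := by
        ext1 ⟨s, y⟩
        rw [Prod.mk_add_mk, add_zero]
        exact extField_add_one F s y
      have h2 := fderiv_comp_add_right (𝕜 := ℝ) (f := extField F) (x := (t, x)) ((1, 0) : ℝ × E3)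
      rw [h1, Prod.mk_add_mk, add_zero] at h2
      exact h2.symm)
    (fun t x hx => by
      have h1 : extField F =ᶠ[nhds (t, x)] fun _ => 0 := by
        have hc : ContinuousAt (fun z : ℝ × E3 => ‖z.2‖) (t, x) := by fun_prop
        filter_upwards [hc.eventually (lt_mem_nhds hx)] with z hz
        exact extField_eq_zero F z.1 hz
      rw [h1.fderiv_eq]
      simp)
  refine ⟨A, ⟨L, hL0⟩, hs.differentiable (by simp), ?_, hA, fun t x => ?_⟩
  · exact lipschitzWith_of_nnnorm_fderiv_le (hs.differentiable (by simp)) fun z => hL z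
  · exact divergence_rotField (contDiff_homogeneousExt_slice hF t) x

/-- The field `x × ∇f` of the homogeneous extension is itself homogeneous of degree one on the shell. -/
theorem rotField_smul {f : S2 → ℝ} {r : ℝ} (h1 : 1 / 2 ≤ r) (h2 : r ≤ 1) (y : S2)
    (hf : Differentiable ℝ (homogeneousExt f)) :
    rotField (homogeneousExt f) (r • (y : E3)) = r • rotField (homogeneousExt f) y := by
  have h3 : HasFDerivAt (fun x => homogeneousExt f (r • x))
      ((fderiv ℝ (homogeneousExt f) (r • (y : E3))).comp (r • ContinuousLinearMap.id ℝ E3))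
      (y : E3) :=
    HasFDerivAt.comp (g := homogeneousExt f) (y : E3) (hf (r • (y : E3))).hasFDerivAt
      ((hasFDerivAt_id (y : E3)).const_smul r)
  have h4 : HasFDerivAt (fun x => r * homogeneousExt f x) (r • fderiv ℝ (homogeneousExt f) y)
      (y : E3) := (hf y).hasFDerivAt.const_mul r
  have h5 := h3.unique (h4.congr_of_eventuallyEq (homogeneousExt_smul_eventuallyEq f h1 h2 y))
  have hr : r ≠ 0 := by positivity
  have h6 : fderiv ℝ (homogeneousExt f) (r • (y : E3)) = fderiv ℝ (homogeneousExt f) y := by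
    ext w
    have := DFunLike.congr_fun h5 w
    simp only [ContinuousLinearMap.comp_apply, FunLike.coe_smul, Pi.smul_apply,
      ContinuousLinearMap.coe_id', id_eq, map_smul, smul_eq_mul] at this
    exact mul_left_cancel₀ hr this
  unfold rotField
  rw [h6]
  ext i
  fin_cases i <;> simp <;> ring

/-- The curves `r • γ(t)`, where `γ` is a Hamiltonian trajectory on the sphere, are integral curves
of the extended field. -/
theorem hasDerivAt_of_sphere_trajectory {F : UnitAddCircle → S2 → ℝ} (hF : IsHamiltonian (𝓡 2) F)
    {γ : ℝ → S2} (hγ : IsHamiltonianTrajectory areaForm F γ) {r : ℝ} (h1 : 1 / 2 ≤ r) (h2 : r ≤ 1)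
    (t : ℝ) : HasDerivAt (fun s => r • (γ s : E3)) (extField F (t, r • (γ t : E3))) t := by
  obtain ⟨v, hv, hd⟩ := hγ t
  have hd' : HasDerivAt (fun s => (γ s : E3)) (sphereD (γ t) v) t := by
    have h := HasMFDerivAt.comp t (hasMFDerivAt_sphere_coe (γ t)) hd
    have h' := hasDerivAt_of_hasMFDerivAt h
    refine h'.congr_deriv ?_
    change sphereD (γ t) ((1 : ℝ) • v) = _
    rw [one_smul]
  have hdf : Differentiable ℝ (homogeneousExt (F t)) :=
    (contDiff_homogeneousExt_slice hF t).differentiable (by simp)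
  set L : E3 →L[ℝ] ℝ := fderiv ℝ (homogeneousExt (F t)) (γ t : E3) with hL
  have hm : HasMFDerivAt (𝓡 2) 𝓘(ℝ, ℝ) (F t) (γ t) (L.comp (sphereD (γ t))) := by
    have h := HasMFDerivAt.comp (f := fun y : S2 => (y : E3)) (g := homogeneousExt (F t)) (γ t)
      (hdf (γ t : E3)).hasFDerivAt.hasMFDerivAt (hasMFDerivAt_sphere_coe (γ t))
    have h3 : homogeneousExt (F t) ∘ (fun y : S2 => (y : E3)) = F t :=
      funext fun y => homogeneousExt_coe (F t) y
    rw [h3] at h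
    exact h
  have h3 : ∀ w : E2, areaForm (γ t) v w = -L (sphereD (γ t) w) := by
    intro w
    have h4 := hv w
    have h5 : mvfderiv (𝓡 2) (F t) (γ t) w = L (sphereD (γ t) w) := by
      have := hm.mfderiv
      unfold mvfderiv
      rw [this]
      rfl
    rw [h5] at h4
    exact h4
  obtain ⟨e0, e1, e2⟩ := (areaForm_contract_iff (γ t) L v).mp h3
  have h4 : sphereD (γ t) v = rotField (homogeneousExt (F t)) (γ t) := by
    ext i
    fin_cases i
    · exact e0
    · exact e1
    · exact e2
  refine (hd'.const_smul r).congr_deriv ?_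
  rw [h4]
  exact (rotField_smul h1 h2 (γ t) hdf).symm

/-- The spherical shell `1/2 ≤ ‖x‖ ≤ 1`. -/
def shell : Set E3 := {x | 1 / 2 ≤ ‖x‖ ∧ ‖x‖ ≤ 1}

theorem ne_zero_of_mem_shell {x : E3} (hx : x ∈ shell) : x ≠ 0 := by
  rintro rfl
  have := hx.1
  norm_num at this

theorem isCompact_shell : IsCompact shell := by
  refine (isCompact_closedBall (0 : E3) 1).of_isClosed_subset ?_ fun x hx => by
    rw [mem_closedBall_zero_iff]; exact hx.2
  exact (isClosed_le continuous_const continuous_norm).inter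
    (isClosed_le continuous_norm continuous_const)

theorem continuousOn_radial_shell : ContinuousOn radial shell := fun _ hx =>
  (continuousAt_radial (ne_zero_of_mem_shell hx)).continuousWithinAt

theorem aemeasurable_radial :
    AEMeasurable radial (MeasureTheory.volume.restrict shell) :=
  continuousOn_radial_shell.aemeasurable isCompact_shell.measurableSet

/-- The area measure on the sphere, up to a constant factor: the measure of a set is the volume of
the part of the shell lying over it. -/
def sphereMeasure : MeasureTheory.Measure S2 :=
  (MeasureTheory.volume.restrict shell).map radial

theorem sphereMeasure_apply {T : Set S2} (hT : MeasurableSet T) :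
    sphereMeasure T = MeasureTheory.volume (shell ∩ radial ⁻¹' T) := by
  rw [sphereMeasure, MeasureTheory.Measure.map_apply_of_aemeasurable aemeasurable_radial hT,
    MeasureTheory.Measure.restrict_apply₀' isCompact_shell.measurableSet.nullMeasurableSet,
    Set.inter_comm]

instance : MeasureTheory.IsFiniteMeasure sphereMeasure := by
  constructor
  rw [sphereMeasure_apply MeasurableSet.univ, Set.preimage_univ, Set.inter_univ]
  exact isCompact_shell.measure_lt_top

theorem sphereMeasure_pos {U : Set S2} (hU : IsOpen U) (hne : U.Nonempty) : 0 < sphereMeasure U := by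
  obtain ⟨y, hy⟩ := hne
  rw [sphereMeasure_apply hU.measurableSet]
  have h0 : (3 / 4 : ℝ) • (y : E3) ≠ 0 := smul_ne_zero (by norm_num) (coe_S2_ne_zero y)
  refine MeasureTheory.Measure.measure_pos_of_mem_nhds _ (x := (3 / 4 : ℝ) • (y : E3)) ?_
  have hn : ‖(3 / 4 : ℝ) • (y : E3)‖ = 3 / 4 := by
    rw [norm_smul, norm_eq_of_mem_sphere]; norm_num
  refine Filter.inter_mem ?_ ((continuousAt_radial h0).preimage_mem_nhds ?_)
  · have hI : Set.Icc (1 / 2 : ℝ) 1 ∈ nhds ‖(3 / 4 : ℝ) • (y : E3)‖ := by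
      rw [hn]; exact Icc_mem_nhds (by norm_num) (by norm_num)
    exact continuous_norm.continuousAt.preimage_mem_nhds hI
  · rw [radial_smul (by norm_num) (coe_S2_ne_zero y), radial_coe]
    exact hU.mem_nhds hy

theorem isCompact_shell_inter {T : Set S2} (hT : IsCompact T) :
    IsCompact (shell ∩ radial ⁻¹' T) :=
  isCompact_shell.of_isClosed_subset
    (continuousOn_radial_shell.preimage_isClosed_of_isClosed isCompact_shell.isClosed hT.isClosed)
    Set.inter_subset_left

section isotopy

variable {F : UnitAddCircle → S2 → ℝ} {φ : ℝ → S2 → S2}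

theorem hasDerivAt_cone_isotopy (hF : IsHamiltonian (𝓡 2) F)
    (hφ : IsHamiltonianIsotopy areaForm F φ) {x : E3} (hx : x ∈ shell) (s : ℝ) :
    HasDerivAt (fun s => ‖x‖ • (φ s (radial x) : E3)) (extField F (s, ‖x‖ • (φ s (radial x) : E3)))
      s :=
  hasDerivAt_of_sphere_trajectory hF (hφ (radial x)).2 hx.1 hx.2 s

theorem cone_isotopy_zero (hφ : IsHamiltonianIsotopy areaForm F φ) {x : E3} (hx : x ∈ shell) :
    ‖x‖ • (φ 0 (radial x) : E3) = x := by
  rw [(hφ (radial x)).1, norm_smul_radial (ne_zero_of_mem_shell hx)]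

theorem coe_mem_shell (y : S2) : (y : E3) ∈ shell := by
  have h := norm_eq_of_mem_sphere y
  constructor <;> rw [h]
  norm_num

theorem continuous_timeOne (hF : IsHamiltonian (𝓡 2) F)
    (hφ : IsHamiltonianIsotopy areaForm F φ) : Continuous (φ 1) := by
  obtain ⟨A, L, hG⟩ := isSolenoidal_extField hF
  have h := hG.continuousOn_timeOne (c := fun x s => ‖x‖ • (φ s (radial x) : E3)) (K := shell)
    (fun x hx => cone_isotopy_zero hφ hx) (fun x hx s _ => hasDerivAt_cone_isotopy hF hφ hx s)
  have h2 := h.comp_continuous continuous_subtype_val coe_mem_shell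
  refine continuous_induced_rng.mpr (h2.congr fun y => ?_)
  simp [radial_coe]

theorem injective_timeOne (hF : IsHamiltonian (𝓡 2) F)
    (hφ : IsHamiltonianIsotopy areaForm F φ) : Function.Injective (φ 1) := by
  -- uniqueness for the extended field, backwards from time `1`
  obtain ⟨A, L, hG⟩ := isSolenoidal_extField hF
  intro x y hxy
  have h : ∀ (x : S2) (s : ℝ), HasDerivAt (fun s => (φ s x : E3)) (extField F (s, (φ s x : E3))) s :=
    fun x s => by
      have := hasDerivAt_of_sphere_trajectory hF (hφ x).2 (r := 1) (by norm_num) le_rfl s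
      simpa only [one_smul] using this
  have h1 := ODE_solution_unique_of_mem_Icc (v := fun t x => extField F (t, x)) (K := L)
    (s := fun _ => Set.univ) (f := fun s => (φ s x : E3)) (g := fun s => (φ s y : E3))
    (a := -1) (b := 2) (t₀ := 1) (fun t _ => (hG.lipschitz_space t).lipschitzOnWith)
    (by norm_num) (fun s _ => (h x s).continuousAt.continuousWithinAt) (fun s _ => h x s)
    (fun _ _ => Set.mem_univ _) (fun s _ => (h y s).continuousAt.continuousWithinAt)
    (fun s _ => h y s) (fun _ _ => Set.mem_univ _) (by rw [hxy])
  have h2 := h1 (show (0 : ℝ) ∈ Set.Icc (-1) 2 by norm_num)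
  simp only [(hφ x).1, (hφ y).1] at h2
  exact Subtype.ext h2

/-- The time-one map of a Hamiltonian isotopy does not decrease the areas of compact sets: the
extended flow maps the cone over `T` into the cone over the image of `T`. -/
theorem sphereMeasure_le_image (hF : IsHamiltonian (𝓡 2) F)
    (hφ : IsHamiltonianIsotopy areaForm F φ) {T : Set S2} (hT : IsCompact T) :
    sphereMeasure T ≤ sphereMeasure (φ 1 '' T) := by
  obtain ⟨A, L, hG⟩ := isSolenoidal_extField hF
  rw [sphereMeasure_apply hT.measurableSet,
    sphereMeasure_apply (hT.image (continuous_timeOne hF hφ)).measurableSet]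
  refine (hG.volume_le_volume_timeOne (c := fun x s => ‖x‖ • (φ s (radial x) : E3))
    (isCompact_shell_inter hT) (fun x hx => cone_isotopy_zero hφ hx.1)
    (fun x hx s _ => hasDerivAt_cone_isotopy hF hφ hx.1 s)).trans (MeasureTheory.measure_mono ?_)
  rintro _ ⟨x, hx, rfl⟩
  have hpos : 0 < ‖x‖ := norm_pos_iff.mpr (ne_zero_of_mem_shell hx.1)
  constructor
  · have h1 : ‖(‖x‖ • (φ 1 (radial x) : E3))‖ = ‖x‖ := by
      rw [norm_smul, norm_norm, norm_eq_of_mem_sphere, mul_one]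
    change 1 / 2 ≤ ‖(‖x‖ • (φ 1 (radial x) : E3))‖ ∧ ‖(‖x‖ • (φ 1 (radial x) : E3))‖ ≤ 1
    rw [h1]
    exact hx.1
  · refine ⟨radial x, hx.2, ?_⟩
    rw [radial_smul hpos (coe_S2_ne_zero _), radial_coe]

end isotopy

/-! ### Cylindrical coordinates on the sphere -/

/-- The point of the sphere with height `p.1 ∈ [-1, 1]` and longitude `p.2`. -/
def cylindrical (p : ℝ × ℝ) : E3 :=
  !₂[√(1 - p.1 ^ 2) * Real.cos p.2, √(1 - p.1 ^ 2) * Real.sin p.2, p.1]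

theorem continuous_cylindrical : Continuous cylindrical := by
  refine (PiLp.continuous_toLp 2 _).comp (continuous_pi fun i => ?_)
  fin_cases i <;> simp <;> fun_prop

theorem norm_sq_E3 (x : E3) : ‖x‖ ^ 2 = x 0 ^ 2 + x 1 ^ 2 + x 2 ^ 2 := by
  rw [← real_inner_self_eq_norm_sq, E3_inner]; ring

theorem norm_cylindrical {p : ℝ × ℝ} (hp : p.1 ∈ Set.Icc (-1 : ℝ) 1) : ‖cylindrical p‖ = 1 := by
  have h0 : 0 ≤ 1 - p.1 ^ 2 := by nlinarith [hp.1, hp.2]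
  have h1 : ‖cylindrical p‖ ^ 2 = 1 := by
    rw [norm_sq_E3]
    simp only [cylindrical, Matrix.cons_val_zero, Matrix.cons_val_one, Matrix.cons_val]
    linear_combination (Real.cos p.2 ^ 2 + Real.sin p.2 ^ 2) * Real.sq_sqrt h0 +
      (1 - p.1 ^ 2) * Real.sin_sq_add_cos_sq p.2
  exact (pow_eq_one_iff_of_nonneg (norm_nonneg _) two_ne_zero).mp h1

theorem exists_cylindrical (y : S2) :
    ∃ θ ∈ Set.Ioc (-Real.pi) Real.pi, cylindrical ((y : E3) 2, θ) = y := by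
  have hy := S2_normSq y
  set c : ℂ := ⟨(y : E3) 0, (y : E3) 1⟩ with hc
  have hn : √(1 - (y : E3) 2 ^ 2) = ‖c‖ := by
    rw [Complex.norm_def, Complex.normSq_mk]
    congr 1
    linarith
  refine ⟨c.arg, Complex.arg_mem_Ioc c, ?_⟩
  ext i
  fin_cases i
  · simp [cylindrical, hn, hc]
  · simp [cylindrical, hn, hc]
  · rfl

theorem abs_height_le (y : S2) : (y : E3) 2 ∈ Set.Icc (-1 : ℝ) 1 := by
  have hy := S2_normSq y
  constructor <;> nlinarith [sq_nonneg ((y : E3) 0), sq_nonneg ((y : E3) 1)]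

theorem continuous_height : Continuous fun y : S2 => (y : E3) 2 := by fun_prop

theorem exists_height_eq {z : ℝ} (hz : z ∈ Set.Icc (-1 : ℝ) 1) : ∃ y : S2, (y : E3) 2 = z :=
  ⟨⟨cylindrical (z, 0), by rw [mem_sphere_zero_iff_norm]; exact norm_cylindrical hz⟩, rfl⟩

theorem isPreconnected_height_preimage {J : Set ℝ} (hJ : Convex ℝ J) :
    IsPreconnected {y : S2 | (y : E3) 2 ∈ J} := by
  have h1 : IsPreconnected ((J ∩ Set.Icc (-1) 1) ×ˢ (Set.univ : Set ℝ)) :=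
    (hJ.inter (convex_Icc _ _)).isPreconnected.prod isPreconnected_univ
  have hne : ∀ p ∈ (J ∩ Set.Icc (-1) 1) ×ˢ (Set.univ : Set ℝ), cylindrical p ≠ 0 := by
    intro p hp h0
    have := norm_cylindrical hp.1.2
    rw [h0, norm_zero] at this
    norm_num at this
  have h2 := h1.image (radial ∘ cylindrical) fun p hp =>
    ((continuousAt_radial (hne p hp)).comp continuous_cylindrical.continuousAt).continuousWithinAt
  convert h2 using 1
  ext y
  constructor
  · intro hy
    obtain ⟨θ, -, hθ⟩ := exists_cylindrical y
    exact ⟨((y : E3) 2, θ), ⟨⟨hy, abs_height_le y⟩, Set.mem_univ _⟩, by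
      rw [Function.comp_apply, hθ, radial_coe]⟩
  · rintro ⟨p, hp, rfl⟩
    have h3 : (radial (cylindrical p) : E3) = cylindrical p := by
      rw [coe_radial (hne p hp), norm_cylindrical hp.1.2]; simp
    change (radial (cylindrical p) : E3) 2 ∈ J
    rw [h3]
    exact hp.1.1

/-- Coordinates `(z, θ, r)` on `ℝ³`: the point at distance `r` from the origin over the point of the
sphere with height `z` and longitude `θ`. -/
def coneCoord (u : E3) : E3 := u 2 • cylindrical (u 0, u 1)

/-- The box of coordinates of the part of the shell over the zone `a < z < b`. -/
def coneBox (a b : ℝ) : Set E3 :=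
  {u | u 0 ∈ Set.Ioo a b ∧ u 1 ∈ Set.Ioc (-Real.pi) Real.pi ∧ u 2 ∈ Set.Icc (1 / 2 : ℝ) 1}

theorem measurableSet_coneBox (a b : ℝ) : MeasurableSet (coneBox a b) := by
  have h : ∀ i : Fin 3, Measurable fun u : E3 => u i := fun i =>
    (EuclideanSpace.proj (𝕜 := ℝ) i : E3 →L[ℝ] ℝ).continuous.measurable
  exact (h 0 measurableSet_Ioo).inter ((h 1 measurableSet_Ioc).inter (h 2 measurableSet_Icc))

/-- The Jacobian of `coneCoord` does not depend on the height; this is the reason for Archimedes'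
theorem below. -/
theorem hasFDerivAt_coneCoord {u : E3} (hu : u 0 ∈ Set.Ioo (-1 : ℝ) 1) :
    ∃ D : E3 →L[ℝ] E3, HasFDerivAt coneCoord D u ∧ D.det = -u 2 ^ 2 := by
  have h0 : 0 < 1 - u 0 ^ 2 := by nlinarith [hu.1, hu.2]
  have hc : ∀ i : Fin 3, HasFDerivAt (fun y : E3 => y i)
      (EuclideanSpace.proj (𝕜 := ℝ) i : E3 →L[ℝ] ℝ) u := fun i =>
    (EuclideanSpace.proj (𝕜 := ℝ) i : E3 →L[ℝ] ℝ).hasFDerivAt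
  have hs := (((hc 0).pow 2).const_sub 1).sqrt h0.ne'
  have hx := (hc 2).mul (hs.mul (hc 1).cos)
  have hy := (hc 2).mul (hs.mul (hc 1).sin)
  have hz := (hc 2).mul (hc 0)
  have hd : DifferentiableAt ℝ coneCoord u := by
    rw [differentiableAt_euclidean]
    intro i
    fin_cases i
    · exact hx.differentiableAt
    · exact hy.differentiableAt
    · exact hz.differentiableAt
  have hcomp : ∀ (i : Fin 3) (D : E3 →L[ℝ] ℝ), HasFDerivAt (fun y => coneCoord y i) D u →
      ∀ w, (fderiv ℝ coneCoord u w) i = D w := by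
    intro i D hD w
    have h1 : HasFDerivAt (fun y => coneCoord y i)
        ((EuclideanSpace.proj (𝕜 := ℝ) i : E3 →L[ℝ] ℝ).comp (fderiv ℝ coneCoord u)) u :=
      (EuclideanSpace.proj (𝕜 := ℝ) i : E3 →L[ℝ] ℝ).hasFDerivAt.comp u hd.hasFDerivAt
    rw [← h1.unique hD]
    rfl
  refine ⟨fderiv ℝ coneCoord u, hd.hasFDerivAt, ?_⟩
  rw [det_E3_eq, Matrix.det_fin_three]
  simp only [Matrix.of_apply, hcomp 0 _ hx, hcomp 1 _ hy, hcomp 2 _ hz]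
  simp
  set s := √(1 - u 0 ^ 2) with hs'
  have hs0 : s ≠ 0 := (Real.sqrt_pos.mpr h0).ne'
  have hs2 : s ^ 2 = 1 - u 0 ^ 2 := Real.sq_sqrt h0.le
  have hcs := Real.sin_sq_add_cos_sq (u 1)
  field_simp
  linear_combination -u 2 ^ 2 * (u 0 ^ 2 + s ^ 2) * hcs - u 2 ^ 2 * hs2

theorem norm_coneCoord {u : E3} (h0 : u 0 ∈ Set.Icc (-1 : ℝ) 1) (h2 : 0 ≤ u 2) :
    ‖coneCoord u‖ = u 2 := by
  rw [coneCoord, norm_smul, norm_cylindrical h0, mul_one, Real.norm_of_nonneg h2]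

theorem coneCoord_injOn {a b : ℝ} (ha : -1 ≤ a) (hb : b ≤ 1) :
    Set.InjOn coneCoord (coneBox a b) := by
  intro u hu v hv huv
  have hu0 : u 0 ∈ Set.Ioo (-1 : ℝ) 1 := ⟨ha.trans_lt hu.1.1, hu.1.2.trans_le hb⟩
  have hv0 : v 0 ∈ Set.Ioo (-1 : ℝ) 1 := ⟨ha.trans_lt hv.1.1, hv.1.2.trans_le hb⟩
  have hu2 : 0 < u 2 := lt_of_lt_of_le (by norm_num) hu.2.2.1
  have hv2 : 0 < v 2 := lt_of_lt_of_le (by norm_num) hv.2.2.1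
  have h2 : u 2 = v 2 := by
    rw [← norm_coneCoord (Set.Ioo_subset_Icc_self hu0) hu2.le,
      ← norm_coneCoord (Set.Ioo_subset_Icc_self hv0) hv2.le, huv]
  have hcyl : cylindrical (u 0, u 1) = cylindrical (v 0, v 1) := by
    unfold coneCoord at huv
    rw [h2] at huv
    exact smul_right_injective E3 hv2.ne' huv
  have hcoord : ∀ i : Fin 3, cylindrical (u 0, u 1) i = cylindrical (v 0, v 1) i := fun i => by
    rw [hcyl]
  have h0 : u 0 = v 0 := hcoord 2
  have hs : √(1 - v 0 ^ 2) ≠ 0 := (Real.sqrt_pos.mpr (by nlinarith [hv0.1, hv0.2])).ne'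
  have hcos := hcoord 0
  have hsin := hcoord 1
  simp only [cylindrical, Matrix.cons_val_zero, Matrix.cons_val_one, h0] at hcos hsin
  have h1 := Real.Angle.cos_sin_inj (mul_left_cancel₀ hs hcos) (mul_left_cancel₀ hs hsin)
  have h1' : u 1 = v 1 := by
    rw [← Real.Angle.toReal_coe_eq_self_iff_mem_Ioc.mpr hu.2.1,
      ← Real.Angle.toReal_coe_eq_self_iff_mem_Ioc.mpr hv.2.1, h1]
  ext i
  fin_cases i
  · exact h0
  · exact h1'
  · exact h2

theorem coneCoord_image {a b : ℝ} (ha : -1 ≤ a) (hb : b ≤ 1) :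
    coneCoord '' coneBox a b = shell ∩ radial ⁻¹' {y : S2 | (y : E3) 2 ∈ Set.Ioo a b} := by
  ext x
  constructor
  · rintro ⟨u, hu, rfl⟩
    have hu0 : u 0 ∈ Set.Icc (-1 : ℝ) 1 := ⟨ha.trans hu.1.1.le, hu.1.2.le.trans hb⟩
    have hu2 : 0 < u 2 := lt_of_lt_of_le (by norm_num) hu.2.2.1
    have hn := norm_coneCoord hu0 hu2.le
    have hc : cylindrical (u 0, u 1) ≠ 0 := by
      rw [← norm_ne_zero_iff, norm_cylindrical hu0]; norm_num
    refine ⟨?_, ?_⟩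
    · change 1 / 2 ≤ ‖coneCoord u‖ ∧ ‖coneCoord u‖ ≤ 1
      rw [hn]; exact hu.2.2
    · have h1 : (radial (coneCoord u) : E3) = cylindrical (u 0, u 1) := by
        rw [coneCoord, radial_smul hu2 hc, coe_radial hc, norm_cylindrical hu0, inv_one, one_smul]
      change (radial (coneCoord u) : E3) 2 ∈ Set.Ioo a b
      rw [h1]
      exact hu.1
  · rintro ⟨hx, hz⟩
    obtain ⟨θ, hθ, hy⟩ := exists_cylindrical (radial x)
    refine ⟨!₂[(radial x : E3) 2, θ, ‖x‖], ⟨hz, hθ, hx⟩, ?_⟩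
    change ‖x‖ • cylindrical ((radial x : E3) 2, θ) = x
    rw [hy, norm_smul_radial (ne_zero_of_mem_shell hx)]

theorem measurableSet_zone (J : Set ℝ) (hJ : MeasurableSet J) :
    MeasurableSet {y : S2 | (y : E3) 2 ∈ J} := continuous_height.measurable hJ

theorem sphereMeasure_zone {a b : ℝ} (ha : -1 ≤ a) (hb : b ≤ 1) :
    sphereMeasure {y : S2 | (y : E3) 2 ∈ Set.Ioo a b} =
      ∫⁻ u in coneBox a b, ENNReal.ofReal (u 2 ^ 2) := by
  rw [sphereMeasure_apply (measurableSet_zone _ measurableSet_Ioo), ← coneCoord_image ha hb]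
  have hd : ∀ u ∈ coneBox a b, ∃ D : E3 →L[ℝ] E3, HasFDerivAt coneCoord D u ∧ D.det = -u 2 ^ 2 :=
    fun u hu => hasFDerivAt_coneCoord ⟨ha.trans_lt hu.1.1, hu.1.2.trans_le hb⟩
  choose! D hD hdet using hd
  rw [← MeasureTheory.lintegral_abs_det_fderiv_eq_addHaar_image MeasureTheory.volume
    (measurableSet_coneBox a b) (fun u hu => (hD u hu).hasFDerivWithinAt) (coneCoord_injOn ha hb)]
  refine MeasureTheory.setLIntegral_congr_fun (measurableSet_coneBox a b) fun u hu => ?_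
  simp only [hdet u hu, abs_neg, abs_pow, sq_abs]

/-- Archimedes' hat-box theorem: the area of a zone of the sphere depends on its height only. -/
theorem sphereMeasure_zone_shift {a b s : ℝ} (ha : -1 ≤ a) (hb : b ≤ 1) (ha' : -1 ≤ a + s)
    (hb' : b + s ≤ 1) : sphereMeasure {y : S2 | (y : E3) 2 ∈ Set.Ioo a b} =
      sphereMeasure {y : S2 | (y : E3) 2 ∈ Set.Ioo (a + s) (b + s)} := by
  rw [sphereMeasure_zone ha hb, sphereMeasure_zone ha' hb']
  have h := (MeasureTheory.measurePreserving_add_right MeasureTheory.volume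
    (EuclideanSpace.single 0 s : E3)).setLIntegral_comp_preimage
    (measurableSet_coneBox (a + s) (b + s)) (f := fun u : E3 => ENNReal.ofReal (u 2 ^ 2))
    (((EuclideanSpace.proj (𝕜 := ℝ) 2 : E3 →L[ℝ] ℝ).continuous.measurable.pow_const 2).ennreal_ofReal)
  rw [← h]
  have hpre : (fun u : E3 => u + EuclideanSpace.single 0 s) ⁻¹' coneBox (a + s) (b + s) =
      coneBox a b := by
    ext u
    simp [coneBox]
  rw [hpre]
  simp

/-! ### Non-displaceability of pairs of circles bounding large caps -/

/-- A closed subset of full measure of an open set is the whole set, if nonempty open sets have positive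
measure. -/
theorem eq_of_subset_of_measure_le {X : Type*} [TopologicalSpace X] [MeasurableSpace X]
    {μ : MeasureTheory.Measure X} [MeasureTheory.IsFiniteMeasure μ] [OpensMeasurableSpace X]
    (hpos : ∀ U : Set X, IsOpen U → U.Nonempty → 0 < μ U) {A W : Set X} (hA : IsClosed A)
    (hW : IsOpen W) (hAW : A ⊆ W) (hμ : μ W ≤ μ A) : A = W := by
  have h0 : μ (W \ A) = 0 := by
    rw [MeasureTheory.measure_sdiff hAW hA.measurableSet.nullMeasurableSet
      (MeasureTheory.measure_ne_top _ _)]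
    exact tsub_eq_zero_of_le hμ
  by_contra hne
  have hn : (W \ A).Nonempty := by
    rw [Set.sdiff_nonempty]
    exact fun h => hne (hAW.antisymm h)
  exact (hpos _ (hW.sdiff hA) hn).ne' h0

instance : ConnectedSpace S2 := by
  have h : IsPreconnected (Set.univ : Set S2) := by
    simpa using isPreconnected_height_preimage (J := Set.univ) convex_univ
  exact { toPreconnectedSpace := ⟨h⟩, toNonempty := inferInstance }

/-- A continuous injective self-map of the sphere that does not decrease the measure of compact
sets. The time-one map of a Hamiltonian isotopy has these properties. -/
structure IsAreaNondecreasing (f : S2 → S2) : Prop where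
  continuous : Continuous f
  injective : Function.Injective f
  le_image : ∀ T : Set S2, IsCompact T → sphereMeasure T ≤ sphereMeasure (f '' T)

namespace IsAreaNondecreasing

variable {f : S2 → S2}

theorem isClosed_image (hf : IsAreaNondecreasing f) {T : Set S2} (hT : IsClosed T) :
    IsClosed (f '' T) :=
  (hT.isCompact.image hf.continuous).isClosed

theorem surjective (hf : IsAreaNondecreasing f) : Function.Surjective f := by
  rw [← Set.range_eq_univ, ← Set.image_univ]
  exact eq_of_subset_of_measure_le (fun U hU hn => sphereMeasure_pos hU hn)
    (hf.isClosed_image isClosed_univ) isOpen_univ (Set.subset_univ _)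
    (hf.le_image _ isCompact_univ)

theorem image_compl (hf : IsAreaNondecreasing f) (T : Set S2) : f '' Tᶜ = (f '' T)ᶜ :=
  Set.image_compl_eq ⟨hf.injective, hf.surjective⟩

theorem isOpen_image (hf : IsAreaNondecreasing f) {U : Set S2} (hU : IsOpen U) : IsOpen (f '' U) := by
  rw [← isClosed_compl_iff, ← hf.image_compl]
  exact hf.isClosed_image hU.isClosed_compl

theorem image_le (hf : IsAreaNondecreasing f) {U : Set S2} (hU : IsOpen U) :
    sphereMeasure (f '' U) ≤ sphereMeasure U := by
  have h1 := hf.le_image Uᶜ hU.isClosed_compl.isCompact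
  rw [hf.image_compl] at h1
  have h2 := MeasureTheory.measure_add_measure_compl hU.measurableSet (μ := sphereMeasure)
  have h3 := MeasureTheory.measure_add_measure_compl (hf.isOpen_image hU).measurableSet
    (μ := sphereMeasure)
  have h4 : sphereMeasure (f '' U) + sphereMeasure Uᶜ ≤ sphereMeasure U + sphereMeasure Uᶜ := by
    rw [h2, ← h3]
    gcongr
  exact (ENNReal.add_le_add_iff_right (MeasureTheory.measure_ne_top _ _)).mp h4

/-- The boundary of an open cap `Z` with closure `Z'` is not mapped into a cap `W` of the same
area: otherwise either the complement of `W`, which is connected and too large, is contained in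
`f '' Z`, or the image of `Z'` fills the proper open set `W`. -/
theorem not_boundary_subset (hf : IsAreaNondecreasing f) {Z Z' W : Set S2} (hZ : IsOpen Z)
    (hZ' : IsClosed Z') (hZZ' : Z ⊆ Z') (hZne : Z.Nonempty) (hW : IsOpen W)
    (hWc : IsPreconnected Wᶜ) (hWne : Wᶜ.Nonempty) (hZW : sphereMeasure Z = sphereMeasure W)
    (hlt : sphereMeasure W < sphereMeasure Wᶜ) : ¬ f '' (Z' \ Z) ⊆ W := by
  intro h
  have hcover : Wᶜ ⊆ f '' Z ∪ f '' Z'ᶜ := by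
    intro y hy
    obtain ⟨x, rfl⟩ := hf.surjective y
    by_cases hx : x ∈ Z
    · exact Or.inl ⟨x, hx, rfl⟩
    · refine Or.inr ⟨x, fun hx' => hy (h ⟨x, ⟨hx', hx⟩, rfl⟩), rfl⟩
  have hdisj : Disjoint (f '' Z) (f '' Z'ᶜ) :=
    (Set.disjoint_image_iff hf.injective).mpr
      (Set.disjoint_left.mpr fun x hx hx' => hx' (hZZ' hx))
  rcases hWc.subset_or_subset (hf.isOpen_image hZ) (hf.isOpen_image hZ'.isOpen_compl) hdisj hcover
    with h1 | h1
  · have := (MeasureTheory.measure_mono h1).trans (hf.image_le hZ)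
    rw [hZW] at this
    exact absurd hlt this.not_gt
  · have h2 : f '' Z' ⊆ W := by
      rw [hf.image_compl, Set.compl_subset_compl] at h1
      exact h1
    have h3 : f '' Z' = W := by
      refine eq_of_subset_of_measure_le (fun U hU hn => sphereMeasure_pos hU hn)
        (hf.isClosed_image hZ') hW h2 ?_
      rw [← hZW]
      exact (MeasureTheory.measure_mono hZZ').trans (hf.le_image _ hZ'.isCompact)
    rcases isClopen_iff.mp ⟨h3 ▸ hf.isClosed_image hZ', hW⟩ with h4 | h4
    · rw [h4, Set.image_eq_empty] at h3
      exact (hZne.mono hZZ').ne_empty h3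
    · rw [h4, Set.compl_univ] at hWne
      exact Set.not_nonempty_empty hWne

/-- A closed set that is not clopen is not contained in the image of an open set of at most the
same measure. -/
theorem not_subset_image (hf : IsAreaNondecreasing f) {Z A : Set S2} (hZ : IsOpen Z)
    (hA : IsClosed A) (hle : sphereMeasure Z ≤ sphereMeasure A) (hne : A.Nonempty)
    (hne' : Aᶜ.Nonempty) : ¬ A ⊆ f '' Z := by
  intro h
  have h1 := eq_of_subset_of_measure_le (fun U hU hn => sphereMeasure_pos hU hn) hA
    (hf.isOpen_image hZ) h ((hf.image_le hZ).trans hle)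
  rcases isClopen_iff.mp ⟨hA, h1 ▸ hf.isOpen_image hZ⟩ with h4 | h4
  · exact hne.ne_empty h4
  · rw [h4, Set.compl_univ] at hne'
    exact Set.not_nonempty_empty hne'

end IsAreaNondecreasing

/-- The zone of points of the sphere with height in `J`. -/
def zone (J : Set ℝ) : Set S2 := {y | (y : E3) 2 ∈ J}

theorem isOpen_zone {J : Set ℝ} (hJ : IsOpen J) : IsOpen (zone J) := hJ.preimage continuous_height

theorem isClosed_zone {J : Set ℝ} (hJ : IsClosed J) : IsClosed (zone J) :=
  hJ.preimage continuous_height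

theorem isPreconnected_zone {J : Set ℝ} (hJ : Convex ℝ J) : IsPreconnected (zone J) :=
  isPreconnected_height_preimage hJ

theorem zone_mono {J J' : Set ℝ} (h : J ⊆ J') : zone J ⊆ zone J' := fun _ hy => h hy

theorem zone_compl (J : Set ℝ) : (zone J)ᶜ = zone Jᶜ := rfl

theorem zone_nonempty {J : Set ℝ} {z : ℝ} (hz : z ∈ J) (hz' : z ∈ Set.Icc (-1 : ℝ) 1) :
    (zone J).Nonempty := by
  obtain ⟨y, rfl⟩ := exists_height_eq hz'
  exact ⟨y, hz⟩

instance : MeasureTheory.NullSingletonClass sphereMeasure where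
  measure_singleton y := by
    rw [sphereMeasure_apply (measurableSet_singleton y)]
    refine MeasureTheory.measure_mono_null (t := (Submodule.span ℝ {(y : E3)} : Set E3)) ?_
      (MeasureTheory.Measure.addHaar_submodule _ _ fun h => ?_)
    · rintro x ⟨hx, rfl⟩
      exact Submodule.mem_span_singleton.mpr ⟨‖x‖, norm_smul_radial (ne_zero_of_mem_shell hx)⟩
    · have h1 := finrank_span_singleton (K := ℝ) (coe_S2_ne_zero y)
      rw [h, finrank_top, finrank_euclideanSpace_fin] at h1
      norm_num at h1

theorem subsingleton_pole {z : ℝ} (hz : z ^ 2 = 1) : (zone {z}).Subsingleton := by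
  have h : ∀ y ∈ zone {z}, (y : E3) 0 = 0 ∧ (y : E3) 1 = 0 ∧ (y : E3) 2 = z := by
    intro y hy
    have h2 : (y : E3) 2 = z := hy
    have h3 := S2_normSq y
    rw [h2, hz] at h3
    refine ⟨?_, ?_, h2⟩ <;> nlinarith [sq_nonneg ((y : E3) 0), sq_nonneg ((y : E3) 1)]
  intro y hy y' hy'
  obtain ⟨a0, a1, a2⟩ := h y hy
  obtain ⟨b0, b1, b2⟩ := h y' hy'
  ext i
  fin_cases i
  · exact a0.trans b0.symm
  · exact a1.trans b1.symm
  · exact a2.trans b2.symm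

theorem sphereMeasure_zone_Ioi (a : ℝ) :
    sphereMeasure (zone (Set.Ioi a)) = sphereMeasure (zone (Set.Ioo a 1)) := by
  refine le_antisymm ?_ (MeasureTheory.measure_mono (zone_mono Set.Ioo_subset_Ioi_self))
  have h1 : zone (Set.Ioi a) ⊆ zone (Set.Ioo a 1) ∪ zone {1} := by
    intro y hy
    rcases (abs_height_le y).2.lt_or_eq with h | h
    · exact Or.inl ⟨hy, h⟩
    · exact Or.inr h
  refine (MeasureTheory.measure_mono h1).trans ((MeasureTheory.measure_union_le _ _).trans ?_)
  rw [(subsingleton_pole (by norm_num)).measure_zero, add_zero]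

theorem sphereMeasure_zone_Iio (a : ℝ) :
    sphereMeasure (zone (Set.Iio a)) = sphereMeasure (zone (Set.Ioo (-1) a)) := by
  refine le_antisymm ?_ (MeasureTheory.measure_mono (zone_mono Set.Ioo_subset_Iio_self))
  have h1 : zone (Set.Iio a) ⊆ zone (Set.Ioo (-1) a) ∪ zone {-1} := by
    intro y hy
    rcases (abs_height_le y).1.lt_or_eq with h | h
    · exact Or.inl ⟨h, hy⟩
    · exact Or.inr h.symm
  refine (MeasureTheory.measure_mono h1).trans ((MeasureTheory.measure_union_le _ _).trans ?_)
  rw [(subsingleton_pole (by norm_num)).measure_zero, add_zero]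

theorem sphereMeasure_caps_eq {ε : ℝ} (h0 : 0 < ε) (h1 : ε < 1) :
    sphereMeasure (zone (Set.Iio (-ε))) = sphereMeasure (zone (Set.Ioi ε)) := by
  rw [sphereMeasure_zone_Ioi, sphereMeasure_zone_Iio]
  have h := sphereMeasure_zone_shift (a := -1) (b := -ε) (s := 1 + ε) le_rfl (by linarith)
    (by linarith) (by linarith)
  rw [show -1 + (1 + ε) = ε by ring, show -ε + (1 + ε) = 1 by ring] at h
  exact h

/-- If `ε < 1/3`, the zone `|z| < ε` has smaller area than the cap `z > ε`: it has the area of the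
zone `ε < z < 3ε`. -/
theorem sphereMeasure_middle_lt {ε : ℝ} (h0 : 0 < ε) (h1 : ε < 1 / 3) :
    sphereMeasure (zone (Set.Ioo (-ε) ε)) < sphereMeasure (zone (Set.Ioi ε)) := by
  have h := sphereMeasure_zone_shift (a := -ε) (b := ε) (s := 2 * ε) (by linarith) (by linarith)
    (by linarith) (by linarith)
  rw [show -ε + 2 * ε = ε by ring, show ε + 2 * ε = 3 * ε by ring] at h
  change sphereMeasure (zone (Set.Ioo (-ε) ε)) = sphereMeasure (zone (Set.Ioo ε (3 * ε))) at h
  rw [h]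
  have hpos := sphereMeasure_pos (isOpen_zone (isOpen_Ioi (a := 3 * ε)))
    (zone_nonempty (z := 1) (Set.mem_Ioi.mpr (by linarith)) (by norm_num))
  have hdisj : Disjoint (zone (Set.Ioo ε (3 * ε))) (zone (Set.Ioi (3 * ε))) :=
    Set.disjoint_left.mpr fun y hy hy' => absurd hy.2 (not_lt.mpr (le_of_lt hy'))
  calc sphereMeasure (zone (Set.Ioo ε (3 * ε)))
      < sphereMeasure (zone (Set.Ioo ε (3 * ε))) + sphereMeasure (zone (Set.Ioi (3 * ε))) :=
        ENNReal.lt_add_right (MeasureTheory.measure_ne_top _ _) hpos.ne'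
    _ = sphereMeasure (zone (Set.Ioo ε (3 * ε)) ∪ zone (Set.Ioi (3 * ε))) :=
        (MeasureTheory.measure_union hdisj (isOpen_zone isOpen_Ioi).measurableSet).symm
    _ ≤ _ := by
        refine MeasureTheory.measure_mono ?_
        rintro y (hy | hy)
        · exact hy.1
        · have : 3 * ε < (y : E3) 2 := hy
          change ε < (y : E3) 2
          linarith

/-- If `C` is mapped off itself, each of the two circles is mapped into one of the three components
of the complement of `C`. Neither can go to a cap, by `not_boundary_subset`. If both go to the
middle zone, the cap `z ≥ ε` lies in the image of one of the three components, none of which has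
enough area. -/
theorem IsAreaNondecreasing.not_disjoint_circlePair {f : S2 → S2} (hf : IsAreaNondecreasing f)
    {ε : ℝ} (h0 : 0 < ε) (h1 : ε < 1 / 3) : ¬ Disjoint (circlePair ε) (f '' circlePair ε) := by
  intro hdisj
  set U := zone (Set.Ioi ε) with hU
  set A := zone (Set.Ioo (-ε) ε) with hA
  set D := zone (Set.Iio (-ε)) with hD
  have hUo : IsOpen U := isOpen_zone isOpen_Ioi
  have hAo : IsOpen A := isOpen_zone isOpen_Ioo
  have hDo : IsOpen D := isOpen_zone isOpen_Iio
  have hUA : Disjoint U A := Set.disjoint_left.mpr fun y hy hy' => lt_asymm hy hy'.2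
  have hUD : Disjoint U D := Set.disjoint_left.mpr fun y (hy : ε < _) (hy' : _ < -ε) => by linarith
  have hAD : Disjoint A D := Set.disjoint_left.mpr fun y hy hy' => lt_asymm hy.1 hy'
  have htri : ∀ y, y ∉ circlePair ε → y ∈ U ∪ (A ∪ D) := by
    intro y hy
    rcases lt_trichotomy ((y : E3) 2) ε with h | h | h
    · rcases lt_trichotomy ((y : E3) 2) (-ε) with h' | h' | h'
      · exact Or.inr (Or.inr h')
      · exact absurd (Or.inr h') hy
      · exact Or.inr (Or.inl ⟨h', h⟩)
    · exact absurd (Or.inl h) hy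
    · exact Or.inl h
  have hcaps : sphereMeasure D = sphereMeasure U := sphereMeasure_caps_eq h0 (by linarith)
  have hmid : sphereMeasure A < sphereMeasure U := sphereMeasure_middle_lt h0 h1
  have hUne : U.Nonempty := zone_nonempty (z := 1) (Set.mem_Ioi.mpr (by linarith)) (by norm_num)
  have hDne : D.Nonempty := zone_nonempty (z := -1) (Set.mem_Iio.mpr (by linarith)) (by norm_num)
  have hApos : 0 < sphereMeasure A := sphereMeasure_pos hAo
    (zone_nonempty (z := 0) ⟨by linarith, h0⟩ (by norm_num))
  have hlt : ∀ W W' : Set S2, sphereMeasure W = sphereMeasure W' → IsOpen W' → Disjoint W A →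
      Disjoint W W' → Disjoint A W' → sphereMeasure W < sphereMeasure Wᶜ := by
    intro W W' he hW' hWA hWW' hAW'
    calc sphereMeasure W = sphereMeasure W' := he
      _ < sphereMeasure A + sphereMeasure W' := by
        rw [add_comm]
        exact ENNReal.lt_add_right (MeasureTheory.measure_ne_top _ _) hApos.ne'
      _ = sphereMeasure (A ∪ W') := (MeasureTheory.measure_union hAW' hW'.measurableSet).symm
      _ ≤ sphereMeasure Wᶜ := MeasureTheory.measure_mono
        (Set.union_subset hWA.symm.subset_compl_right hWW'.symm.subset_compl_right)
  have hUc : IsPreconnected Uᶜ := by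
    rw [hU, zone_compl, Set.compl_Ioi]; exact isPreconnected_zone (convex_Iic ε)
  have hDc : IsPreconnected Dᶜ := by
    rw [hD, zone_compl, Set.compl_Iio]; exact isPreconnected_zone (convex_Ici (-ε))
  have hUlt := hlt U D hcaps.symm hDo hUA hUD hAD
  have hDlt := hlt D U hcaps hUo hAD.symm hUD.symm hUA.symm
  have hUcne : Uᶜ.Nonempty := hDne.mono hUD.symm.subset_compl_right
  have hDcne : Dᶜ.Nonempty := hUne.mono hUD.subset_compl_right
  -- each circle is mapped into the middle zone
  have hcircle : ∀ z : ℝ, zone {z} ⊆ circlePair ε → ∀ Z Z' : Set S2, IsOpen Z → IsClosed Z' →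
      Z ⊆ Z' → Z.Nonempty → Z' \ Z = zone {z} → sphereMeasure Z = sphereMeasure U →
      f '' zone {z} ⊆ A := by
    intro z hz Z Z' hZ hZ' hZZ' hZne hbd hZμ
    have hconn : IsPreconnected (f '' zone {z}) :=
      (isPreconnected_zone (convex_singleton z)).image f hf.continuous.continuousOn
    have hsub : f '' zone {z} ⊆ U ∪ (A ∪ D) := fun y hy =>
      htri y (Set.disjoint_right.mp hdisj (Set.image_mono hz hy))
    rcases hconn.subset_or_subset hUo (hAo.union hDo)
      (Set.disjoint_union_right.mpr ⟨hUA, hUD⟩) hsub with h | h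
    · rw [← hbd] at h
      exact absurd h (hf.not_boundary_subset hZ hZ' hZZ' hZne hUo hUc hUcne hZμ hUlt)
    · rcases hconn.subset_or_subset hAo hDo hAD h with h | h
      · exact h
      · rw [← hbd] at h
        exact absurd h (hf.not_boundary_subset hZ hZ' hZZ' hZne hDo hDc hDcne
          (hZμ.trans hcaps.symm) hDlt)
  have hplus : f '' zone {ε} ⊆ A := by
    refine hcircle ε (fun y hy => Or.inl hy) U (zone (Set.Ici ε)) hUo (isClosed_zone isClosed_Ici)
      (zone_mono Set.Ioi_subset_Ici_self) hUne ?_ rfl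
    change zone (Set.Ici ε \ Set.Ioi ε) = _
    rw [Set.Ici_sdiff_Ioi_same]
  have hminus : f '' zone {-ε} ⊆ A := by
    refine hcircle (-ε) (fun y hy => Or.inr hy) D (zone (Set.Iic (-ε))) hDo
      (isClosed_zone isClosed_Iic) (zone_mono Set.Iio_subset_Iic_self) hDne ?_ hcaps
    change zone (Set.Iic (-ε) \ Set.Iio (-ε)) = _
    rw [Set.Iic_sdiff_Iio_same]
  -- hence the closed cap `z ≥ ε` avoids the images of both circles
  set T := zone (Set.Ici ε) with hT
  have hTA : Disjoint T A := Set.disjoint_left.mpr fun y (hy : ε ≤ _) hy' => not_lt.mpr hy hy'.2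
  have hTc : IsPreconnected T := isPreconnected_zone (convex_Ici ε)
  have hUT : U ⊆ T := zone_mono Set.Ioi_subset_Ici_self
  have hTμ : sphereMeasure U ≤ sphereMeasure T := MeasureTheory.measure_mono hUT
  have hTcl : IsClosed T := isClosed_zone isClosed_Ici
  have hTne' : Tᶜ.Nonempty := zone_nonempty (z := 0) (J := (Set.Ici ε)ᶜ)
    (by simpa using h0) (by norm_num)
  have hcover : T ⊆ f '' U ∪ (f '' A ∪ f '' D) := by
    intro y hy
    obtain ⟨x, rfl⟩ := hf.surjective y
    have hx : x ∉ circlePair ε := by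
      rintro (hx | hx)
      · exact Set.disjoint_left.mp hTA hy (hplus ⟨x, hx, rfl⟩)
      · exact Set.disjoint_left.mp hTA hy (hminus ⟨x, hx, rfl⟩)
    rw [← Set.image_union, ← Set.image_union]
    exact ⟨x, htri x hx, rfl⟩
  have hi : ∀ {P Q : Set S2}, Disjoint P Q → Disjoint (f '' P) (f '' Q) := fun h =>
    (Set.disjoint_image_iff hf.injective).mpr h
  rcases hTc.subset_or_subset (hf.isOpen_image hUo)
    ((hf.isOpen_image hAo).union (hf.isOpen_image hDo))
    (Set.disjoint_union_right.mpr ⟨hi hUA, hi hUD⟩) hcover with h | h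
  · exact hf.not_subset_image hUo hTcl hTμ (hUne.mono hUT) hTne' h
  · rcases hTc.subset_or_subset (hf.isOpen_image hAo) (hf.isOpen_image hDo) (hi hAD) h with h | h
    · exact hf.not_subset_image hAo hTcl (hmid.le.trans hTμ) (hUne.mono hUT) hTne' h
    · exact hf.not_subset_image hDo hTcl (hcaps.le.trans hTμ) (hUne.mono hUT) hTne' h

theorem not_displaceable_circlePair {ε : ℝ} (h0 : 0 < ε) (h1 : ε < 1 / 3) :
    ¬ Displaceable areaForm (circlePair ε) := by
  rintro ⟨F, φ, hF, hφ, hdisj⟩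
  rw [(isClosed_circlePair ε).closure_eq] at hdisj
  have hf : IsAreaNondecreasing (φ 1) := ⟨continuous_timeOne hF hφ, injective_timeOne hF hφ,
    fun _ hT => sphereMeasure_le_image hF hφ hT⟩
  exact hf.not_disjoint_circlePair h0 h1 hdisj

theorem mainTheorem6 :
    (∀ ε : ℝ, 0 < ε → StablyDisplaceable areaForm (circlePair ε)) ∧
    (∃ E : ℝ, 0 < E ∧ ∀ ε : ℝ, 0 < ε →
      ∀ (n : ℕ) (R : Fin n → {r : ℝ // 0 < r}) (e : Fin n → ℤ),
        (∃ k, E < (R k : ℝ) ∧ e k ≠ 0) →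
          relativeCapacity areaForm (circlePair ε) R e = ⊤) ∧
    (∀ ε : ℝ, 0 < ε → ε < 1 / 3 → ¬ Displaceable areaForm (circlePair ε)) ∧
    (∀ n : ℕ, 1 ≤ n → ¬ NonDisplaceableCapacityFormula n) := by
  refine ⟨fun ε hε => nStablyDisplaceable_circlePair 0 hε, relativeCapacity_circlePair_eq_top,
    fun ε h0 h1 => not_displaceable_circlePair h0 h1, fun n hn h => ?_⟩
  obtain ⟨E, hE, htop⟩ := relativeCapacity_circlePair_eq_top
  have h1 := h 2 S2 areaForm areaForm_isSymplectic (circlePair (1 / 4))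
    (isClosed_circlePair (1 / 4)).isCompact
    (not_displaceable_circlePair (by norm_num) (by norm_num))
    (fun _ => ⟨E + 1, by linarith⟩) (fun _ => 1)
  rw [htop (1 / 4) (by norm_num) n _ _ ⟨⟨0, hn⟩, by simp, one_ne_zero⟩] at h1
  exact ENNReal.ofReal_ne_top h1.symm

end
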